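/- Let $d\ge 1$, $\lambda>0$, $T>0$. For $\mathsf m\in\mathbb N^d$ put $E_{\mathsf m,\lambda}=(\sum_j m_j+\frac d2)\lambda$ and $\mathsf h_{\mathsf m,\lambda}(\mathsf x)=\prod_{j}\sqrt[4]{\lambda}\,h_{m_j}(\sqrt\lambda x_j)$, where $h_m(x)=(-1)^m(\pi^{1/2}2^m m!)^{-1/2}e^{x^2/2}\frac{d^m}{dx^m}e^{-x^2}$; these are eigenfunctions, with eigenvalues $E_{\mathsf m,\lambda}$, of the isotropic harmonic oscillator $H=-\frac12\Delta+\frac{\lambda^2}2|\mathsf x|^2$. For $t>0$ let $$g_\lambda(\mathsf x,t,\mathsf y)=\Big(\frac{2\pi\sinh(\lambda t)}{\lambda}\Big)^{-d/2}\exp\Big[-\frac{\lambda(\cosh(\lambda t)(|\mathsf x|^2+|\mathsf y|^2)-2(\mathsf x,\mathsf y))}{2\sinh(\lambda t)}\Big]=\sum_{\mathsf m}e^{-tE_{\mathsf m,\lambda}}\mathsf h_{\mathsf m,\lambda}(\mathsf x)\mathsf h_{\mathsf m,\lambda}(\mathsf y)$$ be Mehler's kernel, the integral kernel of $e^{-tH}$.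 Let $\mathcal Z_\lambda(T)=\sum_{\mathsf m}e^{-TE_{\mathsf m,\lambda}}$, let $p_{\mathsf m}=\mathcal Z_\lambda(T)^{-1}e^{-TE_{\mathsf m,\lambda}}$ be the Gibbs weights, which are positive with sum $1$, and for each $\mathsf m$ let $\mu_{\mathsf m}$ be the signed measure on $\mathbb R^d\times\mathbb R^d$ with integrable density $\varphi_{\mathsf m,0}(\mathsf x)g_\lambda(\mathsf x,T,\mathsf y)\psi_{\mathsf m,T}(\mathsf y)$, where $\varphi_{\mathsf m,0}=\mathsf h_{\mathsf m,\lambda}$ and $\psi_{\mathsf m,T}=e^{TE_{\mathsf m,\lambda}}\mathsf h_{\mathsf m,\lambda}$. Let $\bar\mu$ be the probability measure $\mathcal Z_\lambda(T)^{-1}g_\lambda(\mathsf x,T,\mathsf y)\,\delta(\mathsf x-\mathsf y)\,d\mathsf x\,d\mathsf y$; it is the mixture of the $\mu_{\mathsf m}$ in the sense that $\bar\mu(F_0\times F_T)=\sum_{\mathsf m}p_{\mathsf m}\mu_{\mathsf m}(F_0\times F_T)$ for all Borel sets $F_0,F_T$. Let $\bar Z^\lambda=(\bar Z^\lambda_\tau)_{\tau\in[0,T]}$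 be the $\mathbb R^d$-valued process generated by $g_\lambda$ and $\bar\mu$, that is, with law given, for all $n\ge 0$, $0=t_0<t_1<\dots<t_n<T$, Borel sets $F_0,F_1,\dots,F_n,F_T$ and $\mathsf x_0=\mathsf x$, by $$\mathbb P_{\bar\mu}(\bar Z_0\in F_0,\bar Z_{t_1}\in F_1,\dots,\bar Z_{t_n}\in F_n,\bar Z_T\in F_T)=\int_{F_0\times F_T}\frac{d\bar\mu(\mathsf x,\mathsf y)}{g_\lambda(\mathsf x,T,\mathsf y)}\int_{F_1}d\mathsf x_1\cdots\int_{F_n}d\mathsf x_n\prod_{k=1}^n g_\lambda(\mathsf x_k,t_k-t_{k-1},\mathsf x_{k-1})\;g_\lambda(\mathsf y,T-t_n,\mathsf x_n).$$ Such a process exists on some complete probability space. Every such process is a Bernstein process, that is, $\mathbb E(b(Z_r)\mid\sigma(Z_\tau:\tau\le s)\vee\sigma(Z_\tau:\tau\ge t))=\mathbb E(b(Z_r)\mid Z_s,Z_t)$ for all bounded Borel $b:\mathbb R^d\to\mathbb C$ and $0\le s<r<t\le T$, and its two-sided transition function is $$\mathbb P(Z_r\in F\mid Z_s,Z_t)=\int_F\frac{g_\lambda(Z_t,t-r,\mathsf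 z)\,g_\lambda(\mathsf z,r-s,Z_s)}{g_\lambda(Z_t,t-s,Z_s)}\,d\mathsf z .$$ It is stationary, non-Markovian, Gaussian and centered, and the following statements are valid. (a) For each $t\in[0,T]$ and every Borel set $F$, $$\mathbb P_{\bar\mu}(\bar Z_t^\lambda\in F)=(2\pi\sigma_\lambda)^{-d/2}\int_F e^{-|\mathsf x|^2/(2\sigma_\lambda)}\,d\mathsf x,\qquad \sigma_\lambda=\frac{\sinh(\lambda T)}{2\lambda(\cosh(\lambda T)-1)}.$$ (b) For all $s,t\in[0,T]$ and $i,j\in\{1,\dots,d\}$, $$\mathbb E_{\bar\mu}\big(\bar Z_s^{\lambda,i}\bar Z_t^{\lambda,j}\big)=\frac{\cosh(\lambda(|t-s|-\frac T2))}{2\lambda\sinh(\frac{\lambda T}2)}\,\delta_{i,j}.$$ (c) Let $\mathcal R_\lambda f=\sum_{\mathsf m}p_{\mathsf m}(f,\mathsf h_{\mathsf m,\lambda})_2\,\mathsf h_{\mathsf m,\lambda}$ be the Gibbs density operator on the complex space $L^2(\mathbb R^d)$, and let $Bf=bf$ be multiplication by a real-valued $b\in L^\infty(\mathbb R^d)$.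 Then $\mathcal R_\lambda B$ is of trace class and, for every $t\in[0,T]$, $$\mathrm{Tr}(\mathcal R_\lambda B)=\mathbb E_{\bar\mu}(b(\bar Z_t^\lambda))=(2\pi\sigma_\lambda)^{-d/2}\int_{\mathbb R^d}b(\mathsf x)\,e^{-|\mathsf x|^2/(2\sigma_\lambda)}\,d\mathsf x.$$ Moreover, $\bar Z^\lambda$ is identical in law (same finite-dimensional distributions) with the periodic Ornstein–Uhlenbeck process: for every Wiener process $\mathsf W$ in $\mathbb R^d$, the process $$X_t=\frac{e^{-\lambda t}}{1-e^{-\lambda T}}\int_0^Te^{-\lambda(T-\tau)}\,d\mathsf W_\tau+\int_0^te^{-\lambda(t-\tau)}\,d\mathsf W_\tau,\qquad t\in[0,T],$$ (with forward Itô integrals) is well defined and has the same law as $\bar Z^\lambda$. -/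

import Mathlib

open MeasureTheory ProbabilityTheory Filter Topology
open scoped ENNReal NNReal InnerProductSpace

noncomputable section

namespace PeriodicOU

/-- The state space `ℝᵈ` with its Euclidean norm. -/
abbrev E (d : ℕ) : Type := EuclideanSpace ℝ (Fin d)

/-- The complex Hilbert space `L²(ℝᵈ)`. -/
abbrev L2 (d : ℕ) : Type := Lp ℂ 2 (volume : Measure (E d))

/-! ### The isotropic harmonic oscillator -/

/-- Mehler's kernel `g_λ(x, t, y)` in dimension `d` (meaningful for `t > 0`). -/
def mehler {d : ℕ} (lam : ℝ) (x : E d) (t : ℝ) (y : E d) : ℝ :=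
  (2 * Real.pi * Real.sinh (lam * t) / lam) ^ (-(d : ℝ) / 2) *
    Real.exp (-(lam * (Real.cosh (lam * t) * (‖x‖ ^ 2 + ‖y‖ ^ 2) - 2 * ⟪x, y⟫_ℝ)) /
      (2 * Real.sinh (lam * t)))

/-- The one-dimensional Hermite function of degree `m`. -/
def hermite1 (m : ℕ) (x : ℝ) : ℝ :=
  (-1) ^ m * (Real.sqrt Real.pi * 2 ^ m * (m.factorial : ℝ)) ^ (-(1 : ℝ) / 2) *
    Real.exp (x ^ 2 / 2) * iteratedDeriv m (fun y : ℝ => Real.exp (-y ^ 2)) x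

/-- The scaled product Hermite function `h_{m,λ}` on `ℝᵈ`. -/
def hermiteFn {d : ℕ} (lam : ℝ) (m : Fin d → ℕ) (x : E d) : ℝ :=
  ∏ j, lam ^ ((1 : ℝ) / 4) * hermite1 (m j) (Real.sqrt lam * x j)

/-- The energy level `E_{m,λ} = (m₁ + ⋯ + m_d + d/2) λ`. -/
def energy {d : ℕ} (lam : ℝ) (m : Fin d → ℕ) : ℝ :=
  ((∑ j, (m j : ℝ)) + (d : ℝ) / 2) * lam

/-- The partition function `𝒵_λ(T)`. -/
def partitionFn (d : ℕ) (lam T : ℝ) : ℝ :=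
  ∑' m : Fin d → ℕ, Real.exp (-(T * energy lam m))

/-- The Gibbs weights `p_m`. -/
def gibbsWeight {d : ℕ} (lam T : ℝ) (m : Fin d → ℕ) : ℝ :=
  (partitionFn d lam T)⁻¹ * Real.exp (-(T * energy lam m))

/-- The initial datum `φ_{m,0}`. -/
def initialDatum {d : ℕ} (lam : ℝ) (m : Fin d → ℕ) (x : E d) : ℝ := hermiteFn lam m x

/-- The final datum `ψ_{m,T}`. -/
def finalDatum {d : ℕ} (lam T : ℝ) (m : Fin d → ℕ) (x : E d) : ℝ :=
  Real.exp (T * energy lam m) * hermiteFn lam m x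

/-- The joint density `μ_m(x, y) = φ_{m,0}(x) g_λ(x, T, y) ψ_{m,T}(y)` of a signed measure. -/
def levelDensity {d : ℕ} (lam T : ℝ) (m : Fin d → ℕ) (p : E d × E d) : ℝ :=
  initialDatum lam m p.1 * mehler lam p.1 T p.2 * finalDatum lam T m p.2

/-- The mixed measure `𝒵_λ(T)⁻¹ g_λ(x, T, y) δ(x - y) dx dy` on `ℝᵈ × ℝᵈ`: the image of
`𝒵_λ(T)⁻¹ g_λ(x, T, x) dx` under the diagonal map. -/
def mixedMeasure (d : ℕ) (lam T : ℝ) : Measure (E d × E d) :=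
  ((volume : Measure (E d)).withDensity fun x =>
    ENNReal.ofReal ((partitionFn d lam T)⁻¹ * mehler lam x T x)).map fun x => (x, x)

/-! ### Bernstein processes

A process indexed by `[0, T]` is written `Z : ℝ → Ω → ℝᵈ`; only its values at times in `[0, T]`
are ever used. -/

section Processes

variable {d : ℕ} {Ω : Type*} [MeasurableSpace Ω]

/-- The density `q(x, t; z, r; y, s)` of the two-sided transition function. -/
def transitionDensity (g : E d → ℝ → E d → ℝ) (x : E d) (t : ℝ) (z : E d) (r : ℝ) (y : E d)
    (s : ℝ) : ℝ :=
  g x (t - r) z * g z (r - s) y / g x (t - s) y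

/-- With `t₀ = 0` and `x₀ = x`, the number
`∫_{F₀ × F_T} dμ(x, y) / g(x, T, y) ∫_{F₁} dx₁ ⋯ ∫_{Fₙ} dxₙ`
`∏ₖ g(xₖ, tₖ - tₖ₋₁, xₖ₋₁) · g(y, T - tₙ, xₙ)`. -/
def cylinderMass (g : E d → ℝ → E d → ℝ) (T : ℝ) (μ : Measure (E d × E d)) {n : ℕ}
    (t : Fin n → ℝ) (F₀ FT : Set (E d)) (F : Fin n → Set (E d)) : ℝ≥0∞ :=
  ∫⁻ p in F₀ ×ˢ FT, (∫⁻ x in Set.univ.pi F,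
    ENNReal.ofReal
      ((∏ k : Fin n,
          g (x k) (t k - (Fin.cons 0 t : Fin (n + 1) → ℝ) k.castSucc)
            ((Fin.cons p.1 x : Fin (n + 1) → E d) k.castSucc)) *
        g p.2 (T - (Fin.cons 0 t : Fin (n + 1) → ℝ) (Fin.last n))
          ((Fin.cons p.1 x : Fin (n + 1) → E d) (Fin.last n)) / g p.1 T p.2)) ∂μ

/-- `Z` is the process on `[0, T]` generated by the kernel `g` and the endpoint measure `μ`:
its joint law at the times `0 < t₁ < ⋯ < tₙ < T` and at `0` and `T` is given by `cylinderMass`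
(for `n = 0` this says that `μ` is the joint law of `(Z₀, Z_T)`). -/
structure IsGeneratedBy (g : E d → ℝ → E d → ℝ) (T : ℝ) (μ : Measure (E d × E d))
    (Z : ℝ → Ω → E d) (P : Measure Ω) : Prop where
  measurable : ∀ t ∈ Set.Icc 0 T, Measurable (Z t)
  law : ∀ (n : ℕ) (t : Fin n → ℝ), StrictMono t → (∀ k, t k ∈ Set.Ioo 0 T) →
    ∀ (F₀ FT : Set (E d)) (F : Fin n → Set (E d)), MeasurableSet F₀ → MeasurableSet FT →
      (∀ k, MeasurableSet (F k)) →
      P {ω | Z 0 ω ∈ F₀ ∧ (∀ k, Z (t k) ω ∈ F k) ∧ Z T ω ∈ FT} = cylinderMass g T μ t F₀ FT F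

/-- The `σ`-algebra generated by `Z_τ`, `0 ≤ τ ≤ s`. -/
abbrev past (Z : ℝ → Ω → E d) (s : ℝ) : MeasurableSpace Ω :=
  ⨆ τ ∈ Set.Icc 0 s, MeasurableSpace.comap (Z τ) inferInstance

/-- The `σ`-algebra generated by `Z_τ`, `t ≤ τ ≤ T`. -/
abbrev future (T : ℝ) (Z : ℝ → Ω → E d) (t : ℝ) : MeasurableSpace Ω :=
  ⨆ τ ∈ Set.Icc t T, MeasurableSpace.comap (Z τ) inferInstance

/-- The `σ`-algebra generated by `Z_s`. -/
abbrev present (Z : ℝ → Ω → E d) (s : ℝ) : MeasurableSpace Ω :=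
  MeasurableSpace.comap (Z s) inferInstance

/-- The defining property of a Bernstein (reciprocal) process on `[0, T]`. -/
def IsBernstein (T : ℝ) (Z : ℝ → Ω → E d) (P : Measure Ω) : Prop :=
  ∀ b : E d → ℂ, Measurable b → (∃ C, ∀ x, ‖b x‖ ≤ C) →
    ∀ s r t : ℝ, 0 ≤ s → s < r → r < t → t ≤ T →
      P[fun ω => b (Z r ω) | past Z s ⊔ future T Z t]
        =ᵐ[P] P[fun ω => b (Z r ω) | present Z s ⊔ present Z t]

/-- The function `Q(x, t; F, r; y, s) = ∫_F q(x, t; z, r; y, s) dz` is the two-sided transition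
function of `Z`. -/
def HasTransition (g : E d → ℝ → E d → ℝ) (T : ℝ) (Z : ℝ → Ω → E d) (P : Measure Ω) : Prop :=
  ∀ F : Set (E d), MeasurableSet F →
    ∀ s r t : ℝ, 0 ≤ s → s < r → r < t → t ≤ T →
      P[(Z r ⁻¹' F).indicator (fun _ => (1 : ℝ)) | present Z s ⊔ present Z t]
        =ᵐ[P] fun ω => ∫ z in F, transitionDensity g (Z t ω) t z r (Z s ω) s

/-- The Markov property on `[0, T]`. -/
def IsMarkov (T : ℝ) (Z : ℝ → Ω → E d) (P : Measure Ω) : Prop :=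
  ∀ b : E d → ℂ, Measurable b → (∃ C, ∀ x, ‖b x‖ ≤ C) →
    ∀ s t : ℝ, 0 ≤ s → s < t → t ≤ T →
      P[fun ω => b (Z t ω) | past Z s] =ᵐ[P] P[fun ω => b (Z t ω) | present Z s]

/-- Stationarity on `[0, T]`: finite-dimensional laws are invariant under all time shifts that stay
inside `[0, T]`. -/
def IsStationary (T : ℝ) (Z : ℝ → Ω → E d) (P : Measure Ω) : Prop :=
  ∀ (n : ℕ) (t : Fin n → ℝ) (τ : ℝ), (∀ k, t k ∈ Set.Icc 0 T) → (∀ k, t k + τ ∈ Set.Icc 0 T) →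
    IdentDistrib (fun ω k => Z (t k + τ) ω) (fun ω k => Z (t k) ω) P P

/-- Two processes on `[0, T]`, possibly on different probability spaces, are identical in law:
they have the same finite-dimensional distributions. -/
def SameLaw {Ω' : Type*} [MeasurableSpace Ω'] (T : ℝ) (Z : ℝ → Ω → E d) (P : Measure Ω)
    (X : ℝ → Ω' → E d) (P' : Measure Ω') : Prop :=
  ∀ (n : ℕ) (t : Fin n → ℝ), (∀ k, t k ∈ Set.Icc 0 T) →
    IdentDistrib (fun ω k => Z (t k) ω) (fun ω k => X (t k) ω) P P'

/-! ### The periodic Ornstein-Uhlenbeck process -/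

/-- `W` is a standard Wiener process in `ℝᵈ`: its components are independent standard Brownian
motions. -/
structure IsWiener (W : ℝ≥0 → Ω → E d) (P : Measure Ω) : Prop where
  brownian : ∀ i : Fin d, IsBrownianReal (fun t ω => W t ω i) P
  indep : iIndepFun (fun (i : Fin d) ω (t : ℝ≥0) => W t ω i) P

/-- `I = ∫₀ᵗ f(τ) dW_τ` (forward Itô integral of a continuous deterministic integrand): `I` is the
`L²` limit of the left-endpoint sums. -/
def IsItoIntegral (W : ℝ≥0 → Ω → E d) (P : Measure Ω) (f : ℝ → ℝ) (t : ℝ) (I : Ω → E d) : Prop :=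
  MemLp I 2 P ∧
    Tendsto (fun N : ℕ => eLpNorm (fun ω => I ω - ∑ k ∈ Finset.range N,
      f (t * k / N) • (W (t * (k + 1) / N).toNNReal ω - W (t * k / N).toNNReal ω)) 2 P)
      atTop (𝓝 0)

/-- `X` is the periodic Ornstein-Uhlenbeck process on `[0, T]` driven by `W`:
`X_t = e^{-λt} / (1 - e^{-λT}) ∫₀ᵀ e^{-λ(T-τ)} dW_τ + ∫₀ᵗ e^{-λ(t-τ)} dW_τ` almost surely. -/
def IsPeriodicOU (lam T : ℝ) (W : ℝ≥0 → Ω → E d) (P : Measure Ω) (X : ℝ → Ω → E d) : Prop :=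
  ∀ t ∈ Set.Icc 0 T, ∃ J I : Ω → E d,
    IsItoIntegral W P (fun τ => Real.exp (-(lam * (T - τ)))) T J ∧
    IsItoIntegral W P (fun τ => Real.exp (-(lam * (t - τ)))) t I ∧
    X t =ᵐ[P] fun ω =>
      (Real.exp (-(lam * t)) / (1 - Real.exp (-(lam * T)))) • J ω + I ω

end Processes

/-- The variance `σ_λ`. -/
def oscVariance (lam T : ℝ) : ℝ :=
  Real.sinh (lam * T) / (2 * lam * (Real.cosh (lam * T) - 1))

/-- The centered isotropic Gaussian density `(2πσ_λ)^{-d/2} exp(-|x|² / (2σ_λ))` on `ℝᵈ`. -/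
def gaussianDensity {d : ℕ} (lam T : ℝ) (x : E d) : ℝ :=
  (2 * Real.pi * oscVariance lam T) ^ (-(d : ℝ) / 2) *
    Real.exp (-(‖x‖ ^ 2 / (2 * oscVariance lam T)))

/-! ### The density operator -/

lemma iteratedDeriv_gauss (m : ℕ) : ∃ p : Polynomial ℝ,
    iteratedDeriv m (fun y : ℝ => Real.exp (-y ^ 2)) = fun x => p.eval x * Real.exp (-x ^ 2) := by
  induction m with
  | zero => exact ⟨1, by ext x; simp⟩
  | succ m ih =>
    obtain ⟨p, hp⟩ := ih
    refine ⟨Polynomial.derivative p - Polynomial.C 2 * Polynomial.X * p, ?_⟩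
    rw [iteratedDeriv_succ, hp]
    ext x
    have h1 : HasDerivAt (fun y : ℝ => Real.exp (-y ^ 2)) (Real.exp (-x ^ 2) * (-(2 * x))) x := by
      have := ((hasDerivAt_pow 2 x).neg).exp
      simpa using this
    have h2 := (p.hasDerivAt x).mul h1
    have h3 := h2.deriv
    simp only [Polynomial.eval_sub, Polynomial.eval_mul, Polynomial.eval_C, Polynomial.eval_X]
    refine Eq.trans ?_ (h3.trans ?_)
    · rfl
    · ring

lemma continuous_hermite1 (m : ℕ) : Continuous (hermite1 m) := by
  obtain ⟨p, hp⟩ := iteratedDeriv_gauss m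
  unfold hermite1
  rw [hp]
  fun_prop

lemma hermite1_bound (m : ℕ) : ∃ C, 0 ≤ C ∧ ∀ x, |hermite1 m x| ≤ C * Real.exp (-(x ^ 2 / 4)) := by
  obtain ⟨p, hp⟩ := iteratedDeriv_gauss m
  set c : ℝ := (-1) ^ m * (Real.sqrt Real.pi * 2 ^ m * (m.factorial : ℝ)) ^ (-(1 : ℝ) / 2)
  have key : ∀ q : Polynomial ℝ, ∃ C, 0 ≤ C ∧ ∀ x : ℝ, |q.eval x| ≤ C * Real.exp (x ^ 2 / 4) := by
    intro q
    induction q using Polynomial.induction_on' with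
    | add q r hq hr =>
      obtain ⟨C, hC, h⟩ := hq
      obtain ⟨D, hD, h'⟩ := hr
      refine ⟨C + D, by positivity, fun x => ?_⟩
      rw [Polynomial.eval_add, add_mul]
      exact (abs_add_le _ _).trans (add_le_add (h x) (h' x))
    | monomial n a =>
      refine ⟨|a| * (n.factorial * Real.exp 1), by positivity, fun x => ?_⟩
      have h1 : |x| ^ n ≤ n.factorial * Real.exp |x| := by
        have := Real.pow_div_factorial_le_exp |x| (abs_nonneg x) n
        rwa [div_le_iff₀ (by positivity), mul_comm] at this
      have h2 : Real.exp |x| ≤ Real.exp 1 * Real.exp (x ^ 2 / 4) := by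
        rw [← Real.exp_add]
        apply Real.exp_le_exp.mpr
        nlinarith [sq_nonneg (|x| - 2), sq_abs x]
      rw [Polynomial.eval_monomial, abs_mul, abs_pow, mul_assoc, mul_assoc]
      refine mul_le_mul_of_nonneg_left (h1.trans ?_) (abs_nonneg a)
      exact mul_le_mul_of_nonneg_left h2 (by positivity)
  obtain ⟨C, hC, h⟩ := key p
  refine ⟨|c| * C, by positivity, fun x => ?_⟩
  have : hermite1 m x = c * (Polynomial.eval x p * Real.exp (-(x ^ 2 / 2))) := by
    simp only [hermite1, hp, c]
    have : Real.exp (-(x ^ 2 / 2)) = Real.exp (x ^ 2 / 2) * Real.exp (-x ^ 2) := by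
      rw [← Real.exp_add]; congr 1; ring
    rw [this]; ring
  rw [this, abs_mul c, abs_mul (Polynomial.eval x p), mul_assoc |c|, abs_of_pos (Real.exp_pos _)]
  refine mul_le_mul_of_nonneg_left ?_ (abs_nonneg c)
  calc |Polynomial.eval x p| * Real.exp (-(x ^ 2 / 2))
      ≤ C * Real.exp (x ^ 2 / 4) * Real.exp (-(x ^ 2 / 2)) :=
        mul_le_mul_of_nonneg_right (h x) (Real.exp_pos _).le
    _ = C * Real.exp (-(x ^ 2 / 4)) := by
        rw [mul_assoc, ← Real.exp_add]; congr 2; ring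

lemma continuous_hermiteFn {d : ℕ} (lam : ℝ) (m : Fin d → ℕ) : Continuous (hermiteFn lam m) := by
  unfold hermiteFn
  refine continuous_finsetProd _ fun j _ => continuous_const.mul ?_
  exact (continuous_hermite1 (m j)).comp (by fun_prop)

lemma hermiteFn_bound {d : ℕ} {lam : ℝ} (hlam : 0 < lam) (m : Fin d → ℕ) :
    ∃ C, 0 ≤ C ∧ ∀ x, |hermiteFn lam m x| ≤ C * Real.exp (-(lam / 4 * ‖x‖ ^ 2)) := by
  choose C hC h using fun j => hermite1_bound (m j)
  refine ⟨∏ j, lam ^ ((1 : ℝ) / 4) * C j,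
    Finset.prod_nonneg fun j _ => mul_nonneg (by positivity) (hC j), fun x => ?_⟩
  have hx : Real.exp (-(lam / 4 * ‖x‖ ^ 2)) = ∏ j, Real.exp (-((Real.sqrt lam * x j) ^ 2 / 4)) := by
    rw [← Real.exp_sum, EuclideanSpace.real_norm_sq_eq, Finset.mul_sum, ← Finset.sum_neg_distrib]
    congr 1
    refine Finset.sum_congr rfl fun j _ => ?_
    rw [mul_pow, Real.sq_sqrt hlam.le]; ring
  rw [hx, ← Finset.prod_mul_distrib, hermiteFn, Finset.abs_prod]
  refine Finset.prod_le_prod (fun j _ => abs_nonneg _) fun j _ => ?_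
  rw [abs_mul, abs_of_nonneg (by positivity : (0 : ℝ) ≤ lam ^ ((1 : ℝ) / 4)), mul_assoc]
  exact mul_le_mul_of_nonneg_left (h j _) (by positivity)

lemma memLp_hermiteFn {d : ℕ} {lam : ℝ} (hlam : 0 < lam) (m : Fin d → ℕ) :
    MemLp (fun x : E d => (hermiteFn lam m x : ℂ)) 2 volume := by
  obtain ⟨C, hC, h⟩ := hermiteFn_bound hlam m
  have hcont : Continuous fun x : E d => (hermiteFn lam m x : ℂ) :=
    Complex.continuous_ofReal.comp (continuous_hermiteFn lam m)
  rw [memLp_two_iff_integrable_sq_norm hcont.aestronglyMeasurable]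
  have hint : Integrable (fun x : E d => Real.exp (-(lam / 2 * ‖x‖ ^ 2))) volume := by
    have h1 := GaussianFourier.integrable_cexp_neg_mul_sq_norm_add (V := E d)
      (b := ((lam / 2 : ℝ) : ℂ)) (by simpa using half_pos hlam) 0 0
    refine h1.norm.congr (Eventually.of_forall fun x => ?_)
    simp only [inner_zero_left, Complex.ofReal_zero, mul_zero, add_zero, Complex.norm_exp]
    congr 1
    rw [← Complex.ofReal_pow, ← Complex.ofReal_neg, ← Complex.ofReal_mul, Complex.ofReal_re]
    ring
  refine (hint.const_mul (C ^ 2)).mono' (hcont.norm.pow 2).aestronglyMeasurable (Eventually.of_forall fun x => ?_)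
  rw [Complex.norm_real, Real.norm_eq_abs, Real.norm_eq_abs, abs_of_nonneg (by positivity)]
  calc |hermiteFn lam m x| ^ 2 ≤ (C * Real.exp (-(lam / 4 * ‖x‖ ^ 2))) ^ 2 :=
        pow_le_pow_left₀ (abs_nonneg _) (h x) 2
    _ = C ^ 2 * Real.exp (-(lam / 2 * ‖x‖ ^ 2)) := by
        rw [mul_pow, ← Real.exp_nat_mul]; congr 2; push_cast; ring

/-- The Hermite function `h_{m,λ}` as an element of `L²(ℝᵈ)`. -/
def hermiteL2 {d : ℕ} {lam : ℝ} (hlam : 0 < lam) (m : Fin d → ℕ) : L2 d :=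
  (memLp_hermiteFn hlam m).toLp

/-- The Gibbs density operator `ℛ_λ f = ∑ₘ pₘ (f, h_{m,λ}) h_{m,λ}` on `L²(ℝᵈ)`. -/
def densityOperator (d : ℕ) {lam : ℝ} (hlam : 0 < lam) (T : ℝ) : L2 d →L[ℂ] L2 d :=
  ∑' m : Fin d → ℕ, (gibbsWeight lam T m : ℂ) •
    InnerProductSpace.rankOne ℂ (hermiteL2 hlam m) (hermiteL2 hlam m)

/-- The multiplication operator `f ↦ b f` on `L²(ℝᵈ)` for a real-valued `b ∈ L^∞(ℝᵈ)`. -/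
def mulOperator {d : ℕ} (b : E d → ℝ) (hb : MemLp b ∞ volume) : L2 d →L[ℂ] L2 d :=
  (ContinuousLinearMap.mul ℂ ℂ).holderL volume ∞ 2 2
    (MemLp.toLp (fun x => (b x : ℂ)) hb.ofReal)

/-- The bounded operator `A` on `L²(ℝᵈ)` is of trace class with trace `c`: for every orthonormal
basis the series of diagonal elements converges unconditionally (that is, absolutely), with
sum `c`. -/
def HasTrace {d : ℕ} (A : L2 d →L[ℂ] L2 d) (c : ℂ) : Prop :=
  ∀ (ι : Type) (e : HilbertBasis ι ℂ (L2 d)), HasSum (fun n => ⟪e n, A (e n)⟫_ℂ) c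

end PeriodicOU

end

open PeriodicOU

/-!
The process is identified through its Gaussian structure. Write
`K(u) = cosh (λ (u - T / 2)) / (2 λ sinh (λ T / 2))` (`periodicCov`), and call a process on `[0, T]`
a periodic Gaussian process (`IsPeriodicGaussian`) if it is centered and Gaussian with covariance
`K(|t - s|) δᵢⱼ`. Its finite-dimensional distributions are determined, and `K(T) = K(0)` makes it a
loop: `Z_T = Z_0` almost surely. Four constructions meet in this notion.

* Existence. The functions `periodicKernel` in `L²(ℝ)` have `K` as their Gram matrix; an isonormal
  process (`exists_isonormal`) turns them into a periodic Gaussian process.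
* Mehler's kernel. The increments `Z_{t_{k+1}} - e^{-λ (t_{k+1} - t_k)} Z_{t_k}` around the loop
  are independent Gaussian vectors. Undoing this cyclic linear map gives the density of
  `(Z_0, Z_{t_1}, …, Z_{t_n})` as a multiple of a product of Ornstein-Uhlenbeck transition densities, which is a
  product of Mehler kernels, since the ground state factors cancel around the loop
  (`IsPeriodicGaussian.exists_map_eq_smul`). The constant is found from the Chapman-Kolmogorov
  equation and is the inverse of the partition function. Hence a periodic Gaussian process is
  generated by Mehler's kernel and the endpoint measure (`IsPeriodicGaussian.isGeneratedBy`).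
* Uniqueness. The generating formula fixes all finite-dimensional distributions
  (`IsGeneratedBy.sameLaw`), so that conversely every generated process is a periodic Gaussian
  process (`IsGeneratedBy.isPeriodicGaussian`). Marginals, covariance and stationarity follow.
* Periodic Ornstein-Uhlenbeck process. The Itô sums are images of step functions under the
  isometry `1_{(0, t]} ↦ W_t`, so `X_t` is the image of `periodicKernel` and `X` is a periodic
  Gaussian process too (`isPeriodicGaussian_of_isPeriodicOU`).

For `s < r < t` and a time `u` outside `(s, t)`, the function `p ↦ K(|u - p|)` is a hyperbolic
cosine on `[s, t]`; therefore some linear combination of `Z_s` and `Z_t`, the bridge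
mean, differs from `Z_r` by a Gaussian vector `η` which is independent of the past of `s` and the
future of `t`. The conditional law of `Z_r` is thus the same given `(Z_s, Z_t)` and given past and
future, which is the Bernstein property, and completing the square in the product of two Mehler
kernels identifies it with the two-sided transition function. The Markov property fails because
`Z_0` determines `Z_T`, whereas `Z_{T/2}` does not.

On the operator side, Mehler's formula is proved from the integral representation
`√π Hₘ(x) = ∫ (2 (x + i u))ᵐ e^{-u²} du`: the series sums to an exponential under a double Gaussian
integral. It gives the diagonal `∑ₘ pₘ hₘ(x)² = (2πσ)^{-d/2} e^{-|x|²/(2σ)}`, hence the traces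
against the density operator. That the endpoint measure is the mixture of the measures of the levels
is Parseval's identity for the Hermite functions, whose completeness follows from
Mehler's formula and the injectivity of the Laplace transform.
-/

noncomputable section

namespace PeriodicOU

/-! ### One-dimensional Hermite functions -/

open Polynomial in
/-- The physicists' Hermite polynomials, defined by `H₀ = 1` and `Hₘ₊₁ = 2 X Hₘ - Hₘ'`. -/
def hermPoly : ℕ → ℝ[X]
  | 0 => 1
  | m + 1 => C 2 * X * hermPoly m - derivative (hermPoly m)

open Polynomial in
lemma derivative_hermPoly (m : ℕ) :
    derivative (hermPoly (m + 1)) = C (2 * (m + 1 : ℝ)) * hermPoly m := by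
  induction m with
  | zero => simp [hermPoly]
  | succ m ih =>
    have h : hermPoly (m + 1 + 1) = C 2 * X * hermPoly (m + 1) - derivative (hermPoly (m + 1)) := rfl
    have h' : hermPoly (m + 1) = C 2 * X * hermPoly m - derivative (hermPoly m) := rfl
    rw [h, derivative_sub, ih, derivative_mul, derivative_mul, ih]
    simp only [derivative_C, derivative_X, derivative_mul, zero_mul, zero_add, mul_one]
    push_cast
    rw [show (derivative (hermPoly m)) = C 2 * X * hermPoly m - hermPoly (m + 1) by rw [h']; ring]
    simp only [map_mul, map_add, map_natCast, map_one]
    ring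

lemma eval_hermPoly_succ_succ (m : ℕ) (x : ℝ) :
    (hermPoly (m + 2)).eval x
      = 2 * x * (hermPoly (m + 1)).eval x - 2 * (m + 1) * (hermPoly m).eval x := by
  have h : hermPoly (m + 1 + 1) = Polynomial.C 2 * Polynomial.X * hermPoly (m + 1)
    - Polynomial.derivative (hermPoly (m + 1)) := rfl
  rw [show m + 2 = m + 1 + 1 from rfl, h, derivative_hermPoly]
  simp

lemma iteratedDeriv_exp_neg_sq (m : ℕ) :
    iteratedDeriv m (fun y : ℝ => Real.exp (-y ^ 2))
      = fun x => (-1) ^ m * (hermPoly m).eval x * Real.exp (-x ^ 2) := by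
  induction m with
  | zero => ext x; simp [hermPoly]
  | succ m ih =>
    rw [iteratedDeriv_succ, ih]
    ext x
    have h1 : HasDerivAt (fun y : ℝ => Real.exp (-y ^ 2)) (Real.exp (-x ^ 2) * (-(2 * x))) x := by
      have := ((hasDerivAt_pow 2 x).neg).exp
      simpa using this
    have h2 := (((hermPoly m).hasDerivAt x).const_mul ((-1 : ℝ) ^ m)).mul h1
    refine Eq.trans h2.deriv ?_
    simp only [hermPoly, Polynomial.eval_sub, Polynomial.eval_mul, Polynomial.eval_C,
      Polynomial.eval_X]
    ring

/-- The normalization constant of the Hermite function of degree `m`. -/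
def hermNorm (m : ℕ) : ℝ := (Real.sqrt Real.pi * 2 ^ m * (m.factorial : ℝ)) ^ (-(1 : ℝ) / 2)

lemma hermNorm_sq (m : ℕ) :
    hermNorm m ^ 2 = (Real.sqrt Real.pi * 2 ^ m * (m.factorial : ℝ))⁻¹ := by
  have := Real.pi_pos
  unfold hermNorm
  rw [← Real.rpow_natCast, ← Real.rpow_mul (by positivity)]
  norm_num
  rw [Real.rpow_neg_one]
  simp [mul_comm]

lemma hermite1_eq (m : ℕ) (x : ℝ) :
    hermite1 m x = hermNorm m * (hermPoly m).eval x * Real.exp (-(x ^ 2 / 2)) := by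
  have h1 : Real.exp (-(x ^ 2 / 2)) = Real.exp (x ^ 2 / 2) * Real.exp (-x ^ 2) := by
    rw [← Real.exp_add]; congr 1; ring
  have h2 : ((-1 : ℝ) ^ m) * (-1) ^ m = 1 := by rw [← mul_pow]; simp
  rw [hermite1, iteratedDeriv_exp_neg_sq, h1, hermNorm]
  calc _ = ((-1 : ℝ) ^ m * (-1) ^ m) * ((Real.sqrt Real.pi * 2 ^ m * (m.factorial : ℝ))
      ^ (-(1 : ℝ) / 2) * (hermPoly m).eval x * (Real.exp (x ^ 2 / 2) * Real.exp (-x ^ 2))) := by ring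
    _ = _ := by rw [h2, one_mul]

lemma integrable_polynomial_mul_gaussian (q : Polynomial ℂ) :
    Integrable (fun u : ℝ => q.eval (u : ℂ) * Complex.exp (-(u : ℂ) ^ 2)) := by
  induction q using Polynomial.induction_on' with
  | add p q hp hq =>
    refine (hp.add hq).congr (Eventually.of_forall fun u => ?_)
    simp [add_mul]
  | monomial n a =>
    have h := integrable_rpow_mul_exp_neg_mul_sq (b := 1) one_pos (s := n)
      (lt_of_lt_of_le (by norm_num) n.cast_nonneg)
    refine ((h.ofReal (𝕜 := ℂ)).const_mul a).congr (Eventually.of_forall fun u => ?_)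
    simp [Polynomial.eval_monomial, mul_assoc]

lemma integrable_polynomial_mul_gaussian_real (q : Polynomial ℝ) :
    Integrable (fun u : ℝ => q.eval u * Real.exp (-u ^ 2)) := by
  have h := (integrable_polynomial_mul_gaussian (q.map Complex.ofRealHom)).re
  refine h.congr (Eventually.of_forall fun u => ?_)
  have : (q.map Complex.ofRealHom).eval (u : ℂ) = ((q.eval u : ℝ) : ℂ) := by
    have := Polynomial.eval_map_apply (f := Complex.ofRealHom) (p := q) u
    simpa using this
  simp only [this]
  rw [← Complex.ofReal_pow, ← Complex.ofReal_neg, ← Complex.ofReal_exp, ← Complex.ofReal_mul]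
  exact Complex.ofReal_re _

/-- `∫ (2 (x + i u))ᵐ e^{-u²} du`, which is `√π Hₘ(x)`. -/
def hermIntegral (m : ℕ) (x : ℝ) : ℂ :=
  ∫ u : ℝ, (2 * ((x : ℂ) + Complex.I * u)) ^ m * Complex.exp (-(u : ℂ) ^ 2)

lemma integrable_hermIntegral (m : ℕ) (x : ℝ) :
    Integrable (fun u : ℝ => (2 * ((x : ℂ) + Complex.I * u)) ^ m * Complex.exp (-(u : ℂ) ^ 2)) := by
  have := integrable_polynomial_mul_gaussian
    ((Polynomial.C (2 : ℂ) * (Polynomial.C (x : ℂ) + Polynomial.C Complex.I * Polynomial.X)) ^ m)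
  simpa using this

lemma hermIntegral_zero (x : ℝ) : hermIntegral 0 x = ((Real.sqrt Real.pi : ℝ) : ℂ) := by
  have h := integral_gaussian 1
  simp only [hermIntegral, pow_zero, one_mul]
  rw [← show (∫ u : ℝ, ((Real.exp (-1 * u ^ 2) : ℝ) : ℂ)) = ((Real.sqrt Real.pi : ℝ) : ℂ) by
    rw [integral_complex_ofReal, h]; simp]
  refine integral_congr_ae (Eventually.of_forall fun u => ?_)
  simp

/-- Three-term recurrence, from integrating the derivative of `(2 (x + i u))ᵐ e^{-u²}`. -/
lemma hermIntegral_rec (m : ℕ) (x : ℝ) :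
    hermIntegral (m + 1) x = 2 * x * hermIntegral m x - 2 * m * hermIntegral (m - 1) x := by
  have hd : ∀ u : ℝ, HasDerivAt
      (fun u : ℝ => (2 * ((x : ℂ) + Complex.I * u)) ^ m * Complex.exp (-(u : ℂ) ^ 2))
      (Complex.I * ((2 * ((x : ℂ) + Complex.I * u)) ^ (m + 1) * Complex.exp (-(u : ℂ) ^ 2)
        - 2 * x * ((2 * ((x : ℂ) + Complex.I * u)) ^ m * Complex.exp (-(u : ℂ) ^ 2))
        + 2 * m * ((2 * ((x : ℂ) + Complex.I * u)) ^ (m - 1) * Complex.exp (-(u : ℂ) ^ 2)))) u := by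
    intro u
    have h0 : HasDerivAt (fun u : ℝ => (u : ℂ)) 1 u := Complex.ofRealCLM.hasDerivAt
    have h1 : HasDerivAt (fun u : ℝ => 2 * ((x : ℂ) + Complex.I * u)) (2 * Complex.I) u := by
      have := ((h0.const_mul Complex.I).const_add (x : ℂ)).const_mul 2
      simpa using this
    have he : HasDerivAt (fun u : ℝ => Complex.exp (-(u : ℂ) ^ 2))
        (Complex.exp (-(u : ℂ) ^ 2) * (-(2 * u))) u := by
      have := (h0.pow 2).neg.cexp
      simpa using! this
    refine ((h1.pow m).mul he).congr_deriv ?_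
    simp only [Pi.pow_apply]
    rw [pow_succ _ m]
    linear_combination (-(2 * (u : ℂ) * (2 * ((x : ℂ) + Complex.I * u)) ^ m
      * Complex.exp (-(u : ℂ) ^ 2))) * Complex.I_mul_I
  have hi := ((((integrable_hermIntegral (m + 1) x).sub
    ((integrable_hermIntegral m x).const_mul (2 * x))).add
    ((integrable_hermIntegral (m - 1) x).const_mul (2 * m))).const_mul Complex.I)
  have h := integral_eq_zero_of_hasDerivAt_of_integrable hd hi (integrable_hermIntegral m x)
  rw [integral_const_mul, integral_add, integral_sub, integral_const_mul, integral_const_mul] at h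
  · have h' := (mul_eq_zero.mp h).resolve_left Complex.I_ne_zero
    simp only [hermIntegral]
    linear_combination h'
  · exact integrable_hermIntegral (m + 1) x
  · exact (integrable_hermIntegral m x).const_mul _
  · exact (integrable_hermIntegral (m + 1) x).sub ((integrable_hermIntegral m x).const_mul _)
  · exact (integrable_hermIntegral (m - 1) x).const_mul _

lemma hermIntegral_eq (m : ℕ) (x : ℝ) :
    hermIntegral m x = ((Real.sqrt Real.pi * (hermPoly m).eval x : ℝ) : ℂ) := by
  induction m using Nat.twoStepInduction with
  | zero => simp [hermIntegral_zero, hermPoly]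
  | one => rw [hermIntegral_rec]; simp [hermIntegral_zero, hermPoly]; ring
  | more m ih1 ih2 =>
    rw [show m + 2 = m + 1 + 1 from rfl, hermIntegral_rec, ih2, show m + 1 - 1 = m from rfl, ih1,
      show m + 1 + 1 = m + 2 from rfl, eval_hermPoly_succ_succ]
    push_cast
    ring

/-- Orthogonality of the Hermite polynomials for the weight `e^{-x²}`. -/
lemma integral_hermPoly_mul (m n : ℕ) :
    ∫ x : ℝ, (hermPoly m).eval x * (hermPoly n).eval x * Real.exp (-x ^ 2)
      = if m = n then Real.sqrt Real.pi * 2 ^ m * (m.factorial : ℝ) else 0 := by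
  have hg : ∫ x : ℝ, Real.exp (-x ^ 2) = Real.sqrt Real.pi := by
    simpa using integral_gaussian 1
  -- The creation operator is the adjoint of the annihilation operator.
  have key : ∀ (m : ℕ) (q : Polynomial ℝ),
      ∫ x : ℝ, (hermPoly (m + 1)).eval x * q.eval x * Real.exp (-x ^ 2)
        = ∫ x : ℝ, (hermPoly m).eval x * (Polynomial.derivative q).eval x * Real.exp (-x ^ 2) := by
    intro m q
    have hd : ∀ x : ℝ, HasDerivAt
        (fun x : ℝ => (hermPoly m * q).eval x * Real.exp (-x ^ 2))
        ((hermPoly m * Polynomial.derivative q - hermPoly (m + 1) * q).eval x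
          * Real.exp (-x ^ 2)) x := by
      intro x
      have h1 : HasDerivAt (fun y : ℝ => Real.exp (-y ^ 2)) (Real.exp (-x ^ 2) * (-(2 * x))) x := by
        have := ((hasDerivAt_pow 2 x).neg).exp
        simpa using this
      refine (((hermPoly m * q).hasDerivAt x).mul h1).congr_deriv ?_
      simp [hermPoly, Polynomial.derivative_mul]
      ring
    have h := integral_eq_zero_of_hasDerivAt_of_integrable hd
      (integrable_polynomial_mul_gaussian_real _) (integrable_polynomial_mul_gaussian_real _)
    simp only [Polynomial.eval_sub, sub_mul] at h
    rw [integral_sub (integrable_polynomial_mul_gaussian_real _)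
      (integrable_polynomial_mul_gaussian_real _)] at h
    simp only [Polynomial.eval_mul] at h
    linarith
  induction m generalizing n with
  | zero =>
    cases n with
    | zero => simpa [hermPoly] using hg
    | succ n =>
      have := key n 1
      simp only [Polynomial.eval_one, mul_one, Polynomial.derivative_one, Polynomial.eval_zero,
        mul_zero, zero_mul, integral_zero] at this
      simpa [hermPoly] using this
  | succ m ih =>
    rw [key]
    cases n with
    | zero => simp [hermPoly]
    | succ n =>
      rw [derivative_hermPoly]
      have : ∀ x : ℝ, (hermPoly m).eval x * (Polynomial.C (2 * (n + 1 : ℝ)) * hermPoly n).eval x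
          * Real.exp (-x ^ 2) = (2 * (n + 1 : ℝ)) *
            ((hermPoly m).eval x * (hermPoly n).eval x * Real.exp (-x ^ 2)) := by
        intro x; simp; ring
      simp_rw [this]
      rw [integral_const_mul, ih]
      by_cases h : m = n
      · subst h
        simp [Nat.factorial_succ, pow_succ]; ring
      · simp [h]

lemma integral_hermite1_mul (m n : ℕ) :
    ∫ x : ℝ, hermite1 m x * hermite1 n x = if m = n then 1 else 0 := by
  have : ∀ x : ℝ, hermite1 m x * hermite1 n x = hermNorm m * hermNorm n *
      ((hermPoly m).eval x * (hermPoly n).eval x * Real.exp (-x ^ 2)) := by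
    intro x
    have : Real.exp (-x ^ 2) = Real.exp (-(x ^ 2 / 2)) * Real.exp (-(x ^ 2 / 2)) := by
      rw [← Real.exp_add]; congr 1; ring
    rw [hermite1_eq, hermite1_eq, this]; ring
  simp_rw [this]
  rw [integral_const_mul, integral_hermPoly_mul]
  split_ifs with h
  · subst h
    have := hermNorm_sq m
    rw [← pow_two, this, inv_mul_cancel₀]
    have := Real.pi_pos
    positivity
  · simp

/-- The Hermite functions solve `h'' = (x² - (2m + 1)) h`; the first and second derivatives are
given along with their existence. -/
lemma hermite1_ode (m : ℕ) : ∃ h' : ℝ → ℝ, (∀ x, HasDerivAt (hermite1 m) (h' x) x) ∧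
    ∀ x, HasDerivAt h' ((x ^ 2 - (2 * m + 1)) * hermite1 m x) x := by
  have he : ∀ x : ℝ, HasDerivAt (fun y : ℝ => Real.exp (-(y ^ 2 / 2)))
      (Real.exp (-(x ^ 2 / 2)) * (-x)) x := by
    intro x
    have := (((hasDerivAt_pow 2 x).div_const 2).neg).exp
    refine this.congr_deriv ?_
    simp
  -- The polynomial form of Hermite's differential equation.
  have hode : Polynomial.derivative (Polynomial.derivative (hermPoly m))
      = Polynomial.C 2 * Polynomial.X * Polynomial.derivative (hermPoly m)
        - Polynomial.C (2 * (m : ℝ)) * hermPoly m := by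
    have h1 : hermPoly (m + 1) = Polynomial.C 2 * Polynomial.X * hermPoly m
      - Polynomial.derivative (hermPoly m) := rfl
    have h2 := derivative_hermPoly m
    rw [h1] at h2
    simp only [Polynomial.derivative_sub, Polynomial.derivative_mul, Polynomial.derivative_C,
      Polynomial.derivative_X, zero_mul, zero_add, mul_one] at h2
    simp only [map_mul, map_add, map_natCast, map_one] at h2 ⊢
    linear_combination -h2
  have hf : hermite1 m = fun x => hermNorm m * (hermPoly m).eval x * Real.exp (-(x ^ 2 / 2)) :=
    funext (hermite1_eq m)
  refine ⟨fun x => hermNorm m * (Polynomial.derivative (hermPoly m)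
    - Polynomial.X * hermPoly m).eval x * Real.exp (-(x ^ 2 / 2)), fun x => ?_, fun x => ?_⟩
  · rw [hf]
    refine ((((hermPoly m).hasDerivAt x).const_mul (hermNorm m)).mul (he x)).congr_deriv ?_
    simp
    ring
  · refine ((((Polynomial.derivative (hermPoly m)
      - Polynomial.X * hermPoly m).hasDerivAt x).const_mul (hermNorm m)).mul (he x)).congr_deriv ?_
    rw [hermite1_eq, Polynomial.derivative_sub, hode]
    simp [Polynomial.derivative_mul]
    ring

/-! ### Mehler's formula -/

/-- The integral of the sum in Mehler's formula, `m` being summed under the double integral. -/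
lemma integral_mehler_double {r : ℝ} (hr : 0 < r) (hr1 : r < 1) (x y : ℝ) :
    ∫ u : ℝ, ∫ v : ℝ, Complex.exp (2 * r * ((x : ℂ) + Complex.I * v) * (y + Complex.I * u))
        * (Complex.exp (-(v : ℂ) ^ 2) * Complex.exp (-(u : ℂ) ^ 2))
      = ((Real.pi * (1 - r ^ 2) ^ (-(1 : ℝ) / 2) *
          Real.exp ((2 * r * x * y - r ^ 2 * (x ^ 2 + y ^ 2)) / (1 - r ^ 2)) : ℝ) : ℂ) := by
  have hr2 : 0 < 1 - r ^ 2 := by nlinarith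
  have hI : Complex.I ^ 2 = -1 := Complex.I_sq
  have h1 : ∀ u : ℝ, ∫ v : ℝ,
      Complex.exp (2 * r * ((x : ℂ) + Complex.I * v) * (y + Complex.I * u))
        * (Complex.exp (-(v : ℂ) ^ 2) * Complex.exp (-(u : ℂ) ^ 2))
      = (Real.pi : ℂ) ^ (1 / 2 : ℂ) * Complex.exp (((r ^ 2 - 1 : ℝ) : ℂ) * (u : ℂ) ^ 2
        + (2 * r * (x - r * y) * Complex.I) * u + (2 * r * x * y - r ^ 2 * y ^ 2)) := by
    intro u
    have h := integral_cexp_quadratic (b := -1) (by simp)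
      (2 * r * Complex.I * (y + Complex.I * u)) (2 * r * x * (y + Complex.I * u) - (u : ℂ) ^ 2)
    rw [neg_neg, div_one] at h
    rw [show ((r ^ 2 - 1 : ℝ) : ℂ) * (u : ℂ) ^ 2
        + (2 * r * (x - r * y) * Complex.I) * u + (2 * r * x * y - r ^ 2 * y ^ 2)
        = 2 * r * x * (y + Complex.I * u) - (u : ℂ) ^ 2
          - (2 * r * Complex.I * (y + Complex.I * u)) ^ 2 / (4 * -1) by
      push_cast
      linear_combination (-(r : ℂ) ^ 2 * (y + Complex.I * u) ^ 2 + (r : ℂ) ^ 2 * (u : ℂ) ^ 2) * hI, ← h]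
    refine integral_congr_ae (Eventually.of_forall fun v => ?_)
    simp only
    rw [← Complex.exp_add, ← Complex.exp_add]
    congr 1
    ring
  simp_rw [h1]
  rw [integral_const_mul, integral_cexp_quadratic (by rw [Complex.ofReal_re]; linarith)]
  have h2 : (2 * r * x * y - r ^ 2 * y ^ 2 : ℂ)
      - (2 * r * (x - r * y) * Complex.I) ^ 2 / (4 * ((r ^ 2 - 1 : ℝ) : ℂ))
      = (((2 * r * x * y - r ^ 2 * (x ^ 2 + y ^ 2)) / (1 - r ^ 2) : ℝ) : ℂ) := by
    have h3 : (1 - (r : ℂ) ^ 2) ≠ 0 := by exact_mod_cast hr2.ne'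
    have h4 : ((r : ℂ) ^ 2 - 1) ≠ 0 := by
      intro h; apply h3; linear_combination -h
    rw [mul_pow, hI]
    push_cast
    field_simp
    ring
  have h5 : (Real.pi : ℂ) ^ (1 / 2 : ℂ) * ((Real.pi : ℂ) / -((r ^ 2 - 1 : ℝ) : ℂ)) ^ (1 / 2 : ℂ)
      = ((Real.pi * (1 - r ^ 2) ^ (-(1 : ℝ) / 2) : ℝ) : ℂ) := by
    have e1 : ((Real.pi : ℂ) / -((r ^ 2 - 1 : ℝ) : ℂ)) = ((Real.pi / (1 - r ^ 2) : ℝ) : ℂ) := by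
      push_cast; ring
    have e2 : (1 / 2 : ℂ) = ((1 / 2 : ℝ) : ℂ) := by push_cast; ring
    rw [e1, e2, ← Complex.ofReal_cpow Real.pi_pos.le,
      ← Complex.ofReal_cpow (by have := Real.pi_pos; positivity), ← Complex.ofReal_mul]
    congr 1
    rw [Real.div_rpow Real.pi_pos.le hr2.le, ← mul_div_assoc, ← Real.rpow_add Real.pi_pos,
      neg_div, Real.rpow_neg hr2.le]
    norm_num
    rfl
  rw [← mul_assoc, h5, h2, ← Complex.ofReal_exp, ← Complex.ofReal_mul]

/-- Mehler's formula for the Hermite polynomials. Both factors are written as integrals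
`∫ (2 (x + i u))ᵐ e^{-u²} du`, so that the series becomes an exponential series under a double
integral. -/
lemma hasSum_hermPoly_mul {r : ℝ} (hr : 0 < r) (hr1 : r < 1) (x y : ℝ) :
    HasSum (fun m : ℕ => (r / 2) ^ m / (m.factorial : ℝ) * (hermPoly m).eval x * (hermPoly m).eval y)
      ((1 - r ^ 2) ^ (-(1 : ℝ) / 2) *
          Real.exp ((2 * r * x * y - r ^ 2 * (x ^ 2 + y ^ 2)) / (1 - r ^ 2))) := by
  set A : ℝ × ℝ → ℂ := fun p => 2 * r * ((x : ℂ) + Complex.I * p.2) * (y + Complex.I * p.1) with hA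
  set G : ℝ × ℝ → ℂ := fun p => Complex.exp (-(p.2 : ℂ) ^ 2) * Complex.exp (-(p.1 : ℂ) ^ 2) with hG
  have hAc : Continuous A := by fun_prop
  have hGc : Continuous G := by fun_prop
  have hGn : ∀ p, ‖G p‖ = Real.exp (-p.2 ^ 2 - p.1 ^ 2) := by
    intro p
    rw [hG, norm_mul, Complex.norm_exp, Complex.norm_exp, ← Real.exp_add]
    congr 1
    simp [← Complex.ofReal_pow, sub_eq_add_neg]
  -- `2 r |x + i v| |y + i u| ≤ r (x² + v² + y² + u²)`, so `r < 1` keeps the Gaussian weight.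
  have hAn : ∀ p, ‖A p‖ ≤ r * (x ^ 2 + p.2 ^ 2 + y ^ 2 + p.1 ^ 2) := by
    intro p
    have hn : ∀ a b : ℝ, ‖(a : ℂ) + Complex.I * b‖ ^ 2 = a ^ 2 + b ^ 2 := by
      intro a b
      rw [← Complex.normSq_eq_norm_sq, mul_comm, Complex.normSq_add_mul_I]
    have e1 := hn x p.2
    have e2 := hn y p.1
    simp only [hA, norm_mul, Complex.norm_real, Complex.norm_ofNat, Real.norm_eq_abs, abs_of_pos hr]
    nlinarith [sq_nonneg (‖(x : ℂ) + Complex.I * p.2‖ - ‖(y : ℂ) + Complex.I * p.1‖)]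
  have hint : Integrable (fun p : ℝ × ℝ => Real.exp ‖A p‖ * ‖G p‖) := by
    have h1 : Integrable (fun u : ℝ => Real.exp (-(1 - r) * u ^ 2)) :=
      integrable_exp_neg_mul_sq (by linarith)
    refine ((h1.mul_prod h1).const_mul (Real.exp (r * (x ^ 2 + y ^ 2)))).mono'
      (by fun_prop) (Eventually.of_forall fun p => ?_)
    rw [Real.norm_eq_abs, abs_of_nonneg (by positivity), hGn, ← Real.exp_add, ← Real.exp_add,
      ← Real.exp_add]
    apply Real.exp_le_exp.mpr
    have := hAn p
    nlinarith
  -- Sum the exponential series under the integral.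
  have hs : HasSum (fun m : ℕ => ∫ p, (A p ^ m / (m.factorial : ℂ)) * G p)
      (∫ p, Complex.exp (A p) * G p) := by
    refine hasSum_integral_of_dominated_convergence
      (fun m p => ‖A p‖ ^ m / (m.factorial : ℝ) * ‖G p‖) (fun m => ?_) (fun m => ?_) ?_ ?_ ?_
    · exact ((hAc.pow m).div_const _ |>.mul hGc).aestronglyMeasurable
    · refine Eventually.of_forall fun p => ?_
      simp
    · refine Eventually.of_forall fun p => ?_
      exact (Real.summable_pow_div_factorial _).mul_right _
    · refine hint.congr (Eventually.of_forall fun p => ?_)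
      simp only
      rw [tsum_mul_right, Real.exp_eq_exp_ℝ, NormedSpace.exp_eq_tsum_div]
    · refine Eventually.of_forall fun p => ?_
      have := NormedSpace.expSeries_div_hasSum_exp (A p)
      rw [← Complex.exp_eq_exp_ℂ] at this
      exact this.mul_right _
  have hval : ∫ p, Complex.exp (A p) * G p = ((Real.pi * (1 - r ^ 2) ^ (-(1 : ℝ) / 2) *
      Real.exp ((2 * r * x * y - r ^ 2 * (x ^ 2 + y ^ 2)) / (1 - r ^ 2)) : ℝ) : ℂ) := by
    refine (integral_prod (μ := volume) (ν := volume) (fun p => Complex.exp (A p) * G p) ?_).trans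
      (integral_mehler_double hr hr1 x y)
    refine hint.mono' ((Complex.continuous_exp.comp hAc).mul hGc).aestronglyMeasurable
      (Eventually.of_forall fun p => ?_)
    rw [norm_mul, Complex.norm_exp]
    gcongr
    exact Complex.re_le_norm _
  have hterm : ∀ m : ℕ, ∫ p, (A p ^ m / (m.factorial : ℂ)) * G p
      = ((Real.pi * ((r / 2) ^ m / (m.factorial : ℝ) * (hermPoly m).eval x * (hermPoly m).eval y) : ℝ) : ℂ) := by
    intro m
    have e : ∀ p : ℝ × ℝ, (A p ^ m / (m.factorial : ℂ)) * G p
        = ((r / 2) ^ m / (m.factorial : ℂ)) *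
          (((2 * ((y : ℂ) + Complex.I * p.1)) ^ m * Complex.exp (-(p.1 : ℂ) ^ 2)) *
          ((2 * ((x : ℂ) + Complex.I * p.2)) ^ m * Complex.exp (-(p.2 : ℂ) ^ 2))) := by
      intro p
      have : A p = (r / 2) * (2 * ((y : ℂ) + Complex.I * p.1)) * (2 * ((x : ℂ) + Complex.I * p.2)) := by
        simp only [hA]; ring
      rw [this, mul_pow, mul_pow, hG]
      ring
    simp_rw [e]
    rw [integral_const_mul]
    have := integral_prod_mul (μ := volume) (ν := volume)
      (fun u : ℝ => (2 * ((y : ℂ) + Complex.I * u)) ^ m * Complex.exp (-(u : ℂ) ^ 2))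
      (fun v : ℝ => (2 * ((x : ℂ) + Complex.I * v)) ^ m * Complex.exp (-(v : ℂ) ^ 2))
    refine (congrArg _ this).trans ?_
    change _ * (hermIntegral m y * hermIntegral m x) = _
    rw [hermIntegral_eq, hermIntegral_eq]
    have hpi : ((Real.sqrt Real.pi : ℝ) : ℂ) * ((Real.sqrt Real.pi : ℝ) : ℂ) = (Real.pi : ℂ) := by
      rw [← Complex.ofReal_mul, Real.mul_self_sqrt Real.pi_pos.le]
    push_cast
    linear_combination ((r / 2 : ℂ) ^ m / (m.factorial : ℂ) *
      ((((hermPoly m).eval x : ℝ)) : ℂ) * ((((hermPoly m).eval y : ℝ)) : ℂ)) * hpi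
  rw [hval] at hs
  simp_rw [hterm] at hs
  have hs' := (Complex.hasSum_ofReal.mp hs).mul_left Real.pi⁻¹
  have hpi0 := Real.pi_ne_zero
  convert! hs' using 1
  · ext m; field_simp
  · field_simp

/-- Mehler's formula in dimension one. -/
lemma hasSum_hermite1_mul {r : ℝ} (hr : 0 < r) (hr1 : r < 1) (x y : ℝ) :
    HasSum (fun m : ℕ => r ^ m * hermite1 m x * hermite1 m y)
      ((Real.pi * (1 - r ^ 2)) ^ (-(1 : ℝ) / 2) *
        Real.exp ((2 * r * x * y - r ^ 2 * (x ^ 2 + y ^ 2)) / (1 - r ^ 2) - (x ^ 2 + y ^ 2) / 2)) := by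
  have hpi := Real.pi_pos
  have hr2 : 0 < 1 - r ^ 2 := by nlinarith
  have h := (hasSum_hermPoly_mul hr hr1 x y).mul_left
    ((Real.sqrt Real.pi)⁻¹ * Real.exp (-((x ^ 2 + y ^ 2) / 2)))
  convert! h using 1
  · ext m
    rw [hermite1_eq, hermite1_eq]
    have e : Real.exp (-((x ^ 2 + y ^ 2) / 2)) = Real.exp (-(x ^ 2 / 2)) * Real.exp (-(y ^ 2 / 2)) := by
      rw [← Real.exp_add]; congr 1; ring
    have hn := hermNorm_sq m
    calc _ = r ^ m * hermNorm m ^ 2 * (hermPoly m).eval x * (hermPoly m).eval y *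
          (Real.exp (-(x ^ 2 / 2)) * Real.exp (-(y ^ 2 / 2))) := by ring
      _ = _ := by
        rw [hn, e, div_pow]
        field_simp
  · rw [Real.mul_rpow hpi.le hr2.le, sub_eq_add_neg (_ / _) (_ / _), Real.exp_add, neg_div, Real.rpow_neg hpi.le,
      ← Real.sqrt_eq_rpow]
    ring

/-! ### Sums over the levels in dimension `d` -/

lemma hasSum_mul_real {α β : Type*} {f : α → ℝ} {g : β → ℝ} {a b : ℝ} (hf : HasSum f a)
    (hg : HasSum g b) : HasSum (fun p : α × β => f p.1 * g p.2) (a * b) :=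
  hf.mul hg (summable_mul_of_summable_norm hf.summable.norm hg.summable.norm)

lemma hasSum_pi_prod {d : ℕ} {f : Fin d → ℕ → ℝ} {a : Fin d → ℝ} (hf : ∀ j, HasSum (f j) (a j)) :
    HasSum (fun m : Fin d → ℕ => ∏ j, f j (m j)) (∏ j, a j) := by
  induction d with
  | zero =>
    simp [hasSum_unique]
  | succ d ih =>
    have h0 := hf 0
    have h1 := ih (fun j => hf j.succ)
    rw [← (Fin.consEquiv (fun _ : Fin (d + 1) => ℕ)).hasSum_iff, Fin.prod_univ_succ]
    have h2 := hasSum_mul_real h0 h1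
    convert! h2 using 1
    ext p
    simp [Fin.consEquiv, Fin.prod_univ_succ]

lemma exp_neg_energy {d : ℕ} (lam t : ℝ) (m : Fin d → ℕ) :
    Real.exp (-(t * energy lam m)) = ∏ j, Real.exp (-(t * ((m j + 1 / 2) * lam))) := by
  rw [← Real.exp_sum, energy]
  congr 1
  rw [Finset.sum_neg_distrib, ← Finset.mul_sum, ← Finset.sum_mul, Finset.sum_add_distrib]
  simp only [Finset.sum_const, Finset.card_univ, Fintype.card_fin, nsmul_eq_mul]
  ring

/-- Mehler's formula in dimension one, for the oscillator of frequency `λ`. -/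
lemma hasSum_mehler_one {lam t : ℝ} (hlam : 0 < lam) (ht : 0 < t) (a b : ℝ) :
    HasSum (fun m : ℕ => Real.exp (-(t * ((m + 1 / 2) * lam))) *
        (lam ^ ((1 : ℝ) / 4) * hermite1 m (Real.sqrt lam * a)) *
        (lam ^ ((1 : ℝ) / 4) * hermite1 m (Real.sqrt lam * b)))
      ((2 * Real.pi * Real.sinh (lam * t) / lam) ^ (-(1 : ℝ) / 2) *
        Real.exp (-(lam * (Real.cosh (lam * t) * (a ^ 2 + b ^ 2) - 2 * (a * b))) /
          (2 * Real.sinh (lam * t)))) := by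
  have hlt : 0 < lam * t := mul_pos hlam ht
  set r := Real.exp (-(lam * t)) with hr
  have hr0 : 0 < r := Real.exp_pos _
  have hr1 : r < 1 := by rw [hr, Real.exp_lt_one_iff]; linarith
  have hs : 0 < Real.sinh (lam * t) := Real.sinh_pos_iff.mpr hlt
  have hcs : Real.cosh (lam * t) = r + Real.sinh (lam * t) := by
    have := Real.cosh_sub_sinh (lam * t); rw [hr]; linarith
  have hre : r * Real.exp (lam * t) = 1 := by rw [hr, ← Real.exp_add]; simp
  have h1r : 1 - r ^ 2 = 2 * r * Real.sinh (lam * t) := by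
    rw [Real.sinh_eq, ← hr]; linear_combination -hre
  have hpi := Real.pi_pos
  have hsq : Real.sqrt lam ^ 2 = lam := Real.sq_sqrt hlam.le
  have hq : lam ^ ((1 : ℝ) / 4) * lam ^ ((1 : ℝ) / 4) = lam ^ ((1 : ℝ) / 2) := by
    rw [← Real.rpow_add hlam]; norm_num
  have hrh : Real.exp (-(t * (1 / 2 * lam))) = r ^ ((1 : ℝ) / 2) := by
    rw [hr, ← Real.exp_mul]; congr 1; ring
  have h := (hasSum_hermite1_mul hr0 hr1 (Real.sqrt lam * a) (Real.sqrt lam * b)).mul_left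
    (lam ^ ((1 : ℝ) / 2) * Real.exp (-(t * (1 / 2 * lam))))
  convert! h using 1
  · ext m
    have : Real.exp (-(t * ((m + 1 / 2) * lam))) = r ^ m * Real.exp (-(t * (1 / 2 * lam))) := by
      rw [hr, ← Real.exp_nat_mul, ← Real.exp_add]; congr 1; ring
    rw [this, ← hq]; ring
  · have e : Real.pi * (1 - r ^ 2) = (2 * Real.pi * Real.sinh (lam * t) / lam) * (lam * r) := by
      rw [h1r]; field_simp
    have e1 : lam ^ ((1 : ℝ) / 2) * r ^ ((1 : ℝ) / 2) * (Real.pi * (1 - r ^ 2)) ^ (-(1 : ℝ) / 2)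
        = (2 * Real.pi * Real.sinh (lam * t) / lam) ^ (-(1 : ℝ) / 2) := by
      rw [e, Real.mul_rpow (x := 2 * Real.pi * Real.sinh (lam * t) / lam) (by positivity)
        (by positivity), ← Real.mul_rpow hlam.le hr0.le, neg_div,
        Real.rpow_neg (x := lam * r) (by positivity)]
      have : (lam * r) ^ ((1 : ℝ) / 2) ≠ 0 := by positivity
      field_simp
    rw [hrh, ← mul_assoc (lam ^ ((1 : ℝ) / 2) * r ^ ((1 : ℝ) / 2)), e1]
    congr 2
    rw [h1r, hcs]
    simp only [mul_pow, hsq]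
    field_simp
    linear_combination (-2 * a * b) * hsq

lemma mehler_eq_prod {d : ℕ} {lam t : ℝ} (hlam : 0 < lam) (ht : 0 < t) (x y : E d) :
    mehler lam x t y = ∏ j, ((2 * Real.pi * Real.sinh (lam * t) / lam) ^ (-(1 : ℝ) / 2) *
        Real.exp (-(lam * (Real.cosh (lam * t) * (x j ^ 2 + y j ^ 2) - 2 * (x j * y j))) /
          (2 * Real.sinh (lam * t)))) := by
  have hs : 0 < Real.sinh (lam * t) := Real.sinh_pos_iff.mpr (mul_pos hlam ht)
  have hpi := Real.pi_pos
  rw [Finset.prod_mul_distrib, ← Real.exp_sum, mehler]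
  congr 1
  · rw [Finset.prod_const, Finset.card_univ, Fintype.card_fin, ← Real.rpow_natCast,
      ← Real.rpow_mul (by positivity)]
    congr 1; ring
  · congr 1
    rw [← Finset.sum_div, Finset.sum_neg_distrib, ← Finset.mul_sum, Finset.sum_sub_distrib,
      ← Finset.mul_sum, ← Finset.mul_sum, Finset.sum_add_distrib, EuclideanSpace.real_norm_sq_eq,
      EuclideanSpace.real_norm_sq_eq, PiLp.inner_apply]
    simp [mul_comm]

/-- Mehler's formula. -/
lemma hasSum_mehler {d : ℕ} {lam t : ℝ} (hlam : 0 < lam) (ht : 0 < t) (x y : E d) :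
    HasSum (fun m : Fin d → ℕ => Real.exp (-(t * energy lam m)) * hermiteFn lam m x *
        hermiteFn lam m y) (mehler lam x t y) := by
  have h := hasSum_pi_prod (fun j : Fin d => hasSum_mehler_one hlam ht (x j) (y j))
  rw [mehler_eq_prod hlam ht]
  convert! h using 1
  ext m
  rw [Finset.prod_mul_distrib, Finset.prod_mul_distrib, exp_neg_energy]
  rfl

lemma hasSum_exp_energy {d : ℕ} {lam T : ℝ} (hlam : 0 < lam) (hT : 0 < T) :
    HasSum (fun m : Fin d → ℕ => Real.exp (-(T * energy lam m)))
      ((2 * Real.sinh (lam * T / 2))⁻¹ ^ d) := by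
  have h1 : HasSum (fun n : ℕ => Real.exp (-(T * ((n + 1 / 2) * lam))))
      (2 * Real.sinh (lam * T / 2))⁻¹ := by
    have hr1 : Real.exp (-(lam * T)) < 1 := by rw [Real.exp_lt_one_iff]; nlinarith
    have h := (hasSum_geometric_of_lt_one (Real.exp_pos _).le hr1).mul_left
      (Real.exp (-(lam * T / 2)))
    convert! h using 1
    · ext n
      rw [← Real.exp_nat_mul, ← Real.exp_add]; congr 1; ring
    · have hs : 0 < Real.sinh (lam * T / 2) := Real.sinh_pos_iff.mpr (by positivity)
      have e1 : Real.exp (-(lam * T)) = Real.exp (-(lam * T / 2)) * Real.exp (-(lam * T / 2)) := by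
        rw [← Real.exp_add]; congr 1; ring
      have e2 : Real.exp (-(lam * T / 2)) * Real.exp (lam * T / 2) = 1 := by
        rw [← Real.exp_add]; simp
      have e3 : 1 - Real.exp (-(lam * T)) ≠ 0 := by linarith
      field_simp
      rw [Real.sinh_eq, e1]
      linear_combination -e2
  have h := hasSum_pi_prod (fun _ : Fin d => h1)
  simp_rw [exp_neg_energy]
  simpa using h

lemma partitionFn_eq {d : ℕ} {lam T : ℝ} (hlam : 0 < lam) (hT : 0 < T) :
    partitionFn d lam T = (2 * Real.sinh (lam * T / 2))⁻¹ ^ d :=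
  (hasSum_exp_energy hlam hT).tsum_eq

lemma partitionFn_pos {d : ℕ} {lam T : ℝ} (hlam : 0 < lam) (hT : 0 < T) :
    0 < partitionFn d lam T := by
  rw [partitionFn_eq hlam hT]
  have hs : 0 < Real.sinh (lam * T / 2) := Real.sinh_pos_iff.mpr (by positivity)
  positivity

lemma gibbsWeight_pos {d : ℕ} {lam T : ℝ} (hlam : 0 < lam) (hT : 0 < T) (m : Fin d → ℕ) :
    0 < gibbsWeight lam T m :=
  mul_pos (inv_pos.mpr (partitionFn_pos hlam hT)) (Real.exp_pos _)

lemma hasSum_gibbsWeight {d : ℕ} {lam T : ℝ} (hlam : 0 < lam) (hT : 0 < T) :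
    HasSum (fun m : Fin d → ℕ => gibbsWeight lam T m) 1 := by
  have h := (hasSum_exp_energy (d := d) hlam hT).mul_left (partitionFn d lam T)⁻¹
  rw [← partitionFn_eq hlam hT, inv_mul_cancel₀ (partitionFn_pos hlam hT).ne'] at h
  exact h

/-- The Hermite functions are orthonormal in `L²(ℝᵈ)`. -/
lemma integral_hermiteFn_mul {d : ℕ} {lam : ℝ} (hlam : 0 < lam) (m n : Fin d → ℕ) :
    ∫ x : E d, hermiteFn lam m x * hermiteFn lam n x = if m = n then 1 else 0 := by
  have h1 : ∀ j, ∫ a : ℝ, (lam ^ ((1 : ℝ) / 4) * hermite1 (m j) (Real.sqrt lam * a)) *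
      (lam ^ ((1 : ℝ) / 4) * hermite1 (n j) (Real.sqrt lam * a)) = if m j = n j then 1 else 0 := by
    intro j
    have hq : lam ^ ((1 : ℝ) / 4) * lam ^ ((1 : ℝ) / 4) = Real.sqrt lam := by
      rw [← Real.rpow_add hlam, Real.sqrt_eq_rpow]; norm_num
    have hs : 0 < Real.sqrt lam := Real.sqrt_pos.mpr hlam
    have e : ∀ a : ℝ, (lam ^ ((1 : ℝ) / 4) * hermite1 (m j) (Real.sqrt lam * a)) *
      (lam ^ ((1 : ℝ) / 4) * hermite1 (n j) (Real.sqrt lam * a)) = Real.sqrt lam *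
        ((fun z => hermite1 (m j) z * hermite1 (n j) z) (Real.sqrt lam * a)) := by
      intro a; rw [← hq]; ring
    simp_rw [e]
    rw [integral_const_mul, Measure.integral_comp_mul_left
      (fun z => hermite1 (m j) z * hermite1 (n j) z), integral_hermite1_mul,
      abs_of_pos (inv_pos.mpr hs), smul_eq_mul, mul_inv_cancel_left₀ hs.ne']
  rw [← (PiLp.volume_preserving_toLp (Fin d)).integral_comp
    (MeasurableEquiv.toLp 2 _).measurableEmbedding]
  simp only [hermiteFn, ← Finset.prod_mul_distrib]
  rw [integral_fintype_prod_volume_eq_prod (f := fun j (a : ℝ) =>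
    (lam ^ ((1 : ℝ) / 4) * hermite1 (m j) (Real.sqrt lam * a)) *
      (lam ^ ((1 : ℝ) / 4) * hermite1 (n j) (Real.sqrt lam * a)))]
  simp_rw [h1]
  split_ifs with h
  · simp [h]
  · obtain ⟨j, hj⟩ := Function.ne_iff.mp h
    exact Finset.prod_eq_zero (Finset.mem_univ j) (by simp [hj])

/-- The second derivative of a smooth function in a direction, computed along lines. -/
lemma iteratedFDeriv_two_eq_of_hasDerivAt {V : Type*} [NormedAddCommGroup V] [NormedSpace ℝ V]
    {F G : V → ℝ} (hF : ContDiff ℝ 2 F) {x v : V} {c : ℝ}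
    (h1 : ∀ y, HasDerivAt (fun s : ℝ => F (y + s • v)) (G y) 0)
    (h2 : HasDerivAt (fun s : ℝ => G (x + s • v)) c 0) :
    iteratedFDeriv ℝ 2 F x ![v, v] = c := by
  have hd0 : ∀ y : V, HasDerivAt (fun s : ℝ => y + s • v) v 0 := by
    intro y
    simpa using ((hasDerivAt_id (0 : ℝ)).smul_const v).const_add y
  have hz : ∀ y : V, y + (0 : ℝ) • v = y := by intro y; simp
  have hfd : ∀ y : V, fderiv ℝ F y v = G y := by
    intro y
    have h3 : HasFDerivAt F (fderiv ℝ F y) (y + (0 : ℝ) • v) := by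
      rw [hz]; exact ((hF.differentiable (by norm_num)) y).hasFDerivAt
    exact (h3.comp_hasDerivAt (0 : ℝ) (hd0 y)).unique (h1 y)
  have hc : ContDiff ℝ 1 (fderiv ℝ F) := hF.fderiv_right (by norm_num)
  have h3 : HasFDerivAt (fderiv ℝ F) (fderiv ℝ (fderiv ℝ F) x) (x + (0 : ℝ) • v) := by
    rw [hz]; exact ((hc.differentiable (by norm_num)) x).hasFDerivAt
  have h4 : HasDerivAt (fun s : ℝ => fderiv ℝ F (x + s • v) v) (fderiv ℝ (fderiv ℝ F) x v v) 0 := by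
    have h5 : HasDerivAt (fun s : ℝ => fderiv ℝ F (x + s • v)) (fderiv ℝ (fderiv ℝ F) x v) 0 :=
      h3.comp_hasDerivAt (0 : ℝ) (hd0 x)
    exact ((ContinuousLinearMap.apply ℝ ℝ v).hasFDerivAt.comp_hasDerivAt (0 : ℝ) h5)
  simp only [hfd] at h4
  rw [iteratedFDeriv_two_apply]
  exact h4.unique h2

/-- The Hermite functions are eigenfunctions of the harmonic oscillator. -/
lemma oscillator_hermiteFn {d : ℕ} {lam : ℝ} (hlam : 0 < lam) (m : Fin d → ℕ) (x : E d) :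
    -(1 / 2) * Laplacian.laplacian (hermiteFn lam m) x
        + lam ^ 2 / 2 * ‖x‖ ^ 2 * hermiteFn lam m x = energy lam m * hermiteFn lam m x := by
  have hsq : Real.sqrt lam ^ 2 = lam := Real.sq_sqrt hlam.le
  choose h' hh' hh'' using hermite1_ode
  set q := lam ^ ((1 : ℝ) / 4)
  -- Factors and their derivatives along the coordinates.
  let f : Fin d → ℝ → ℝ := fun j a => q * hermite1 (m j) (Real.sqrt lam * a)
  let f' : Fin d → ℝ → ℝ := fun j a => q * (Real.sqrt lam * h' (m j) (Real.sqrt lam * a))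
  have hf : ∀ j a, HasDerivAt (f j) (f' j a) a := by
    intro j a
    have h1 : HasDerivAt (fun a => Real.sqrt lam * a) (Real.sqrt lam) a := by
      simpa using (hasDerivAt_id a).const_mul (Real.sqrt lam)
    refine (((hh' (m j) _).comp a h1).const_mul q).congr_deriv ?_
    simp only [f']; ring
  have hf' : ∀ j a, HasDerivAt (f' j) ((lam ^ 2 * a ^ 2 - (2 * m j + 1) * lam) * f j a) a := by
    intro j a
    have h1 : HasDerivAt (fun a => Real.sqrt lam * a) (Real.sqrt lam) a := by
      simpa using (hasDerivAt_id a).const_mul (Real.sqrt lam)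
    refine ((((hh'' (m j) _).comp a h1).const_mul (Real.sqrt lam)).const_mul q).congr_deriv ?_
    simp only [f]
    linear_combination (q * hermite1 (m j) (Real.sqrt lam * a) *
      (a ^ 2 * (Real.sqrt lam ^ 2 + lam) - (2 * m j + 1))) * hsq
  have hsmooth : ContDiff ℝ 2 (hermiteFn lam m : E d → ℝ) := by
    have h1 : ∀ j, ContDiff ℝ 2 (hermite1 (m j)) := by
      intro j
      rw [show hermite1 (m j) = fun x => hermNorm (m j) * (hermPoly (m j)).eval x *
        Real.exp (-(x ^ 2 / 2)) from funext (hermite1_eq (m j))]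
      have := (hermPoly (m j)).contDiff_aeval (𝕜 := ℝ) 2
      simp only [Polynomial.coe_aeval_eq_eval] at this
      fun_prop
    unfold hermiteFn
    refine contDiff_prod fun j _ => contDiff_const.mul ((h1 j).comp ?_)
    fun_prop
  have hline : ∀ i, iteratedFDeriv ℝ 2 (hermiteFn lam m) x
      ![EuclideanSpace.basisFun (Fin d) ℝ i, EuclideanSpace.basisFun (Fin d) ℝ i]
      = (lam ^ 2 * x i ^ 2 - (2 * m i + 1) * lam) * hermiteFn lam m x := by
    intro i
    set v := EuclideanSpace.basisFun (Fin d) ℝ i with hv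
    have hvi : ∀ (y : E d) (s : ℝ), (y + s • v) i = y i + s := by intro y s; simp [hv]
    have hvj : ∀ (y : E d) (s : ℝ), ∀ j ∈ Finset.univ.erase i, (y + s • v) j = y j := by
      intro y s j hj; simp [hv, Finset.ne_of_mem_erase hj]
    have hprod : ∀ y : E d,
        hermiteFn lam m y = f i (y i) * ∏ j ∈ Finset.univ.erase i, f j (y j) := fun y =>
      (Finset.mul_prod_erase Finset.univ (fun j => f j (y j)) (Finset.mem_univ i)).symm
    have hs : ∀ y : E d, HasDerivAt (fun s : ℝ => y i + s) 1 0 := by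
      intro y
      simpa using (hasDerivAt_id (0 : ℝ)).const_add (y i)
    refine iteratedFDeriv_two_eq_of_hasDerivAt hsmooth
      (G := fun y => f' i (y i) * ∏ j ∈ Finset.univ.erase i, f j (y j)) (fun y => ?_) ?_
    · have h3 : HasDerivAt (f i) (f' i (y i)) (y i + 0) := by rw [add_zero]; exact hf i (y i)
      have h2 := (h3.comp (0 : ℝ) (hs y)).mul_const (∏ j ∈ Finset.univ.erase i, f j (y j))
      rw [mul_one] at h2
      refine h2.congr_of_eventuallyEq (Eventually.of_forall fun s => ?_)
      simp only [Function.comp_apply]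
      rw [hprod, hvi, Finset.prod_congr rfl fun j hj => by rw [hvj y s j hj]]
    · have h3 : HasDerivAt (f' i) ((lam ^ 2 * x i ^ 2 - (2 * m i + 1) * lam) * f i (x i))
          (x i + 0) := by rw [add_zero]; exact hf' i (x i)
      have h2 := (h3.comp (0 : ℝ) (hs x)).mul_const (∏ j ∈ Finset.univ.erase i, f j (x j))
      rw [mul_one, mul_assoc, ← hprod] at h2
      refine h2.congr_of_eventuallyEq (Eventually.of_forall fun s => ?_)
      simp only [Function.comp_apply]
      rw [hvi, Finset.prod_congr rfl fun j hj => by rw [hvj x s j hj]]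
  rw [InnerProductSpace.laplacian_eq_iteratedFDeriv_orthonormalBasis _
    (EuclideanSpace.basisFun (Fin d) ℝ)]
  simp only [hline]
  rw [← Finset.sum_mul, Finset.sum_sub_distrib, ← Finset.mul_sum, ← EuclideanSpace.real_norm_sq_eq,
    ← Finset.sum_mul, Finset.sum_add_distrib, ← Finset.mul_sum, energy]
  simp
  ring

/-! ### Isotropic Gaussian densities and the Mehler kernel -/

/-- The centered Gaussian density of variance `v` in each direction. -/
def gaussDensity {d : ℕ} (v : ℝ) (x : E d) : ℝ :=
  (2 * Real.pi * v) ^ (-(d : ℝ) / 2) * Real.exp (-(‖x‖ ^ 2 / (2 * v)))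

/-- The centered Gaussian measure of variance `v` in each direction (for `v > 0`). -/
def gaussMeasure (d : ℕ) (v : ℝ) : Measure (E d) :=
  volume.withDensity fun x => ENNReal.ofReal (gaussDensity v x)

lemma gaussDensity_pos {d : ℕ} {v : ℝ} (hv : 0 < v) (x : E d) : 0 < gaussDensity v x := by
  have := Real.pi_pos
  unfold gaussDensity
  positivity

lemma continuous_gaussDensity {d : ℕ} (v : ℝ) : Continuous (gaussDensity v : E d → ℝ) := by
  unfold gaussDensity; fun_prop

lemma integrable_cexp_mul_gaussDensity {d : ℕ} {v : ℝ} (hv : 0 < v) (t : E d) :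
    Integrable (fun x : E d => Complex.exp (⟪x, t⟫_ℝ * Complex.I) * (gaussDensity v x : ℂ)) := by
  have h := GaussianFourier.integrable_cexp_neg_mul_sq_norm_add (V := E d)
    (b := ((1 / (2 * v) : ℝ) : ℂ)) (by rw [Complex.ofReal_re]; positivity) Complex.I t
  refine (h.const_mul (((2 * Real.pi * v) ^ (-(d : ℝ) / 2) : ℝ) : ℂ)).congr
    (Eventually.of_forall fun x => ?_)
  simp only [gaussDensity, Complex.ofReal_mul, Complex.ofReal_exp]
  rw [mul_left_comm, ← Complex.exp_add]
  congr 2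
  rw [real_inner_comm]
  push_cast
  ring

lemma integral_cexp_mul_gaussDensity {d : ℕ} {v : ℝ} (hv : 0 < v) (t : E d) :
    ∫ x : E d, Complex.exp (⟪x, t⟫_ℝ * Complex.I) * (gaussDensity v x : ℂ)
      = Complex.exp (-(v * ‖t‖ ^ 2 / 2 : ℝ)) := by
  have hpi := Real.pi_pos
  have h := GaussianFourier.integral_cexp_neg_mul_sq_norm_add (V := E d)
    (b := ((1 / (2 * v) : ℝ) : ℂ)) (by rw [Complex.ofReal_re]; positivity) Complex.I t
  have e : ∀ x : E d, Complex.exp (⟪x, t⟫_ℝ * Complex.I) * (gaussDensity v x : ℂ)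
      = (((2 * Real.pi * v) ^ (-(d : ℝ) / 2) : ℝ) : ℂ) *
        Complex.exp (-((1 / (2 * v) : ℝ) : ℂ) * ‖x‖ ^ 2 + Complex.I * ⟪t, x⟫_ℝ) := by
    intro x
    simp only [gaussDensity, Complex.ofReal_mul, Complex.ofReal_exp]
    rw [mul_left_comm, ← Complex.exp_add]
    congr 2
    rw [real_inner_comm]
    push_cast
    ring
  simp_rw [e]
  rw [integral_const_mul, h, ← mul_assoc]
  have e1 : ((Real.pi : ℂ) / ((1 / (2 * v) : ℝ) : ℂ)) = ((2 * Real.pi * v : ℝ) : ℂ) := by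
    push_cast
    have : (v : ℂ) ≠ 0 := by exact_mod_cast hv.ne'
    field_simp
  have e2 : ((Module.finrank ℝ (E d) : ℂ) / 2) = (((d : ℝ) / 2 : ℝ) : ℂ) := by
    rw [finrank_euclideanSpace_fin]; push_cast; ring
  rw [e1, e2, ← Complex.ofReal_cpow (by positivity), ← Complex.ofReal_mul,
    ← Real.rpow_add (by positivity)]
  have e3 : -(d : ℝ) / 2 + d / 2 = 0 := by ring
  rw [e3, Real.rpow_zero, Complex.ofReal_one, one_mul, Complex.I_sq]
  congr 1
  have : (v : ℂ) ≠ 0 := by exact_mod_cast hv.ne'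
  push_cast
  field_simp
  ring

lemma integrable_gaussDensity {d : ℕ} {v : ℝ} (hv : 0 < v) :
    Integrable (gaussDensity v : E d → ℝ) := by
  have h := (integrable_cexp_mul_gaussDensity (d := d) hv 0).re
  refine h.congr (Eventually.of_forall fun x => ?_)
  simp

lemma lintegral_gaussDensity {d : ℕ} {v : ℝ} (hv : 0 < v) :
    ∫⁻ x : E d, ENNReal.ofReal (gaussDensity v x) = 1 := by
  have h := integral_cexp_mul_gaussDensity (d := d) hv 0
  have e : ∀ x : E d, Complex.exp (⟪x, (0 : E d)⟫_ℝ * Complex.I) * (gaussDensity v x : ℂ)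
      = (gaussDensity v x : ℂ) := by intro x; simp
  simp_rw [e] at h
  rw [integral_complex_ofReal] at h
  have h' : ∫ x : E d, gaussDensity v x = 1 := by
    have h2 : ((∫ x : E d, gaussDensity v x : ℝ) : ℂ) = ((1 : ℝ) : ℂ) := by rw [h]; simp
    exact_mod_cast h2
  rw [← ofReal_integral_eq_lintegral_ofReal (integrable_gaussDensity hv)
    (Eventually.of_forall fun x => (gaussDensity_pos hv x).le), h', ENNReal.ofReal_one]

lemma isProbabilityMeasure_gaussMeasure {d : ℕ} {v : ℝ} (hv : 0 < v) :
    IsProbabilityMeasure (gaussMeasure d v) :=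
  ⟨by rw [gaussMeasure, withDensity_apply _ MeasurableSet.univ, setLIntegral_univ,
    lintegral_gaussDensity hv]⟩

lemma charFun_gaussMeasure {d : ℕ} {v : ℝ} (hv : 0 < v) (t : E d) :
    charFun (gaussMeasure d v) t = Complex.exp (-(v * ‖t‖ ^ 2 / 2 : ℝ)) := by
  rw [← integral_cexp_mul_gaussDensity hv t, charFun_apply, gaussMeasure,
    integral_withDensity_eq_integral_toReal_smul]
  · refine integral_congr_ae (Eventually.of_forall fun x => ?_)
    simp only
    rw [ENNReal.toReal_ofReal (gaussDensity_pos hv x).le, Complex.real_smul, mul_comm]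
  · exact (continuous_gaussDensity v).measurable.ennreal_ofReal
  · exact Eventually.of_forall fun x => ENNReal.ofReal_lt_top

lemma sinh_pos_of {lam t : ℝ} (hlam : 0 < lam) (ht : 0 < t) : 0 < Real.sinh (lam * t) :=
  Real.sinh_pos_iff.mpr (mul_pos hlam ht)

lemma mehler_pos {d : ℕ} {lam t : ℝ} (hlam : 0 < lam) (ht : 0 < t) (x y : E d) :
    0 < mehler lam x t y := by
  have := Real.pi_pos
  have := sinh_pos_of hlam ht
  unfold mehler
  positivity

lemma mehler_comm {d : ℕ} (lam t : ℝ) (x y : E d) : mehler lam x t y = mehler lam y t x := by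
  rw [mehler, mehler, real_inner_comm, add_comm (‖x‖ ^ 2)]

lemma continuous_mehler {d : ℕ} (lam t : ℝ) :
    Continuous fun p : E d × E d => mehler lam p.1 t p.2 := by
  unfold mehler; fun_prop

/-- Doob's transform by the ground state turns Mehler's kernel into the transition density of the
Ornstein-Uhlenbeck process. -/
lemma gaussDensity_eq_mehler {d : ℕ} {lam t : ℝ} (hlam : 0 < lam) (ht : 0 < t) (x z : E d) :
    gaussDensity ((1 - Real.exp (-(lam * t)) ^ 2) / (2 * lam)) (z - Real.exp (-(lam * t)) • x)
      = Real.exp (d * lam / 2 * t) * Real.exp (lam / 2 * (‖x‖ ^ 2 - ‖z‖ ^ 2)) *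
        mehler lam z t x := by
  have hs := sinh_pos_of hlam ht
  have hpi := Real.pi_pos
  set a := Real.exp (-(lam * t)) with ha
  have ha0 : 0 < a := Real.exp_pos _
  have hae : a * Real.exp (lam * t) = 1 := by rw [ha, ← Real.exp_add]; simp
  have h1a : 1 - a ^ 2 = 2 * a * Real.sinh (lam * t) := by
    rw [Real.sinh_eq, ← ha]; linear_combination -hae
  have hc : Real.cosh (lam * t) = a + Real.sinh (lam * t) := by
    have := Real.cosh_sub_sinh (lam * t); rw [ha]; linarith
  have hcs : a * (a + 2 * Real.sinh (lam * t)) = 1 := by linear_combination -h1a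
  rw [gaussDensity, mehler, h1a, hc]
  have e1 : (2 * Real.pi * (2 * a * Real.sinh (lam * t) / (2 * lam))) ^ (-(d : ℝ) / 2)
      = Real.exp (d * lam / 2 * t) * (2 * Real.pi * Real.sinh (lam * t) / lam) ^ (-(d : ℝ) / 2) := by
    rw [show 2 * Real.pi * (2 * a * Real.sinh (lam * t) / (2 * lam))
      = a * (2 * Real.pi * Real.sinh (lam * t) / lam) by field_simp,
      Real.mul_rpow ha0.le (by positivity)]
    congr 1
    rw [ha, ← Real.exp_mul]
    congr 1; ring
  rw [e1]
  have e2 : Real.exp (-(‖z - a • x‖ ^ 2 / (2 * (2 * a * Real.sinh (lam * t) / (2 * lam)))))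
      = Real.exp (lam / 2 * (‖x‖ ^ 2 - ‖z‖ ^ 2)) * Real.exp (-(lam * ((a + Real.sinh (lam * t)) *
        (‖z‖ ^ 2 + ‖x‖ ^ 2) - 2 * ⟪z, x⟫_ℝ)) / (2 * Real.sinh (lam * t))) := by
    rw [← Real.exp_add]
    congr 1
    rw [norm_sub_sq_real, norm_smul, inner_smul_right, Real.norm_eq_abs, mul_pow, sq_abs]
    field_simp
    linear_combination (‖z‖ ^ 2) * hcs
  rw [e2]
  ring

lemma sinh_add_pos {lam s t : ℝ} (hlam : 0 < lam) (hs : 0 < s) (ht : 0 < t) :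
    0 < Real.sinh (lam * (s + t)) := sinh_pos_of hlam (add_pos hs ht)

/-- The completion of the square behind `mehler_mul_mehler`, in terms of the coefficients of the
quadratic forms. -/
lemma bridge_exponent {lam S S' S'' C C' C'' : ℝ} (hlam : 0 < lam) (h1 : 0 < S) (h2 : 0 < S')
    (h3 : 0 < S'') (hS : S'' = S * C' + C * S') (hx : C * S'' = C'' * S + S')
    (hy : C' * S'' = C'' * S' + S) (X Y Z xz zy xy : ℝ) :
    -(lam * (C * (X + Z) - 2 * xz)) / (2 * S) + -(lam * (C' * (Z + Y) - 2 * zy)) / (2 * S')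
      = -(lam * (C'' * (X + Y) - 2 * xy)) / (2 * S'')
        + -((Z - 2 * (S' / S'' * xz + S / S'' * zy) + ((S' / S'') ^ 2 * X
        + 2 * ((S' / S'') * (S / S'') * xy) + (S / S'') ^ 2 * Y)) /
          (2 * (S * S' / (lam * S'')))) := by
  apply sub_eq_zero.mp
  have key : -(lam * (C * (X + Z) - 2 * xz)) / (2 * S)
      + -(lam * (C' * (Z + Y) - 2 * zy)) / (2 * S')
      - (-(lam * (C'' * (X + Y) - 2 * xy)) / (2 * S'')
        + -((Z - 2 * (S' / S'' * xz + S / S'' * zy) + ((S' / S'') ^ 2 * X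
        + 2 * ((S' / S'') * (S / S'') * xy) + (S / S'') ^ 2 * Y)) /
          (2 * (S * S' / (lam * S'')))))
     = -(lam * X) / (2 * S * S'') * (C * S'' - (C'' * S + S'))
       - (lam * Y) / (2 * S' * S'') * (C' * S'' - (C'' * S' + S))
       + lam * Z / (2 * S * S') * (S'' - (S * C' + C * S')) := by
    field_simp
    ring
  rw [key, sub_eq_zero.mpr hx, sub_eq_zero.mpr hy, sub_eq_zero.mpr hS]
  ring

/-- The Gaussian law of a bridge of Mehler's kernel. -/
lemma mehler_mul_mehler {d : ℕ} {lam s t : ℝ} (hlam : 0 < lam) (hs : 0 < s) (ht : 0 < t)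
    (x y z : E d) :
    mehler lam x s z * mehler lam z t y = mehler lam x (s + t) y *
      gaussDensity (Real.sinh (lam * s) * Real.sinh (lam * t) / (lam * Real.sinh (lam * (s + t))))
        (z - ((Real.sinh (lam * t) / Real.sinh (lam * (s + t))) • x
          + (Real.sinh (lam * s) / Real.sinh (lam * (s + t))) • y)) := by
  have h1 := sinh_pos_of hlam hs
  have h2 := sinh_pos_of hlam ht
  have h3 := sinh_add_pos hlam hs ht
  have hpi := Real.pi_pos
  have hS : Real.sinh (lam * (s + t)) = Real.sinh (lam * s) * Real.cosh (lam * t)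
      + Real.cosh (lam * s) * Real.sinh (lam * t) := by rw [mul_add, Real.sinh_add]
  have hC : Real.cosh (lam * (s + t)) = Real.cosh (lam * s) * Real.cosh (lam * t)
      + Real.sinh (lam * s) * Real.sinh (lam * t) := by rw [mul_add, Real.cosh_add]
  have q1 := Real.cosh_sq (lam * s)
  have q2 := Real.cosh_sq (lam * t)
  unfold mehler gaussDensity
  set S := Real.sinh (lam * s)
  set S' := Real.sinh (lam * t)
  set S'' := Real.sinh (lam * (s + t))
  set C := Real.cosh (lam * s)
  set C' := Real.cosh (lam * t)
  set C'' := Real.cosh (lam * (s + t))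
  have e1 : (2 * Real.pi * S / lam) ^ (-(d : ℝ) / 2) * (2 * Real.pi * S' / lam) ^ (-(d : ℝ) / 2)
      = (2 * Real.pi * S'' / lam) ^ (-(d : ℝ) / 2) *
        (2 * Real.pi * (S * S' / (lam * S''))) ^ (-(d : ℝ) / 2) := by
    rw [← Real.mul_rpow (by positivity) (by positivity),
      ← Real.mul_rpow (by positivity) (by positivity)]
    congr 1
    field_simp
  have e2 : -(lam * (C * (‖x‖ ^ 2 + ‖z‖ ^ 2) - 2 * ⟪x, z⟫_ℝ)) / (2 * S)
      + -(lam * (C' * (‖z‖ ^ 2 + ‖y‖ ^ 2) - 2 * ⟪z, y⟫_ℝ)) / (2 * S')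
      = -(lam * (C'' * (‖x‖ ^ 2 + ‖y‖ ^ 2) - 2 * ⟪x, y⟫_ℝ)) / (2 * S'')
        + -(‖z - ((S' / S'') • x + (S / S'') • y)‖ ^ 2 / (2 * (S * S' / (lam * S'')))) := by
    have n : ‖z - ((S' / S'') • x + (S / S'') • y)‖ ^ 2 = ‖z‖ ^ 2 - 2 * (S' / S'' * ⟪x, z⟫_ℝ
        + S / S'' * ⟪z, y⟫_ℝ) + ((S' / S'') ^ 2 * ‖x‖ ^ 2 + 2 * ((S' / S'') * (S / S'') * ⟪x, y⟫_ℝ)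
        + (S / S'') ^ 2 * ‖y‖ ^ 2) := by
      rw [norm_sub_sq_real, norm_add_sq_real, inner_add_right, inner_smul_right, inner_smul_right,
        inner_smul_left, inner_smul_right, norm_smul, norm_smul, mul_pow, mul_pow,
        Real.norm_eq_abs, Real.norm_eq_abs, sq_abs, sq_abs, real_inner_comm x z]
      simp only [conj_trivial]
      ring
    rw [n]
    exact bridge_exponent hlam h1 h2 h3 hS (by rw [hS, hC]; linear_combination S' * q1)
      (by rw [hS, hC]; linear_combination S * q2) _ _ _ _ _ _
  calc _ = ((2 * Real.pi * S / lam) ^ (-(d : ℝ) / 2) * (2 * Real.pi * S' / lam) ^ (-(d : ℝ) / 2)) *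
        (Real.exp (-(lam * (C * (‖x‖ ^ 2 + ‖z‖ ^ 2) - 2 * ⟪x, z⟫_ℝ)) / (2 * S)) *
        Real.exp (-(lam * (C' * (‖z‖ ^ 2 + ‖y‖ ^ 2) - 2 * ⟪z, y⟫_ℝ)) / (2 * S'))) := by ring
    _ = _ := by rw [e1, ← Real.exp_add, e2, Real.exp_add]; ring

lemma bridge_variance_pos {lam s t : ℝ} (hlam : 0 < lam) (hs : 0 < s) (ht : 0 < t) :
    0 < Real.sinh (lam * s) * Real.sinh (lam * t) / (lam * Real.sinh (lam * (s + t))) := by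
  have h1 := sinh_pos_of hlam hs
  have h2 := sinh_pos_of hlam ht
  have h3 := sinh_add_pos hlam hs ht
  positivity

/-- The Chapman-Kolmogorov equation for Mehler's kernel. -/
lemma lintegral_mehler_mul_mehler {d : ℕ} {lam s t : ℝ} (hlam : 0 < lam) (hs : 0 < s) (ht : 0 < t)
    (x y : E d) :
    ∫⁻ z, ENNReal.ofReal (mehler lam x s z * mehler lam z t y)
      = ENNReal.ofReal (mehler lam x (s + t) y) := by
  simp_rw [mehler_mul_mehler hlam hs ht, ENNReal.ofReal_mul (mehler_pos hlam (add_pos hs ht) x y).le]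
  rw [lintegral_const_mul' _ _ ENNReal.ofReal_ne_top]
  rw [lintegral_sub_right_eq_self (fun z => ENNReal.ofReal (gaussDensity _ z)),
    lintegral_gaussDensity (bridge_variance_pos hlam hs ht), mul_one]

lemma oscVariance_pos {lam T : ℝ} (hlam : 0 < lam) (hT : 0 < T) : 0 < oscVariance lam T := by
  have h1 := sinh_pos_of hlam hT
  have h2 : 1 < Real.cosh (lam * T) := Real.one_lt_cosh.mpr (by positivity)
  have : 0 < Real.cosh (lam * T) - 1 := by linarith
  unfold oscVariance
  positivity

lemma gaussianDensity_eq {d : ℕ} (lam T : ℝ) (x : E d) :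
    gaussianDensity lam T x = gaussDensity (oscVariance lam T) x := rfl

/-- The normalized diagonal of Mehler's kernel is the Gaussian density of variance `σ_λ`. -/
lemma inv_partitionFn_mul_mehler {d : ℕ} {lam T : ℝ} (hlam : 0 < lam) (hT : 0 < T) (x : E d) :
    (partitionFn d lam T)⁻¹ * mehler lam x T x = gaussianDensity lam T x := by
  have h1 := sinh_pos_of hlam hT
  have h2 : 1 < Real.cosh (lam * T) := Real.one_lt_cosh.mpr (by positivity)
  have h3 : 0 < Real.cosh (lam * T) - 1 := by linarith
  have hs : 0 < Real.sinh (lam * T / 2) := Real.sinh_pos_iff.mpr (by positivity)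
  have hpi := Real.pi_pos
  have hc : Real.cosh (lam * T) = 1 + 2 * Real.sinh (lam * T / 2) ^ 2 := by
    have e := Real.cosh_two_mul (lam * T / 2)
    rw [show 2 * (lam * T / 2) = lam * T by ring] at e
    have := Real.cosh_sq (lam * T / 2)
    linarith
  rw [partitionFn_eq hlam hT, inv_pow, inv_inv, mehler, gaussianDensity, ← mul_assoc]
  congr 1
  · have e : (2 * Real.sinh (lam * T / 2)) ^ d
        = ((2 * Real.sinh (lam * T / 2)) ^ 2) ^ ((d : ℝ) / 2) := by
      rw [← Real.rpow_natCast _ 2, ← Real.rpow_mul (by positivity), ← Real.rpow_natCast]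
      congr 1; push_cast; ring
    rw [e, show 2 * Real.pi * Real.sinh (lam * T) / lam
      = (2 * Real.sinh (lam * T / 2)) ^ 2 * (2 * Real.pi * oscVariance lam T) by
        rw [oscVariance, hc]; field_simp; ring,
      Real.mul_rpow (by positivity) (by have := oscVariance_pos hlam hT; positivity), ← mul_assoc,
      ← Real.rpow_add (by positivity), show (d : ℝ) / 2 + -d / 2 = 0 by ring, Real.rpow_zero, one_mul]
  · congr 1
    rw [real_inner_self_eq_norm_sq, oscVariance]
    field_simp
    ring

lemma mixedMeasure_eq {d : ℕ} {lam T : ℝ} (hlam : 0 < lam) (hT : 0 < T) :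
    mixedMeasure d lam T = (gaussMeasure d (oscVariance lam T)).map fun x => (x, x) := by
  simp only [mixedMeasure, inv_partitionFn_mul_mehler hlam hT]
  rfl

lemma isProbabilityMeasure_mixedMeasure {d : ℕ} {lam T : ℝ} (hlam : 0 < lam) (hT : 0 < T) :
    IsProbabilityMeasure (mixedMeasure d lam T) := by
  have := isProbabilityMeasure_gaussMeasure (d := d) (oscVariance_pos hlam hT)
  rw [mixedMeasure_eq hlam hT]
  exact Measure.isProbabilityMeasure_map (by fun_prop)

lemma mehler_le {d : ℕ} {lam t : ℝ} (hlam : 0 < lam) (ht : 0 < t) (x y : E d) :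
    mehler lam x t y ≤ (2 * Real.pi * Real.sinh (lam * t) / lam) ^ (-(d : ℝ) / 2) := by
  have hs := sinh_pos_of hlam ht
  have hpi := Real.pi_pos
  refine mul_le_of_le_one_right (by positivity) (Real.exp_le_one_iff.mpr ?_)
  apply div_nonpos_of_nonpos_of_nonneg _ (by positivity)
  have h1 := Real.one_le_cosh (lam * t)
  have h2 := real_inner_le_norm x y
  have h3 : 0 ≤ Real.cosh (lam * t) * (‖x‖ ^ 2 + ‖y‖ ^ 2) - 2 * ⟪x, y⟫_ℝ := by
    nlinarith [sq_nonneg (‖x‖ - ‖y‖), sq_nonneg ‖x‖, sq_nonneg ‖y‖]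
  have := mul_nonneg hlam.le h3
  linarith

lemma integrable_hermiteFn {d : ℕ} {lam : ℝ} (hlam : 0 < lam) (m : Fin d → ℕ) :
    Integrable (hermiteFn lam m : E d → ℝ) := by
  obtain ⟨C, hC, h⟩ := hermiteFn_bound hlam m
  have h1 : Integrable fun x : E d => Real.exp (-(lam / 4) * ‖x‖ ^ 2) := by
    have h1 := GaussianFourier.integrable_cexp_neg_mul_sq_norm_add (V := E d)
      (b := ((lam / 4 : ℝ) : ℂ)) (by rw [Complex.ofReal_re]; positivity) 0 0
    refine h1.norm.congr (Eventually.of_forall fun x => ?_)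
    simp only [inner_zero_left, Complex.ofReal_zero, mul_zero, add_zero, Complex.norm_exp]
    congr 1
    rw [← Complex.ofReal_pow, ← Complex.ofReal_neg, ← Complex.ofReal_mul, Complex.ofReal_re]
  refine (h1.const_mul C).mono' (continuous_hermiteFn lam m).aestronglyMeasurable
    (Eventually.of_forall fun x => ?_)
  simpa using h x

lemma integrable_levelDensity {d : ℕ} {lam T : ℝ} (hlam : 0 < lam) (hT : 0 < T) (m : Fin d → ℕ) :
    Integrable (levelDensity lam T m : E d × E d → ℝ) := by
  have h := (integrable_hermiteFn hlam m).mul_prod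
    ((integrable_hermiteFn hlam m).const_mul (Real.exp (T * energy lam m)))
  have h2 := h.bdd_mul (c := (2 * Real.pi * Real.sinh (lam * T) / lam) ^ (-(d : ℝ) / 2))
    (continuous_mehler (d := d) lam T).aestronglyMeasurable (Eventually.of_forall fun p => by
      rw [Real.norm_eq_abs, abs_of_pos (mehler_pos hlam hT _ _)]; exact mehler_le hlam hT _ _)
  refine h2.congr (Eventually.of_forall fun p => ?_)
  simp only [levelDensity, initialDatum, finalDatum]
  ring

/-! ### The Gibbs density operator and its traces -/

lemma coeFn_hermiteL2 {d : ℕ} {lam : ℝ} (hlam : 0 < lam) (m : Fin d → ℕ) :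
    (hermiteL2 hlam m : E d → ℂ) =ᵐ[volume] fun x => (hermiteFn lam m x : ℂ) :=
  (memLp_hermiteFn hlam m).coeFn_toLp

lemma orthonormal_hermiteL2 {d : ℕ} {lam : ℝ} (hlam : 0 < lam) :
    Orthonormal ℂ (hermiteL2 hlam : (Fin d → ℕ) → L2 d) := by
  rw [orthonormal_iff_ite]
  intro m n
  rw [L2.inner_def]
  have h : ∫ x : E d, ((hermiteFn lam m x * hermiteFn lam n x : ℝ) : ℂ) = if m = n then 1 else 0 := by
    rw [integral_complex_ofReal, integral_hermiteFn_mul hlam]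
    split_ifs <;> simp
  rw [← h]
  refine integral_congr_ae ?_
  filter_upwards [coeFn_hermiteL2 hlam m, coeFn_hermiteL2 hlam n] with x h1 h2
  rw [h1, h2]
  simp [mul_comm]

lemma norm_hermiteL2 {d : ℕ} {lam : ℝ} (hlam : 0 < lam) (m : Fin d → ℕ) :
    ‖hermiteL2 hlam m‖ = 1 := (orthonormal_hermiteL2 hlam).1 m

lemma hasSum_densityOperator {d : ℕ} {lam T : ℝ} (hlam : 0 < lam) (hT : 0 < T) (f : L2 d) :
    HasSum (fun m : Fin d → ℕ =>
      ((gibbsWeight lam T m : ℂ) * ⟪hermiteL2 hlam m, f⟫_ℂ) • hermiteL2 hlam m)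
      (densityOperator d hlam T f) := by
  have hs : Summable fun m : Fin d → ℕ => (gibbsWeight lam T m : ℂ) •
      InnerProductSpace.rankOne ℂ (hermiteL2 hlam m) (hermiteL2 hlam m) := by
    refine Summable.of_norm ?_
    refine (hasSum_gibbsWeight (d := d) hlam hT).summable.congr fun m => ?_
    rw [norm_smul, InnerProductSpace.norm_rankOne, norm_hermiteL2, Complex.norm_real,
      Real.norm_eq_abs, abs_of_pos (gibbsWeight_pos hlam hT m)]
    simp
  have h := hs.hasSum.mapL (ContinuousLinearMap.apply ℂ (L2 d) f)
  convert! h using 1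
  ext1 m
  simp only [ContinuousLinearMap.apply_apply, smul_apply,
    InnerProductSpace.rankOne_apply, smul_smul]

/-- The trace of the composition of an operator `∑ₘ pₘ (·, hₘ) hₘ` with a bounded operator. -/
lemma hasTrace_comp {d : ℕ} {κ : Type*} {p : κ → ℝ} (hp : ∀ m, 0 ≤ p m) (hps : Summable p)
    {h : κ → L2 d} (hh : ∀ m, ‖h m‖ = 1) {R : L2 d →L[ℂ] L2 d}
    (hR : ∀ f, HasSum (fun m => ((p m : ℂ) * ⟪h m, f⟫_ℂ) • h m) (R f)) (B : L2 d →L[ℂ] L2 d)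
    {c : ℂ} (hc : HasSum (fun m => (p m : ℂ) * ⟪h m, B (h m)⟫_ℂ) c) :
    HasTrace (R ∘L B) c := by
  intro ι e
  let B' := ContinuousLinearMap.adjoint B
  let F : κ × ι → ℂ := fun q => (p q.1 : ℂ) * (⟪B' (h q.1), e q.2⟫_ℂ * ⟪e q.2, h q.1⟫_ℂ)
  have hrow : ∀ m, HasSum (fun n => F (m, n)) ((p m : ℂ) * ⟪h m, B (h m)⟫_ℂ) := by
    intro m
    have h1 := (e.hasSum_inner_mul_inner (B' (h m)) (h m)).mul_left (p m : ℂ)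
    rwa [ContinuousLinearMap.adjoint_inner_left] at h1
  have hcol : ∀ n, HasSum (fun m => F (m, n)) ⟪e n, (R ∘L B) (e n)⟫_ℂ := by
    intro n
    have h1 := (hR (B (e n))).mapL (innerSL ℂ (e n))
    convert! h1 using 1
    ext m
    simp only [F, B', ContinuousLinearMap.adjoint_inner_left]
    simp
    ring
  -- Absolute summability: Bessel's inequality in `n`, then summability of the weights in `m`.
  have hbes : ∀ x : L2 d, Summable (fun n => ‖⟪e n, x⟫_ℂ‖ ^ 2) ∧
      ∑' n, ‖⟪e n, x⟫_ℂ‖ ^ 2 ≤ ‖x‖ ^ 2 := fun x =>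
    ⟨e.orthonormal.inner_products_summable x, e.orthonormal.tsum_inner_products_le x⟩
  have hle : ∀ m n, ‖F (m, n)‖ ≤
      p m * ((‖⟪e n, B' (h m)⟫_ℂ‖ ^ 2 + ‖⟪e n, h m⟫_ℂ‖ ^ 2) / 2) := by
    intro m n
    simp only [F, norm_mul, Complex.norm_real, Real.norm_eq_abs, abs_of_nonneg (hp m)]
    refine mul_le_mul_of_nonneg_left ?_ (hp m)
    rw [norm_inner_symm]
    nlinarith [sq_nonneg (‖⟪e n, B' (h m)⟫_ℂ‖ - ‖⟪e n, h m⟫_ℂ‖)]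
  have hsb : ∀ m, Summable fun n => p m * ((‖⟪e n, B' (h m)⟫_ℂ‖ ^ 2 + ‖⟪e n, h m⟫_ℂ‖ ^ 2) / 2) :=
    fun m => (((hbes _).1.add (hbes _).1).div_const 2).mul_left _
  have hsn : ∀ m, Summable fun n => ‖F (m, n)‖ := fun m =>
    Summable.of_nonneg_of_le (fun n => norm_nonneg _) (hle m) (hsb m)
  have hF : Summable F := by
    refine Summable.of_norm ((summable_prod_of_nonneg fun q => norm_nonneg _).mpr ⟨hsn, ?_⟩)
    refine Summable.of_nonneg_of_le (fun m => tsum_nonneg fun n => norm_nonneg _) (fun m => ?_)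
      (hps.mul_right ((‖B'‖ ^ 2 + 1) / 2))
    refine ((hsn m).tsum_le_tsum (hle m) (hsb m)).trans ?_
    rw [tsum_mul_left, tsum_div_const, (hbes _).1.tsum_add (hbes _).1]
    refine mul_le_mul_of_nonneg_left ?_ (hp m)
    have h1 := (hbes (B' (h m))).2
    have h2 := (hbes (h m)).2
    have h3 : ‖B' (h m)‖ ≤ ‖B'‖ := by simpa [hh] using B'.le_opNorm (h m)
    have h4 : ‖B' (h m)‖ ^ 2 ≤ ‖B'‖ ^ 2 := pow_le_pow_left₀ (norm_nonneg _) h3 2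
    rw [hh, one_pow] at h2
    linarith
  have h1 := hF.hasSum.prod_fiberwise hrow
  have h2 := ((Equiv.prodComm ι κ).hasSum_iff.mpr hF.hasSum).prod_fiberwise hcol
  rwa [h1.unique hc] at h2

lemma inner_hermiteL2_mulOperator {d : ℕ} {lam : ℝ} (hlam : 0 < lam) (m : Fin d → ℕ)
    (b : E d → ℝ) (hb : MemLp b ∞ volume) :
    ⟪hermiteL2 hlam m, mulOperator b hb (hermiteL2 hlam m)⟫_ℂ
      = ((∫ x, b x * hermiteFn lam m x ^ 2 : ℝ) : ℂ) := by
  rw [L2.inner_def, ← integral_complex_ofReal]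
  refine integral_congr_ae ?_
  have h3 : (mulOperator b hb (hermiteL2 hlam m) : E d → ℂ) =ᵐ[volume] fun x =>
      (MemLp.toLp (fun x => (b x : ℂ)) hb.ofReal : Lp ℂ ∞ volume) x * hermiteL2 hlam m x :=
    (ContinuousLinearMap.mul ℂ ℂ).coeFn_holder (r := 2) _ _
  have h5 : (MemLp.toLp (fun x => (b x : ℂ)) hb.ofReal : Lp ℂ ∞ volume)
      =ᵐ[volume] fun x => (b x : ℂ) := MemLp.coeFn_toLp _
  filter_upwards [coeFn_hermiteL2 hlam m, h3, h5] with x h1 h2 h4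
  rw [h2, h1, h4]
  simp
  ring

lemma memLp_top_bound {d : ℕ} {b : E d → ℝ} (hb : MemLp b ∞ volume) :
    ∃ C, 0 ≤ C ∧ ∀ᵐ x ∂volume, |b x| ≤ C := by
  refine ⟨(eLpNorm b ∞ volume).toReal, ENNReal.toReal_nonneg, ?_⟩
  filter_upwards [ae_le_eLpNormEssSup (f := b) (μ := volume)] with x hx
  rw [eLpNorm_exponent_top]
  rw [← Real.norm_eq_abs, ← toReal_enorm]
  exact ENNReal.toReal_mono (by simpa using hb.2.ne) hx

lemma hasSum_gibbsWeight_mul_sq {d : ℕ} {lam T : ℝ} (hlam : 0 < lam) (hT : 0 < T) (x : E d) :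
    HasSum (fun m : Fin d → ℕ => gibbsWeight lam T m * hermiteFn lam m x ^ 2)
      (gaussianDensity lam T x) := by
  have h := (hasSum_mehler hlam hT x x).mul_left (partitionFn d lam T)⁻¹
  rw [inv_partitionFn_mul_mehler hlam hT] at h
  convert! h using 1
  ext m
  rw [gibbsWeight]
  ring

/-- The trace of `ℛ_λ B` is the mean of `b` for the Gaussian density. -/
lemma hasTrace_densityOperator_comp {d : ℕ} {lam T : ℝ} (hlam : 0 < lam) (hT : 0 < T)
    (b : E d → ℝ) (hb : MemLp b ∞ volume) :
    HasTrace (densityOperator d hlam T ∘L mulOperator b hb)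
      ((∫ x, b x * gaussianDensity lam T x : ℝ) : ℂ) := by
  refine hasTrace_comp (p := gibbsWeight lam T) (fun m => (gibbsWeight_pos hlam hT m).le)
    (hasSum_gibbsWeight hlam hT).summable (norm_hermiteL2 hlam)
    (hasSum_densityOperator hlam hT) _ ?_
  simp_rw [inner_hermiteL2_mulOperator, ← Complex.ofReal_mul]
  rw [Complex.hasSum_ofReal]
  obtain ⟨C, hC, hbC⟩ := memLp_top_bound hb
  simp_rw [← integral_const_mul]
  refine hasSum_integral_of_dominated_convergence
    (fun m x => C * (gibbsWeight lam T m * hermiteFn lam m x ^ 2)) (fun m => ?_) (fun m => ?_)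
    ?_ ?_ ?_
  · exact (hb.1.mul ((continuous_hermiteFn lam m).pow 2).aestronglyMeasurable).const_mul _
  · filter_upwards [hbC] with x hx
    have := gibbsWeight_pos hlam hT m
    rw [Real.norm_eq_abs, abs_mul, abs_mul, abs_of_pos this,
      abs_of_nonneg (sq_nonneg (hermiteFn lam m x)), mul_left_comm]
    gcongr
  · exact Eventually.of_forall fun x => ((hasSum_gibbsWeight_mul_sq hlam hT x).mul_left C).summable
  · have h := (integrable_gaussDensity (d := d) (oscVariance_pos hlam hT)).const_mul C
    refine h.congr (Eventually.of_forall fun x => ?_)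
    exact ((hasSum_gibbsWeight_mul_sq hlam hT x).mul_left C).tsum_eq.symm
  · refine Eventually.of_forall fun x => ?_
    convert! (hasSum_gibbsWeight_mul_sq hlam hT x).mul_left (b x) using 1
    ext m; ring

/-! ### Completeness of the Hermite functions -/

/-- A function whose bilateral Laplace transform vanishes identically is zero. -/
lemma ae_eq_zero_of_laplace {d : ℕ} {f : E d → ℝ}
    (hi : ∀ x : E d, Integrable fun y => Real.exp ⟪x, y⟫_ℝ * f y)
    (h0 : ∀ x : E d, ∫ y, Real.exp ⟪x, y⟫_ℝ * f y = 0) : f =ᵐ[volume] 0 := by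
  have hfi : Integrable f := by simpa using hi 0
  have hfm : AEMeasurable f := hfi.aemeasurable
  -- The positive and negative parts of `f` as finite measures.
  let μ₁ : Measure (E d) := volume.withDensity fun y => ENNReal.ofReal (f y)
  let μ₂ : Measure (E d) := volume.withDensity fun y => ENNReal.ofReal (-f y)
  have : IsFiniteMeasure μ₁ := isFiniteMeasure_withDensity_ofReal hfi.2
  have : IsFiniteMeasure μ₂ := isFiniteMeasure_withDensity_ofReal hfi.neg.2
  have key : ∀ (g : E d → ℝ), Integrable g → ∀ G : E d → ℝ, Continuous G →
      (Integrable (fun y => G y * g y) →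
      Integrable G (volume.withDensity fun y => ENNReal.ofReal (g y)) ∧
      ∫ y, G y ∂(volume.withDensity fun y => ENNReal.ofReal (g y)) = ∫ y, G y * max (g y) 0) := by
    intro g hg G hG hGg
    have hm := hg.aemeasurable.ennreal_ofReal
    have hlt : ∀ᵐ y ∂(volume : Measure (E d)), ENNReal.ofReal (g y) < ∞ :=
      Eventually.of_forall fun y => ENNReal.ofReal_lt_top
    constructor
    · rw [integrable_withDensity_iff_integrable_smul₀' hm hlt]
      refine hGg.mono (hm.ennreal_toReal.aestronglyMeasurable.smul hG.aestronglyMeasurable)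
        (Eventually.of_forall fun y => ?_)
      rw [ENNReal.toReal_ofReal', smul_eq_mul, norm_mul, norm_mul, mul_comm]
      gcongr
      rw [Real.norm_eq_abs, Real.norm_eq_abs, abs_of_nonneg (le_max_right _ _)]
      exact max_le (le_abs_self _) (abs_nonneg _)
    · rw [integral_withDensity_eq_integral_toReal_smul₀ hm hlt]
      refine integral_congr_ae (Eventually.of_forall fun y => ?_)
      simp [ENNReal.toReal_ofReal', mul_comm]
  have hexp : ∀ x : E d, Continuous fun y : E d => Real.exp ⟪x, y⟫_ℝ := fun x => by fun_prop
  have hineg : ∀ x : E d, Integrable fun y => Real.exp ⟪x, y⟫_ℝ * -f y := fun x => by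
    simpa using (hi x).neg
  have hk1 := fun x => key f hfi _ (hexp x) (hi x)
  have hk2 := fun x => key (fun y => -f y) hfi.neg _ (hexp x) (hineg x)
  have hmgf : ∀ x : E d, ∫ y, Real.exp ⟪x, y⟫_ℝ ∂μ₁ = ∫ y, Real.exp ⟪x, y⟫_ℝ ∂μ₂ := by
    intro x
    rw [(hk1 x).2, (hk2 x).2, ← sub_eq_zero, ← integral_sub]
    · refine (integral_congr_ae ?_).trans (h0 x)
      refine (Eventually.of_forall fun y => ?_)
      simp only
      rw [← mul_sub]
      congr 1
      rcases le_total (f y) 0 with h | h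
      · rw [max_eq_right h, max_eq_left (by linarith)]; ring
      · rw [max_eq_left h, max_eq_right (by linarith)]; ring
    · refine (hi x).mono ((hexp x).aestronglyMeasurable.mul
        (hfm.max aemeasurable_const).aestronglyMeasurable) (Eventually.of_forall fun y => ?_)
      rw [norm_mul, norm_mul]
      gcongr
      rw [Real.norm_eq_abs, Real.norm_eq_abs, abs_of_nonneg (le_max_right _ _)]
      exact max_le (le_abs_self _) (abs_nonneg _)
    · refine (hi x).mono ((hexp x).aestronglyMeasurable.mul
        (hfm.neg.max aemeasurable_const).aestronglyMeasurable) (Eventually.of_forall fun y => ?_)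
      rw [norm_mul, norm_mul]
      gcongr
      rw [Real.norm_eq_abs, Real.norm_eq_abs, abs_of_nonneg (le_max_right _ _)]
      exact max_le (neg_le_abs _) (abs_nonneg _)
  have hμ : μ₁ = μ₂ := by
    have hz : μ₁ = 0 ↔ μ₂ = 0 := by
      have h1 := hmgf 0
      simp only [inner_zero_left, Real.exp_zero, integral_const, smul_eq_mul, mul_one] at h1
      rw [← Measure.measure_univ_eq_zero, ← Measure.measure_univ_eq_zero,
        ← measureReal_eq_zero_iff, ← measureReal_eq_zero_iff, h1]
    refine Measure.ext_of_charFun (funext fun x => ?_)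
    -- The moment generating functions of the linear functionals agree, hence so do their
    -- analytic continuations.
    have h1 : mgf (fun y => ⟪x, y⟫_ℝ) μ₁ = mgf (fun y => ⟪x, y⟫_ℝ) μ₂ := by
      ext t
      have := hmgf (t • x)
      simpa only [mgf, inner_smul_left, conj_trivial] using this
    have h2 : integrableExpSet (fun y => ⟪x, y⟫_ℝ) μ₁ = Set.univ := by
      refine Set.eq_univ_of_forall fun t => ?_
      have := (hk1 (t • x)).1
      simpa only [integrableExpSet, Set.mem_ofPred_eq, inner_smul_left, conj_trivial] using this
    have h3 := eqOn_complexMGF_of_mgf' h1 hz (x := Complex.I) (by simp [h2])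
    simp only [complexMGF] at h3
    rw [charFun_apply, charFun_apply]
    simpa only [mul_comm, real_inner_comm] using h3
  have hae := (withDensity_eq_iff hfm.ennreal_ofReal hfm.neg.ennreal_ofReal
    (by simpa using (hfi.lintegral_lt_top).ne)).mp hμ
  filter_upwards [hae] with y hy
  have hy' := congrArg ENNReal.toReal hy
  simp only [ENNReal.toReal_ofReal', Pi.neg_apply] at hy'
  rcases le_total (f y) 0 with h | h
  · rw [max_eq_right h, max_eq_left (by linarith)] at hy'; simp; linarith
  · rw [max_eq_left h, max_eq_right (by linarith)] at hy'; simp; linarith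

/-- A square-integrable function orthogonal to all Hermite functions is zero. -/
lemma ae_eq_zero_of_hermiteFn {d : ℕ} {lam : ℝ} (hlam : 0 < lam) {f : E d → ℝ}
    (hf : MemLp f 2 volume) (h0 : ∀ m : Fin d → ℕ, ∫ y, hermiteFn lam m y * f y = 0) :
    f =ᵐ[volume] 0 := by
  have hf2 : Integrable fun y => f y ^ 2 := hf.integrable_sq
  have hh2 : ∀ m : Fin d → ℕ, Integrable fun y : E d => hermiteFn lam m y ^ 2 := by
    intro m
    have := (memLp_hermiteFn hlam m).integrable_norm_pow (by norm_num)
    simpa using this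
  have hhi : ∀ m : Fin d → ℕ, ∫ y : E d, hermiteFn lam m y ^ 2 = 1 := by
    intro m
    simpa [pow_two] using integral_hermiteFn_mul hlam m m
  have hprod : ∀ m : Fin d → ℕ, Integrable fun y => hermiteFn lam m y * f y := by
    intro m
    refine (((hh2 m).add hf2).div_const 2).mono'
      ((continuous_hermiteFn lam m).aestronglyMeasurable.mul hf.1) (Eventually.of_forall fun y => ?_)
    simp only [Pi.add_apply]
    rw [Real.norm_eq_abs, abs_le]
    constructor <;> nlinarith [sq_nonneg (hermiteFn lam m y - f y),
      sq_nonneg (hermiteFn lam m y + f y)]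
  -- Integrating Mehler's formula against `f`.
  have hmehler : ∀ x : E d, ∫ y, mehler lam x 1 y * f y = 0 := by
    intro x
    have hs : HasSum (fun m : Fin d → ℕ => ∫ y, Real.exp (-(1 * energy lam m)) * hermiteFn lam m x *
        hermiteFn lam m y * f y) (∫ y, ∑' m : Fin d → ℕ, Real.exp (-(1 * energy lam m)) *
          hermiteFn lam m x * hermiteFn lam m y * f y) := by
      refine hasSum_integral_of_summable_integral_norm (fun m => ?_) ?_
      · refine ((hprod m).const_mul (Real.exp (-(1 * energy lam m)) * hermiteFn lam m x)).congr
          (Eventually.of_forall fun y => by simp only; ring)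
      · have hsum : Summable fun m : Fin d → ℕ => (Real.exp (-(1 * energy lam m)) +
            Real.exp (-(1 * energy lam m)) * hermiteFn lam m x * hermiteFn lam m x) / 2 *
            ((1 + ∫ y, f y ^ 2) / 2) :=
          (((hasSum_exp_energy hlam one_pos).summable.add
            (hasSum_mehler hlam one_pos x x).summable).div_const 2).mul_right _
        refine Summable.of_nonneg_of_le (fun m => integral_nonneg fun y => norm_nonneg _)
          (fun m => ?_) hsum
        have e : ∀ y, ‖Real.exp (-(1 * energy lam m)) * hermiteFn lam m x * hermiteFn lam m y * f y‖
            = (Real.exp (-(1 * energy lam m)) * |hermiteFn lam m x|) *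
              ‖hermiteFn lam m y * f y‖ := by
          intro y
          rw [mul_assoc, norm_mul, norm_mul (Real.exp _), Real.norm_eq_abs, Real.norm_eq_abs,
            abs_of_pos (Real.exp_pos _)]
        simp_rw [e]
        rw [integral_const_mul]
        have hI0 : 0 ≤ ∫ y, f y ^ 2 := integral_nonneg fun y => sq_nonneg _
        refine mul_le_mul ?_ ?_ (integral_nonneg fun y => norm_nonneg _) ?_
        · have hp := Real.exp_pos (-(1 * energy lam m))
          have : |hermiteFn lam m x| ≤ (1 + hermiteFn lam m x * hermiteFn lam m x) / 2 := by
            rw [← pow_two, ← sq_abs]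
            nlinarith [sq_nonneg (|hermiteFn lam m x| - 1)]
          nlinarith
        · rw [← hhi m, ← integral_add (hh2 m) hf2, ← integral_div]
          refine integral_mono (hprod m).norm (((hh2 m).add hf2).div_const 2) fun y => ?_
          simp only
          rw [Real.norm_eq_abs, abs_le]
          constructor <;> nlinarith [sq_nonneg (hermiteFn lam m y - f y),
            sq_nonneg (hermiteFn lam m y + f y)]
        · have := (Real.exp_pos (-(1 * energy lam m)))
          have h2 := mul_self_nonneg (hermiteFn lam m x)
          nlinarith
    have e1 : ∀ y, ∑' m : Fin d → ℕ, Real.exp (-(1 * energy lam m)) *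
          hermiteFn lam m x * hermiteFn lam m y * f y = mehler lam x 1 y * f y := fun y =>
      ((hasSum_mehler hlam one_pos x y).mul_right (f y)).tsum_eq
    have e2 : ∀ m : Fin d → ℕ, ∫ y, Real.exp (-(1 * energy lam m)) * hermiteFn lam m x *
        hermiteFn lam m y * f y = 0 := by
      intro m
      simp_rw [mul_assoc]
      rw [integral_const_mul, integral_const_mul, h0 m]
      simp
    simp_rw [e1, e2] at hs
    exact hs.unique hasSum_zero
  have hsp := sinh_pos_of hlam one_pos
  set S := Real.sinh (lam * 1)
  set C := Real.cosh (lam * 1) with hC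
  have hCp : 0 < C := Real.cosh_pos _
  have hpi := Real.pi_pos
  let w : E d → ℝ := fun y => Real.exp (-(lam * C / (2 * S)) * ‖y‖ ^ 2)
  have hw : ∀ x y : E d, mehler lam ((S / lam) • x) 1 y =
      ((2 * Real.pi * S / lam) ^ (-(d : ℝ) / 2) *
        Real.exp (-(lam * C / (2 * S)) * ‖(S / lam) • x‖ ^ 2)) * (Real.exp ⟪x, y⟫_ℝ * w y) := by
    intro x y
    simp only [w]
    rw [mehler, mul_assoc (_ ^ _) (Real.exp _) (Real.exp _ * Real.exp _), ← Real.exp_add,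
      ← Real.exp_add]
    congr 2
    rw [inner_smul_left, show Real.sinh (lam * 1) = S from rfl,
      show Real.cosh (lam * 1) = C from rfl]
    simp only [conj_trivial]
    field_simp
    ring
  -- Up to factors, Mehler's kernel is the kernel of the Laplace transform of `w f`.
  have h1 : (fun y => w y * f y) =ᵐ[volume] 0 := by
    refine ae_eq_zero_of_laplace (fun x => ?_) (fun x => ?_)
    · have hg : MemLp (fun y : E d => Real.exp ⟪x, y⟫_ℝ * w y) 2 volume := by
        have hc : Continuous fun y : E d => Real.exp ⟪x, y⟫_ℝ * w y := by fun_prop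
        rw [memLp_two_iff_integrable_sq hc.aestronglyMeasurable]
        have h := GaussianFourier.integrable_cexp_neg_mul_sq_norm_add (V := E d)
          (b := ((lam * C / S : ℝ) : ℂ)) (by rw [Complex.ofReal_re]; positivity) 2 x
        refine h.norm.congr (Eventually.of_forall fun y => ?_)
        simp only [w]
        rw [Complex.norm_exp, ← Real.exp_add, ← Real.exp_nat_mul]
        congr 1
        have : (-((lam * C / S : ℝ) : ℂ) * (‖y‖ : ℂ) ^ 2 + 2 * (⟪x, y⟫_ℝ : ℂ))
          = ((-(lam * C / S) * ‖y‖ ^ 2 + 2 * ⟪x, y⟫_ℝ : ℝ) : ℂ) := by push_cast; ring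
        rw [this, Complex.ofReal_re]
        push_cast
        field_simp
        ring
      refine (hg.integrable_mul hf).congr (Eventually.of_forall fun y => ?_)
      simp only [Pi.mul_apply]
      ring
    · have h := hmehler ((S / lam) • x)
      simp_rw [hw] at h
      simp_rw [mul_assoc] at h
      rw [integral_const_mul, integral_const_mul] at h
      have h2 := (mul_eq_zero.mp h).resolve_left (by positivity)
      exact (mul_eq_zero.mp h2).resolve_left (Real.exp_pos _).ne'
  filter_upwards [h1] with y hy
  exact (mul_eq_zero.mp hy).resolve_left (Real.exp_pos _).ne'

/-- The Hermite functions as a Hilbert basis of `L²(ℝᵈ)`. -/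
def hermiteBasis {d : ℕ} {lam : ℝ} (hlam : 0 < lam) : HilbertBasis (Fin d → ℕ) ℂ (L2 d) :=
  HilbertBasis.mkOfOrthogonalEqBot (orthonormal_hermiteL2 hlam) (by
    rw [Submodule.eq_bot_iff]
    intro f hf
    have hfm : MemLp (f : E d → ℂ) 2 volume := Lp.memLp f
    have h0 : ∀ m : Fin d → ℕ, ∫ y, (hermiteFn lam m y : ℂ) * f y = 0 := by
      intro m
      have h1 : ⟪hermiteL2 hlam m, f⟫_ℂ = 0 :=
        Submodule.mem_orthogonal _ _ |>.mp hf _ (Submodule.subset_span ⟨m, rfl⟩)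
      rw [L2.inner_def] at h1
      rw [← h1]
      refine integral_congr_ae ?_
      filter_upwards [coeFn_hermiteL2 hlam m] with y hy
      rw [hy]
      simp [mul_comm]
    have hint : ∀ m : Fin d → ℕ, Integrable fun y => (hermiteFn lam m y : ℂ) * f y := fun m =>
      (memLp_hermiteFn hlam m).integrable_mul hfm
    have hre := ae_eq_zero_of_hermiteFn hlam hfm.re fun m => by
      have h1 := integral_re (𝕜 := ℂ) (hint m)
      rw [h0 m] at h1
      simpa using h1
    have him := ae_eq_zero_of_hermiteFn hlam hfm.im fun m => by
      have h1 := integral_im (𝕜 := ℂ) (hint m)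
      rw [h0 m] at h1
      simpa using h1
    rw [Lp.eq_zero_iff_ae_eq_zero]
    filter_upwards [hre, him] with y h1 h2
    exact Complex.ext (by simpa using h1) (by simpa using h2))

/-- Parseval's identity for the Hermite functions. -/
lemma hasSum_integral_hermiteFn_mul {d : ℕ} {lam : ℝ} (hlam : 0 < lam) {u v : E d → ℝ}
    (hu : MemLp u 2 volume) (hv : MemLp v 2 volume) :
    HasSum (fun m : Fin d → ℕ => (∫ x, u x * hermiteFn lam m x) * ∫ x, v x * hermiteFn lam m x)
      (∫ x, u x * v x) := by
  have huc : MemLp (fun x => (u x : ℂ)) 2 (volume : Measure (E d)) := hu.ofReal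
  have hvc : MemLp (fun x => (v x : ℂ)) 2 (volume : Measure (E d)) := hv.ofReal
  have h := (hermiteBasis hlam).hasSum_inner_mul_inner huc.toLp hvc.toLp
  rw [← Complex.hasSum_ofReal]
  have hb : ∀ m : Fin d → ℕ, hermiteBasis hlam m = hermiteL2 hlam m := fun m => by
    rw [hermiteBasis, HilbertBasis.coe_mkOfOrthogonalEqBot]
  convert! h using 1
  · ext m
    rw [Complex.ofReal_mul, hb, L2.inner_def, L2.inner_def, ← integral_complex_ofReal,
      ← integral_complex_ofReal]
    congr 1
    · refine integral_congr_ae ?_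
      filter_upwards [coeFn_hermiteL2 hlam m, huc.coeFn_toLp] with x h1 h2
      rw [h1, h2]; simp [mul_comm]
    · refine integral_congr_ae ?_
      filter_upwards [coeFn_hermiteL2 hlam m, hvc.coeFn_toLp] with x h1 h2
      rw [h1, h2]; simp
  · rw [L2.inner_def, ← integral_complex_ofReal]
    refine integral_congr_ae ?_
    filter_upwards [huc.coeFn_toLp, hvc.coeFn_toLp] with x h1 h2
    rw [h1, h2]; simp [mul_comm]

/-! ### The endpoint measure as a mixture -/

lemma integrable_mehler_mul_mehler {d : ℕ} {lam s t : ℝ} (hlam : 0 < lam) (hs : 0 < s) (ht : 0 < t)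
    (x y : E d) : Integrable fun z => mehler lam x s z * mehler lam z t y := by
  simp_rw [mehler_mul_mehler hlam hs ht]
  exact ((integrable_gaussDensity (bridge_variance_pos hlam hs ht)).comp_sub_right _).const_mul _

lemma integral_mehler_mul_mehler {d : ℕ} {lam s t : ℝ} (hlam : 0 < lam) (hs : 0 < s) (ht : 0 < t)
    (x y : E d) : ∫ z, mehler lam x s z * mehler lam z t y = mehler lam x (s + t) y := by
  rw [integral_eq_lintegral_of_nonneg_ae (Eventually.of_forall fun z =>
    (mul_pos (mehler_pos hlam hs x z) (mehler_pos hlam ht z y)).le)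
    (integrable_mehler_mul_mehler hlam hs ht x y).aestronglyMeasurable,
    lintegral_mehler_mul_mehler hlam hs ht,
    ENNReal.toReal_ofReal (mehler_pos hlam (add_pos hs ht) x y).le]

lemma _root_.Continuous.mehler {d : ℕ} {X : Type*} [TopologicalSpace X] {f g : X → E d}
    (hf : Continuous f) (hg : Continuous g) (lam s : ℝ) :
    Continuous fun a => mehler lam (f a) s (g a) := by
  unfold PeriodicOU.mehler
  fun_prop

lemma integrable_mul_mehler_mul_mehler {d : ℕ} {lam s : ℝ} (hlam : 0 < lam) (hs : 0 < s)
    {f : E d × E d → ℝ} (hf : Integrable f) :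
    Integrable fun q : (E d × E d) × E d =>
      f q.1 * (mehler lam q.1.1 s q.2 * mehler lam q.2 s q.1.2) := by
  have hc : Continuous fun q : (E d × E d) × E d =>
      mehler lam q.1.1 s q.2 * mehler lam q.2 s q.1.2 :=
    (Continuous.mehler (by fun_prop) (by fun_prop) lam s).mul
      (Continuous.mehler (by fun_prop) (by fun_prop) lam s)
  have hm : AEStronglyMeasurable (fun q : (E d × E d) × E d =>
      f q.1 * (mehler lam q.1.1 s q.2 * mehler lam q.2 s q.1.2)) (volume.prod volume) :=
    AEStronglyMeasurable.mul hf.1.comp_fst hc.aestronglyMeasurable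
  refine (integrable_prod_iff hm).mpr ⟨?_, ?_⟩
  · refine Eventually.of_forall fun p => ?_
    have h := Integrable.const_mul (integrable_mehler_mul_mehler hlam hs hs p.1 p.2) (f p)
    simp only
    exact h
  · have e : ∀ p : E d × E d, ∫ z, ‖f p * (mehler lam p.1 s z * mehler lam z s p.2)‖
        = mehler lam p.1 (s + s) p.2 * ‖f p‖ := by
      intro p
      simp_rw [norm_mul (f p)]
      rw [integral_const_mul, mul_comm]
      congr 1
      rw [← integral_mehler_mul_mehler hlam hs hs]
      refine integral_congr_ae (Eventually.of_forall fun z => ?_)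
      exact Real.norm_of_nonneg (mul_pos (mehler_pos hlam hs _ z) (mehler_pos hlam hs z _)).le
    simp_rw [e]
    refine hf.norm.bdd_mul (c := (2 * Real.pi * Real.sinh (lam * (s + s)) / lam) ^ (-(d : ℝ) / 2))
      (continuous_mehler (d := d) lam _).aestronglyMeasurable (Eventually.of_forall fun p => ?_)
    rw [Real.norm_eq_abs, abs_of_pos (mehler_pos hlam (add_pos hs hs) _ _)]
    exact mehler_le hlam (add_pos hs hs) _ _

/-- The semigroup property, tested against a product. -/
lemma integral_mul_mehler_eq {d : ℕ} {lam s : ℝ} (hlam : 0 < lam) (hs : 0 < s)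
    {u v : E d → ℝ} (hu : Integrable u) (hv : Integrable v) :
    (Integrable fun z => (∫ x, u x * mehler lam x s z) * ∫ y, v y * mehler lam y s z) ∧
    ∫ p : E d × E d, u p.1 * v p.2 * mehler lam p.1 (s + s) p.2
      = ∫ z, (∫ x, u x * mehler lam x s z) * ∫ y, v y * mehler lam y s z := by
  have hG := integrable_mul_mehler_mul_mehler hlam hs (hu.mul_prod hv)
  have e : ∀ z, ∫ p : E d × E d, u p.1 * v p.2 * (mehler lam p.1 s z * mehler lam z s p.2)
      = (∫ x, u x * mehler lam x s z) * ∫ y, v y * mehler lam y s z := by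
    intro z
    rw [← integral_prod_mul]
    refine integral_congr_ae (Eventually.of_forall fun p => ?_)
    simp only
    rw [mehler_comm lam s z]; ring
  constructor
  · exact (hG.integral_prod_right).congr (Eventually.of_forall e)
  · simp_rw [← e]
    rw [← integral_integral_swap hG]
    refine integral_congr_ae (Eventually.of_forall fun p => ?_)
    simp only
    rw [integral_const_mul, integral_mehler_mul_mehler hlam hs hs]

lemma memLp_indicator_mehler {d : ℕ} {lam s : ℝ} (hlam : 0 < lam) (hs : 0 < s) {F : Set (E d)}
    (hF : MeasurableSet F) (z : E d) :
    MemLp (F.indicator fun x => mehler lam x s z) 2 volume := by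
  have hc : Continuous fun x : E d => mehler lam x s z :=
    Continuous.mehler (by fun_prop) (by fun_prop) lam s
  refine MemLp.indicator hF ((memLp_two_iff_integrable_sq hc.aestronglyMeasurable).mpr ?_)
  have h := integrable_mehler_mul_mehler hlam hs hs z z
  have e : (fun x : E d => mehler lam x s z ^ 2)
      = fun x => mehler lam z s x * mehler lam x s z := by
    ext x
    rw [mehler_comm lam s z x, pow_two]
  rw [e]
  exact h

lemma integrable_integral_mehler_sq {d : ℕ} {lam s : ℝ} (hlam : 0 < lam) (hs : 0 < s)
    (F : Set (E d)) :
    Integrable (fun z => ∫ x in F, mehler lam x s z * mehler lam z s x) ∧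
    ∫ z, ∫ x in F, mehler lam x s z * mehler lam z s x = ∫ x in F, mehler lam x (s + s) x := by
  have hi : Integrable (fun x : E d => mehler lam x (s + s) x) := by
    have h := (integrable_gaussDensity (d := d) (oscVariance_pos hlam (add_pos hs hs))).const_mul
      (partitionFn d lam (s + s))
    refine h.congr (Eventually.of_forall fun x => ?_)
    simp only
    rw [← gaussianDensity_eq, ← inv_partitionFn_mul_mehler hlam (add_pos hs hs),
      mul_inv_cancel_left₀ (partitionFn_pos hlam (add_pos hs hs)).ne']
  have hc : Continuous fun q : E d × E d => mehler lam q.1 s q.2 * mehler lam q.2 s q.1 :=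
    (Continuous.mehler (by fun_prop) (by fun_prop) lam s).mul
      (Continuous.mehler (by fun_prop) (by fun_prop) lam s)
  have hG : Integrable (fun q : E d × E d => mehler lam q.1 s q.2 * mehler lam q.2 s q.1)
      ((volume.restrict F).prod volume) := by
    refine (integrable_prod_iff hc.aestronglyMeasurable).mpr ⟨Eventually.of_forall fun x =>
      integrable_mehler_mul_mehler hlam hs hs x x, ?_⟩
    refine hi.integrableOn.congr (Eventually.of_forall fun x => ?_)
    simp only
    rw [← integral_mehler_mul_mehler hlam hs hs]
    refine integral_congr_ae (Eventually.of_forall fun z => ?_)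
    exact (Real.norm_of_nonneg (mul_pos (mehler_pos hlam hs _ z) (mehler_pos hlam hs z _)).le).symm
  refine ⟨hG.integral_prod_right, ?_⟩
  rw [← integral_integral_swap hG]
  simp_rw [integral_mehler_mul_mehler hlam hs hs]

lemma integral_indicator_mehler_mul {d : ℕ} {lam s : ℝ} {F G : Set (E d)}
    (hF : MeasurableSet F) (hG : MeasurableSet G) (z : E d) :
    ∫ x, F.indicator (fun x => mehler lam x s z) x * G.indicator (fun x => mehler lam x s z) x
      = ∫ x in F ∩ G, mehler lam x s z * mehler lam z s x := by
  rw [← integral_indicator (hF.inter hG)]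
  refine integral_congr_ae (Eventually.of_forall fun x => ?_)
  simp only
  rw [← Set.inter_indicator_mul]
  simp only [Set.indicator, mehler_comm lam s z x]

/-- The endpoint measure is the mixture of the signed measures of the levels: Parseval's identity
for the Hermite functions is applied to the two halves of `g_T = g_{T/2} * g_{T/2}`. -/
lemma hasSum_mixedMeasure {d : ℕ} {lam T : ℝ} (hlam : 0 < lam) (hT : 0 < T) {F₀ FT : Set (E d)}
    (h₀ : MeasurableSet F₀) (h₁ : MeasurableSet FT) :
    HasSum (fun m : Fin d → ℕ => gibbsWeight lam T m * ∫ p in F₀ ×ˢ FT, levelDensity lam T m p)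
        ((mixedMeasure d lam T).real (F₀ ×ˢ FT)) := by
  have hs : 0 < T / 2 := half_pos hT
  have hss : T / 2 + T / 2 = T := by ring
  set u : E d → E d → ℝ := fun z => F₀.indicator fun x => mehler lam x (T / 2) z with hu
  set v : E d → E d → ℝ := fun z => FT.indicator fun x => mehler lam x (T / 2) z with hv
  let a : (Fin d → ℕ) → E d → ℝ := fun m z => ∫ x, u z x * hermiteFn lam m x
  let b : (Fin d → ℕ) → E d → ℝ := fun m z => ∫ x, v z x * hermiteFn lam m x
  have hu2 := fun z => memLp_indicator_mehler hlam hs h₀ z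
  have hv2 := fun z => memLp_indicator_mehler hlam hs h₁ z
  have hin : ∀ (m : Fin d → ℕ) (F : Set (E d)) (z : E d),
      ∫ x, F.indicator (fun x => mehler lam x (T / 2) z) x * hermiteFn lam m x =
      ∫ x, F.indicator (hermiteFn lam m) x * mehler lam x (T / 2) z := by
    intro m F z
    refine integral_congr_ae (Eventually.of_forall fun x => ?_)
    simp only [Set.indicator]
    split_ifs <;> ring
  have hlevel : ∀ m : Fin d → ℕ, (Integrable fun z => a m z * b m z) ∧
      gibbsWeight lam T m * ∫ p in F₀ ×ˢ FT, levelDensity lam T m p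
        = (partitionFn d lam T)⁻¹ * ∫ z, a m z * b m z := by
    intro m
    obtain ⟨h1, h2⟩ := integral_mul_mehler_eq hlam hs ((integrable_hermiteFn hlam m).indicator h₀)
      ((integrable_hermiteFn hlam m).indicator h₁)
    simp only [a, b, u, v, hin]
    refine ⟨h1, ?_⟩
    rw [← h2, hss, gibbsWeight, mul_assoc, ← integral_const_mul,
      ← integral_indicator (h₀.prod h₁)]
    congr 1
    refine integral_congr_ae (Eventually.of_forall fun p => ?_)
    simp only [Set.indicator, Set.mem_prod, levelDensity, initialDatum, finalDatum]
    have hexp : Real.exp (-(T * energy lam m)) * Real.exp (T * energy lam m) = 1 := by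
      rw [← Real.exp_add]; simp
    by_cases h1 : p.1 ∈ F₀ <;> by_cases h2 : p.2 ∈ FT <;> simp [h1, h2]
    linear_combination (hermiteFn lam m p.1 * mehler lam p.1 T p.2 * hermiteFn lam m p.2) * hexp
  -- Parseval for fixed `z`, integrated over `z` with the bound `|a b| ≤ (a² + b²) / 2`, whose sum is
  -- known from Parseval as well.
  have hsum : HasSum (fun m : Fin d → ℕ => ∫ z, a m z * b m z) (∫ z, ∫ x, u z x * v z x) := by
    have hbd : ∀ z, HasSum (fun m : Fin d → ℕ => (a m z * a m z + b m z * b m z) / 2)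
        (((∫ x, u z x * u z x) + ∫ x, v z x * v z x) / 2) := fun z =>
      ((hasSum_integral_hermiteFn_mul hlam (hu2 z) (hu2 z)).add
        (hasSum_integral_hermiteFn_mul hlam (hv2 z) (hv2 z))).div_const 2
    refine hasSum_integral_of_dominated_convergence
      (fun m z => (a m z * a m z + b m z * b m z) / 2) (fun m => (hlevel m).1.1)
      (fun m => Eventually.of_forall fun z => ?_) (Eventually.of_forall fun z => (hbd z).summable)
      ?_ (Eventually.of_forall fun z => hasSum_integral_hermiteFn_mul hlam (hu2 z) (hv2 z))
    · rw [Real.norm_eq_abs, abs_le]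
      constructor <;> nlinarith [sq_nonneg (a m z + b m z), sq_nonneg (a m z - b m z)]
    · have e : ∀ z, ∑' m : Fin d → ℕ, (a m z * a m z + b m z * b m z) / 2
          = ((∫ x in F₀ ∩ F₀, mehler lam x (T / 2) z * mehler lam z (T / 2) x)
            + ∫ x in FT ∩ FT, mehler lam x (T / 2) z * mehler lam z (T / 2) x) / 2 := by
        intro z
        rw [(hbd z).tsum_eq, ← integral_indicator_mehler_mul h₀ h₀,
          ← integral_indicator_mehler_mul h₁ h₁]
      simp_rw [e]
      exact ((integrable_integral_mehler_sq hlam hs (F₀ ∩ F₀)).1.add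
        (integrable_integral_mehler_sq hlam hs (FT ∩ FT)).1).div_const 2
  have hval : ∫ z, ∫ x, u z x * v z x = ∫ x in F₀ ∩ FT, mehler lam x T x := by
    simp only [hu, hv, integral_indicator_mehler_mul h₀ h₁]
    rw [(integrable_integral_mehler_sq hlam hs (F₀ ∩ FT)).2, hss]
  have hmeas : (mixedMeasure d lam T).real (F₀ ×ˢ FT)
      = (partitionFn d lam T)⁻¹ * ∫ x in F₀ ∩ FT, mehler lam x T x := by
    rw [measureReal_def, mixedMeasure, Measure.map_apply (by fun_prop) (h₀.prod h₁)]
    have hpre : (fun x : E d => (x, x)) ⁻¹' (F₀ ×ˢ FT) = F₀ ∩ FT := rfl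
    have hm : Measurable fun x : E d => mehler lam x T x :=
      (Continuous.mehler (by fun_prop) (by fun_prop) lam T).measurable
    have hp := partitionFn_pos (d := d) hlam hT
    rw [hpre, withDensity_apply _ (h₀.inter h₁), ← integral_const_mul,
      integral_eq_lintegral_of_nonneg_ae (Eventually.of_forall fun x =>
        (mul_pos (inv_pos.mpr hp) (mehler_pos hlam hT x x)).le)
        (hm.const_mul _).aestronglyMeasurable]
  rw [hmeas, ← hval]
  simp_rw [fun m => (hlevel m).2]
  exact hsum.mul_left _

/-! ### Gaussian processes with the periodic covariance -/

section

variable {d : ℕ} {Ω : Type*} [MeasurableSpace Ω] {P : Measure Ω}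

/-- The covariance of the process at two times at distance `u`. -/
def periodicCov (lam T u : ℝ) : ℝ :=
  Real.cosh (lam * (u - T / 2)) / (2 * lam * Real.sinh (lam * T / 2))

/-- `Z` is, on `[0, T]`, a centered Gaussian process in `ℝᵈ` with independent identically
distributed components and covariance `periodicCov lam T |t - s|`. This is expressed through the
characteristic functions of the finite-dimensional distributions. -/
structure IsPeriodicGaussian (lam T : ℝ) (Z : ℝ → Ω → E d) (P : Measure Ω) : Prop where
  aemeasurable : ∀ t ∈ Set.Icc 0 T, AEMeasurable (Z t) P
  charFun_fin : ∀ (n : ℕ) (t : Fin n → ℝ), (∀ k, t k ∈ Set.Icc 0 T) → ∀ c : Fin n → E d,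
    ∫ ω, Complex.exp (((∑ k, ⟪c k, Z (t k) ω⟫_ℝ : ℝ) : ℂ) * Complex.I) ∂P =
      Complex.exp (-((∑ k, ∑ l, periodicCov lam T |t k - t l| * ⟪c k, c l⟫_ℝ) / 2 : ℝ))

/-- A real random variable whose characteristic function is `exp (-q r² / 2)` is a centered
Gaussian of variance `q`. -/
lemma map_eq_gaussianReal_of_charFun [IsProbabilityMeasure P] {X : Ω → ℝ} (hX : AEMeasurable X P)
    {q : ℝ} (h : ∀ r : ℝ, ∫ ω, Complex.exp ((r * X ω : ℝ) * Complex.I) ∂P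
      = Complex.exp (-(r ^ 2 * q / 2 : ℝ))) :
    0 ≤ q ∧ P.map X = gaussianReal 0 q.toNNReal := by
  have hq : 0 ≤ q := by
    have h1 : ‖∫ ω, Complex.exp ((1 * X ω : ℝ) * Complex.I) ∂P‖ ≤ 1 := by
      refine (norm_integral_le_of_norm_le_const (C := 1) (Eventually.of_forall fun ω => ?_)).trans
        (by simp)
      rw [Complex.norm_exp_ofReal_mul_I]
    rw [h 1, Complex.norm_exp, Complex.neg_re, Complex.ofReal_re, Real.exp_le_one_iff] at h1
    linarith
  refine ⟨hq, ?_⟩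
  have := Measure.isProbabilityMeasure_map (μ := P) hX
  refine Measure.ext_of_charFun (funext fun r => ?_)
  rw [charFun_gaussianReal, charFun_apply_real, integral_map hX (by fun_prop)]
  have e : ∀ ω, Complex.exp (r * X ω * Complex.I)
      = Complex.exp ((r * X ω : ℝ) * Complex.I) := fun ω => by push_cast; rfl
  simp_rw [e]
  rw [h r]
  congr 1
  push_cast [Real.coe_toNNReal q hq]
  ring

lemma strongDual_pi_apply {ι : Type*} [Fintype ι] (L : StrongDual ℝ (ι → E d)) :
    ∃ c : ι → E d, ∀ x, L x = ∑ k, ⟪c k, x k⟫_ℝ := by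
  classical
  refine ⟨fun k => (InnerProductSpace.toDual ℝ (E d)).symm
    (L ∘L ContinuousLinearMap.single ℝ (fun _ => E d) k), fun x => ?_⟩
  simp only [InnerProductSpace.toDual_symm_apply, ContinuousLinearMap.comp_apply,
    ContinuousLinearMap.single_apply]
  rw [← map_sum, Finset.univ_sum_single]

namespace IsPeriodicGaussian

variable {lam T : ℝ} {Z : ℝ → Ω → E d}

lemma charFun_fintype (hZ : IsPeriodicGaussian lam T Z P) {ι : Type*} [Fintype ι] (t : ι → ℝ)
    (ht : ∀ k, t k ∈ Set.Icc 0 T) (c : ι → E d) :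
    ∫ ω, Complex.exp (((∑ k, ⟪c k, Z (t k) ω⟫_ℝ : ℝ) : ℂ) * Complex.I) ∂P =
      Complex.exp (-((∑ k, ∑ l, periodicCov lam T |t k - t l| * ⟪c k, c l⟫_ℝ) / 2 : ℝ)) := by
  let e := (Fintype.equivFin ι).symm
  have h := hZ.charFun_fin _ (fun k => t (e k)) (fun k => ht _) (fun k => c (e k))
  have h1 : ∀ ω, ∑ k, ⟪c (e k), Z (t (e k)) ω⟫_ℝ = ∑ k, ⟪c k, Z (t k) ω⟫_ℝ := fun ω =>
    e.sum_comp (fun k => ⟪c k, Z (t k) ω⟫_ℝ)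
  have h2 : ∑ k, ∑ l, periodicCov lam T |t (e k) - t (e l)| * ⟪c (e k), c (e l)⟫_ℝ
      = ∑ k, ∑ l, periodicCov lam T |t k - t l| * ⟪c k, c l⟫_ℝ := by
    rw [← e.sum_comp]
    refine Finset.sum_congr rfl fun k _ => ?_
    rw [← e.sum_comp (fun l => periodicCov lam T |t (e k) - t l| * ⟪c (e k), c l⟫_ℝ)]
  simp_rw [h1, h2] at h
  exact h

lemma aemeasurable_pi (hZ : IsPeriodicGaussian lam T Z P) {ι : Type*} [Fintype ι] {t : ι → ℝ}
    (ht : ∀ k, t k ∈ Set.Icc 0 T) : AEMeasurable (fun ω k => Z (t k) ω) P :=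
  aemeasurable_pi_lambda _ fun k => hZ.aemeasurable _ (ht k)

/-- The finite-dimensional distributions are determined by the mutual distances of the times. -/
lemma identDistrib [IsProbabilityMeasure P] (hZ : IsPeriodicGaussian lam T Z P) {Ω' : Type*}
    [MeasurableSpace Ω'] {P' : Measure Ω'} [IsProbabilityMeasure P'] {X : ℝ → Ω' → E d}
    (hX : IsPeriodicGaussian lam T X P') {ι : Type*} [Fintype ι] {t s : ι → ℝ}
    (ht : ∀ k, t k ∈ Set.Icc 0 T) (hs : ∀ k, s k ∈ Set.Icc 0 T)
    (hts : ∀ k l, |t k - t l| = |s k - s l|) :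
    IdentDistrib (fun ω k => Z (t k) ω) (fun ω k => X (s k) ω) P P' := by
  have h1 := hZ.aemeasurable_pi ht
  have h2 := hX.aemeasurable_pi hs
  refine ⟨h1, h2, ?_⟩
  have := Measure.isProbabilityMeasure_map (μ := P) h1
  have := Measure.isProbabilityMeasure_map (μ := P') h2
  refine Measure.ext_of_charFunDual (funext fun L => ?_)
  obtain ⟨c, hc⟩ := strongDual_pi_apply L
  rw [charFunDual_apply, charFunDual_apply, integral_map h1 (by fun_prop),
    integral_map h2 (by fun_prop)]
  simp_rw [hc]
  rw [hZ.charFun_fintype t ht c, hX.charFun_fintype s hs c]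
  simp_rw [hts]

lemma sameLaw [IsProbabilityMeasure P] (hZ : IsPeriodicGaussian lam T Z P) {Ω' : Type*}
    [MeasurableSpace Ω'] {P' : Measure Ω'} [IsProbabilityMeasure P'] {X : ℝ → Ω' → E d}
    (hX : IsPeriodicGaussian lam T X P') : SameLaw T Z P X P' := fun _ _ ht =>
  hZ.identDistrib hX ht ht fun _ _ => rfl

lemma isStationary [IsProbabilityMeasure P] (hZ : IsPeriodicGaussian lam T Z P) :
    IsStationary T Z P := fun _ _ _ ht hτ =>
  hZ.identDistrib hZ hτ ht fun _ _ => by rw [add_sub_add_right_eq_sub]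

lemma of_sameLaw (hZ : IsPeriodicGaussian lam T Z P) {Ω' : Type*}
    [MeasurableSpace Ω'] {P' : Measure Ω'} {X : ℝ → Ω' → E d}
    (h : SameLaw T Z P X P') : IsPeriodicGaussian lam T X P' where
  aemeasurable t ht := by
    have h1 := (h 1 (fun _ => t) fun _ => ht).aemeasurable_snd
    exact (aemeasurable_pi_iff.mp h1) 0
  charFun_fin n t ht c := by
    rw [← hZ.charFun_fin n t ht c]
    have h1 := (h n t ht).comp (u := fun x : Fin n → E d =>
      Complex.exp (((∑ k, ⟪c k, x k⟫_ℝ : ℝ) : ℂ) * Complex.I))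
      (Continuous.measurable (by fun_prop))
    exact h1.integral_eq.symm

/-- Linear functionals of the process are centered Gaussian variables. -/
lemma map_sum_inner [IsProbabilityMeasure P] (hZ : IsPeriodicGaussian lam T Z P) {ι : Type*}
    [Fintype ι] (t : ι → ℝ) (ht : ∀ k, t k ∈ Set.Icc 0 T) (c : ι → E d) :
    0 ≤ ∑ k, ∑ l, periodicCov lam T |t k - t l| * ⟪c k, c l⟫_ℝ ∧
    P.map (fun ω => ∑ k, ⟪c k, Z (t k) ω⟫_ℝ) = gaussianReal 0
      (∑ k, ∑ l, periodicCov lam T |t k - t l| * ⟪c k, c l⟫_ℝ).toNNReal := by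
  refine map_eq_gaussianReal_of_charFun ?_ fun r => ?_
  · have hc : Continuous fun x : ι → E d => ∑ k, ⟪c k, x k⟫_ℝ := by fun_prop
    exact hc.measurable.comp_aemeasurable (hZ.aemeasurable_pi ht)
  · have h := hZ.charFun_fintype t ht (fun k => r • c k)
    simp only [inner_smul_left, inner_smul_right, conj_trivial, ← Finset.mul_sum] at h
    rw [h]
    congr 3
    rw [Finset.mul_sum]
    congr 1
    refine Finset.sum_congr rfl fun k _ => ?_
    rw [Finset.mul_sum]
    refine Finset.sum_congr rfl fun l _ => ?_
    ring

lemma hasGaussianLaw_pi [IsProbabilityMeasure P] (hZ : IsPeriodicGaussian lam T Z P) {ι : Type*}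
    [Fintype ι] (t : ι → ℝ) (ht : ∀ k, t k ∈ Set.Icc 0 T) :
    HasGaussianLaw (fun ω k => Z (t k) ω) P where
  isGaussian_map := isGaussian_of_map_eq_gaussianReal fun L => by
    obtain ⟨c, hc⟩ := strongDual_pi_apply L
    refine ⟨0, (∑ k, ∑ l, periodicCov lam T |t k - t l| * ⟪c k, c l⟫_ℝ).toNNReal, ?_⟩
    rw [AEMeasurable.map_map_of_aemeasurable (by fun_prop) (hZ.aemeasurable_pi ht)]
    simp only [Function.comp_def, hc]
    exact (hZ.map_sum_inner t ht c).2

lemma isGaussianProcess [IsProbabilityMeasure P] (hZ : IsPeriodicGaussian lam T Z P) :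
    IsGaussianProcess (fun t : Set.Icc (0 : ℝ) T => Z t) P where
  hasGaussianLaw I := hZ.hasGaussianLaw_pi (fun k : I => ((k : Set.Icc (0 : ℝ) T) : ℝ))
    fun k => k.1.2

lemma hasGaussianLaw [IsProbabilityMeasure P] (hZ : IsPeriodicGaussian lam T Z P) {t : ℝ}
    (ht : t ∈ Set.Icc 0 T) : HasGaussianLaw (Z t) P :=
  (hZ.hasGaussianLaw_pi (fun _ : Unit => t) fun _ => ht).eval ()

lemma memLp_inner [IsProbabilityMeasure P] (hZ : IsPeriodicGaussian lam T Z P) {t : ℝ}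
    (ht : t ∈ Set.Icc 0 T) (x : E d) : MemLp (fun ω => ⟪x, Z t ω⟫_ℝ) 2 P :=
  ((hZ.hasGaussianLaw ht).map_fun (innerSL ℝ x)).memLp_two

lemma integral_inner [IsProbabilityMeasure P] (hZ : IsPeriodicGaussian lam T Z P) {t : ℝ}
    (ht : t ∈ Set.Icc 0 T) (x : E d) : ∫ ω, ⟪x, Z t ω⟫_ℝ ∂P = 0 := by
  have h := (hZ.map_sum_inner (fun _ : Unit => t) (fun _ => ht) fun _ => x).2
  simp only [Finset.univ_unique, Finset.sum_singleton] at h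
  have h1 := integral_map (μ := P) (f := id) (hZ.memLp_inner ht x).aemeasurable (by fun_prop)
  rw [h] at h1
  simpa using h1.symm

lemma integral_eq_zero [IsProbabilityMeasure P] (hZ : IsPeriodicGaussian lam T Z P) {t : ℝ}
    (ht : t ∈ Set.Icc 0 T) : ∫ ω, Z t ω ∂P = 0 := by
  refine ext_inner_left ℝ fun x => ?_
  rw [inner_zero_right, ← _root_.integral_inner (hZ.hasGaussianLaw ht).integrable]
  exact hZ.integral_inner ht x

lemma integrable_inner_add_inner_sq [IsProbabilityMeasure P] (hZ : IsPeriodicGaussian lam T Z P)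
    {s t : ℝ} (hs : s ∈ Set.Icc 0 T) (ht : t ∈ Set.Icc 0 T) (x y : E d) :
    Integrable (fun ω => (⟪x, Z s ω⟫_ℝ + ⟪y, Z t ω⟫_ℝ) ^ 2) P :=
  ((hZ.memLp_inner hs x).add (hZ.memLp_inner ht y)).integrable_sq

lemma integral_inner_add_inner_sq [IsProbabilityMeasure P] (hZ : IsPeriodicGaussian lam T Z P)
    {s t : ℝ} (hs : s ∈ Set.Icc 0 T) (ht : t ∈ Set.Icc 0 T) (x y : E d) :
    ∫ ω, (⟪x, Z s ω⟫_ℝ + ⟪y, Z t ω⟫_ℝ) ^ 2 ∂P =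
      periodicCov lam T 0 * (⟪x, x⟫_ℝ + ⟪y, y⟫_ℝ) + 2 * periodicCov lam T |t - s| * ⟪x, y⟫_ℝ := by
  obtain ⟨h0, h⟩ := hZ.map_sum_inner ![s, t] (Fin.forall_fin_two.mpr ⟨hs, ht⟩) ![x, y]
  simp only [Fin.sum_univ_two, Matrix.cons_val_zero, Matrix.cons_val_one] at h h0
  have hm : AEMeasurable (fun ω => ⟪x, Z s ω⟫_ℝ + ⟪y, Z t ω⟫_ℝ) P :=
    (hZ.memLp_inner hs x).aemeasurable.add (hZ.memLp_inner ht y).aemeasurable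
  have h1 := integral_map (μ := P) (f := fun r => r ^ 2) hm (by fun_prop)
  have h2 : ∀ v : ℝ≥0, ∫ r, r ^ 2 ∂(gaussianReal 0 v) = v := by
    intro v
    have h3 := variance_eq_integral (μ := gaussianReal 0 v) (X := id) (by fun_prop)
    rw [variance_id_gaussianReal] at h3
    simpa using h3.symm
  rw [← h1, h, h2, Real.coe_toNNReal _ h0, sub_self, sub_self, abs_zero, abs_sub_comm s t,
    real_inner_comm x y]
  ring

/-- The covariance of the process. -/
lemma integral_inner_mul_inner [IsProbabilityMeasure P] (hZ : IsPeriodicGaussian lam T Z P)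
    {s t : ℝ} (hs : s ∈ Set.Icc 0 T) (ht : t ∈ Set.Icc 0 T) (x y : E d) :
    ∫ ω, ⟪x, Z s ω⟫_ℝ * ⟪y, Z t ω⟫_ℝ ∂P = periodicCov lam T |t - s| * ⟪x, y⟫_ℝ := by
  have h1 := hZ.integral_inner_add_inner_sq hs ht x y
  have h2 := hZ.integral_inner_add_inner_sq hs ht x (-y)
  have hi1 := hZ.integrable_inner_add_inner_sq hs ht x y
  have hi2 := hZ.integrable_inner_add_inner_sq hs ht x (-y)
  have e : ∀ ω, ⟪x, Z s ω⟫_ℝ * ⟪y, Z t ω⟫_ℝ = ((⟪x, Z s ω⟫_ℝ + ⟪y, Z t ω⟫_ℝ) ^ 2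
      - (⟪x, Z s ω⟫_ℝ + ⟪-y, Z t ω⟫_ℝ) ^ 2) / 4 := by
    intro ω; rw [inner_neg_left]; ring
  simp_rw [e]
  rw [integral_div, integral_sub hi1 hi2, h1, h2, inner_neg_neg, inner_neg_right]
  ring

lemma covariance_inner [IsProbabilityMeasure P] (hZ : IsPeriodicGaussian lam T Z P)
    {s t : ℝ} (hs : s ∈ Set.Icc 0 T) (ht : t ∈ Set.Icc 0 T) (x y : E d) :
    cov[fun ω => ⟪x, Z s ω⟫_ℝ, fun ω => ⟪y, Z t ω⟫_ℝ; P]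
      = periodicCov lam T |t - s| * ⟪x, y⟫_ℝ := by
  rw [covariance_eq_sub (hZ.memLp_inner hs x) (hZ.memLp_inner ht y), hZ.integral_inner hs,
    zero_mul, sub_zero, ← hZ.integral_inner_mul_inner hs ht]
  rfl

end IsPeriodicGaussian

/-- A random vector with the characteristic function of `gaussMeasure d v` has that law. -/
lemma map_eq_gaussMeasure [IsProbabilityMeasure P] {Y : Ω → E d} (hY : HasGaussianLaw Y P)
    {v : ℝ} (hv : 0 < v) (h0 : ∀ x, ∫ ω, ⟪x, Y ω⟫_ℝ ∂P = 0)
    (hvar : ∀ x, Var[fun ω => ⟪x, Y ω⟫_ℝ; P] = v * ‖x‖ ^ 2) : P.map Y = gaussMeasure d v := by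
  have := isProbabilityMeasure_gaussMeasure (d := d) hv
  have := Measure.isProbabilityMeasure_map (μ := P) hY.aemeasurable
  refine Measure.ext_of_charFun (funext fun x => ?_)
  rw [hY.charFun_map_eq, charFun_gaussMeasure hv, h0, hvar]
  congr 1
  push_cast
  ring

lemma periodicCov_zero {lam T : ℝ} (hlam : 0 < lam) (hT : 0 < T) :
    periodicCov lam T 0 = oscVariance lam T := by
  have hs : 0 < Real.sinh (lam * T / 2) := Real.sinh_pos_iff.mpr (by positivity)
  have h1 : Real.sinh (lam * T) = 2 * Real.sinh (lam * T / 2) * Real.cosh (lam * T / 2) := by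
    rw [← Real.sinh_two_mul]; congr 1; ring
  have h2 : Real.cosh (lam * T) - 1 = 2 * Real.sinh (lam * T / 2) ^ 2 := by
    have e := Real.cosh_two_mul (lam * T / 2)
    rw [show 2 * (lam * T / 2) = lam * T by ring] at e
    have := Real.cosh_sq (lam * T / 2)
    linarith
  rw [periodicCov, oscVariance, h1, h2, show lam * (0 - T / 2) = -(lam * T / 2) by ring,
    Real.cosh_neg]
  field_simp

lemma periodicCov_period (lam T : ℝ) : periodicCov lam T T = periodicCov lam T 0 := by
  rw [periodicCov, periodicCov, ← Real.cosh_neg]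
  congr 2
  ring

namespace IsPeriodicGaussian

variable {lam T : ℝ} {Z : ℝ → Ω → E d}

lemma map_eq [IsProbabilityMeasure P] (hZ : IsPeriodicGaussian lam T Z P) (hlam : 0 < lam)
    (hT : 0 < T) {t : ℝ} (ht : t ∈ Set.Icc 0 T) :
    P.map (Z t) = gaussMeasure d (oscVariance lam T) := by
  refine map_eq_gaussMeasure (hZ.hasGaussianLaw ht) (oscVariance_pos hlam hT)
    (hZ.integral_inner ht) fun x => ?_
  rw [← covariance_self (hZ.memLp_inner ht x).aemeasurable, hZ.covariance_inner ht ht, sub_self,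
    abs_zero, periodicCov_zero hlam hT, real_inner_self_eq_norm_sq]

/-- The process is a loop. -/
lemma ae_eq_endpoints [IsProbabilityMeasure P] (hZ : IsPeriodicGaussian lam T Z P)
    (hT : 0 < T) : Z T =ᵐ[P] Z 0 := by
  have h0 : (0 : ℝ) ∈ Set.Icc 0 T := ⟨le_rfl, hT.le⟩
  have h1 : T ∈ Set.Icc 0 T := ⟨hT.le, le_rfl⟩
  have key : ∀ i : Fin d, ∀ᵐ ω ∂P, Z T ω i - Z 0 ω i = 0 := by
    intro i
    set e : E d := EuclideanSpace.single i 1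
    have h := hZ.integral_inner_add_inner_sq h0 h1 (-e) e
    rw [sub_zero, abs_of_pos hT, periodicCov_period, inner_neg_neg, inner_neg_left] at h
    have h' : ∫ ω, (⟪-e, Z 0 ω⟫_ℝ + ⟪e, Z T ω⟫_ℝ) ^ 2 ∂P = 0 := by rw [h]; ring
    rw [integral_eq_zero_iff_of_nonneg (fun ω => sq_nonneg _)
      (hZ.integrable_inner_add_inner_sq h0 h1 (-e) e)] at h'
    filter_upwards [h'] with ω hω
    have := pow_eq_zero_iff (two_ne_zero) |>.mp hω
    rw [inner_neg_left] at this
    simp only [e, EuclideanSpace.inner_single_left, map_one, one_mul] at this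
    linarith
  filter_upwards [ae_all_iff.mpr key] with ω hω
  ext i
  linarith [hω i]

end IsPeriodicGaussian

end

/-! ### Gaussian subspaces of `L²` -/

section

variable {d : ℕ} {Ω : Type*} [MeasurableSpace Ω] {P : Measure Ω}

/-- The element `f` of `L²(P)` is a centered Gaussian variable (of variance `‖f‖²`). -/
def IsCenteredGaussian (f : Lp ℝ 2 P) : Prop :=
  ∀ r : ℝ, ∫ ω, Complex.exp ((r * f ω : ℝ) * Complex.I) ∂P = Complex.exp (-(r ^ 2 * ‖f‖ ^ 2 / 2 : ℝ))

lemma integrable_cexp_ofReal_mul_I [IsFiniteMeasure P] {X : Ω → ℝ} (hX : AEMeasurable X P) :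
    Integrable (fun ω => Complex.exp ((X ω : ℂ) * Complex.I)) P := by
  refine Integrable.of_bound (C := 1) ?_ (Eventually.of_forall fun ω => ?_)
  · exact (Complex.measurable_exp.comp_aemeasurable
      ((Complex.measurable_ofReal.comp_aemeasurable hX).mul_const _)).aestronglyMeasurable
  · rw [Complex.norm_exp_ofReal_mul_I]

lemma norm_integral_cexp_sub_le [IsProbabilityMeasure P] (r : ℝ) (f g : Lp ℝ 2 P) :
    ‖∫ ω, Complex.exp ((r * f ω : ℝ) * Complex.I) ∂P
      - ∫ ω, Complex.exp ((r * g ω : ℝ) * Complex.I) ∂P‖ ≤ |r| * ‖f - g‖ := by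
  have hf : AEMeasurable f P := (Lp.aestronglyMeasurable f).aemeasurable
  have hg : AEMeasurable g P := (Lp.aestronglyMeasurable g).aemeasurable
  have h2 : MemLp (fun ω => f ω - g ω) 2 P := (Lp.memLp f).sub (Lp.memLp g)
  rw [← integral_sub (integrable_cexp_ofReal_mul_I (hf.const_mul r))
    (integrable_cexp_ofReal_mul_I (hg.const_mul r))]
  have hb : ∀ ω, ‖Complex.exp ((r * f ω : ℝ) * Complex.I)
      - Complex.exp ((r * g ω : ℝ) * Complex.I)‖ ≤ |r| * ‖f ω - g ω‖ := by
    intro ω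
    have e : Complex.exp ((r * f ω : ℝ) * Complex.I) - Complex.exp ((r * g ω : ℝ) * Complex.I)
        = Complex.exp ((r * g ω : ℝ) * Complex.I) *
          (Complex.exp (Complex.I * ((r * (f ω - g ω) : ℝ) : ℂ)) - 1) := by
      rw [mul_sub, ← Complex.exp_add, mul_one]
      congr 2
      push_cast
      ring
    rw [e, norm_mul, Complex.norm_exp_ofReal_mul_I, one_mul]
    refine Real.norm_exp_I_mul_ofReal_sub_one_le.trans ?_
    rw [norm_mul, Real.norm_eq_abs]
  refine (norm_integral_le_of_norm_le ((h2.integrable (by norm_num)).norm.const_mul |r|)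
    (Eventually.of_forall hb)).trans ?_
  rw [integral_const_mul]
  gcongr
  rw [integral_norm_eq_lintegral_enorm h2.1, ← eLpNorm_one_eq_lintegral_enorm, Lp.norm_def]
  refine ENNReal.toReal_mono (Lp.eLpNorm_ne_top _) ?_
  refine (eLpNorm_le_eLpNorm_of_exponent_le (p := 1) (q := 2) (by norm_num) h2.1).trans
    (le_of_eq ?_)
  exact eLpNorm_congr_ae (Lp.coeFn_sub f g).symm

lemma isClosed_isCenteredGaussian [IsProbabilityMeasure P] :
    IsClosed {f : Lp ℝ 2 P | IsCenteredGaussian f} := by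
  have : {f : Lp ℝ 2 P | IsCenteredGaussian f} = ⋂ r : ℝ, {f | ∫ ω, Complex.exp ((r * f ω : ℝ) *
      Complex.I) ∂P = Complex.exp (-(r ^ 2 * ‖f‖ ^ 2 / 2 : ℝ))} := by
    ext f; simp [IsCenteredGaussian]
  rw [this]
  refine isClosed_iInter fun r => isClosed_eq ?_ (by fun_prop)
  refine (LipschitzWith.of_dist_le_mul (K := ⟨|r|, abs_nonneg r⟩) fun f g => ?_).continuous
  rw [dist_eq_norm, dist_eq_norm]
  exact norm_integral_cexp_sub_le r f g

lemma isCenteredGaussian_of_hasGaussianLaw [IsProbabilityMeasure P] {f : Lp ℝ 2 P}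
    (hf : HasGaussianLaw f P) (h0 : ∫ ω, f ω ∂P = 0) : IsCenteredGaussian f := by
  intro r
  have h := hf.charFun_map_eq r
  rw [charFun_apply_real, integral_map hf.aemeasurable (by fun_prop)] at h
  have h1 : ∫ ω, ⟪r, f ω⟫_ℝ ∂P = 0 := by
    simp only [RCLike.inner_apply, conj_trivial]
    rw [integral_mul_const, h0, zero_mul]
  have h2 : Var[fun ω => ⟪r, f ω⟫_ℝ; P] = r ^ 2 * ‖f‖ ^ 2 := by
    simp only [RCLike.inner_apply, conj_trivial]
    rw [variance_of_integral_eq_zero (hf.aemeasurable.mul_const r)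
      (by rw [integral_mul_const, h0, zero_mul]), ← real_inner_self_eq_norm_sq, L2.inner_def,
      ← integral_const_mul]
    refine integral_congr_ae (Eventually.of_forall fun ω => ?_)
    simp only [RCLike.inner_apply, conj_trivial]
    ring
  rw [h1, h2] at h
  have e : ∀ ω, Complex.exp ((r * f ω : ℝ) * Complex.I) = Complex.exp (r * f ω * Complex.I) :=
    fun ω => by push_cast; rfl
  simp_rw [e, h]
  congr 1
  push_cast
  ring

/-- The closed linear span of a family of variables whose linear combinations are Gaussian and
centered consists of centered Gaussian variables. -/
lemma isCenteredGaussian_of_mem_closure_span [IsProbabilityMeasure P] {A : Type*}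
    {X : A → Ω → ℝ} (hX2 : ∀ a, MemLp (X a) 2 P) (h0 : ∀ a, ∫ ω, X a ω ∂P = 0)
    (hG : ∀ c : A →₀ ℝ, HasGaussianLaw (fun ω => c.sum fun a r => r * X a ω) P) {f : Lp ℝ 2 P}
    (hf : f ∈ (Submodule.span ℝ (Set.range fun a => (hX2 a).toLp)).topologicalClosure) :
    IsCenteredGaussian f := by
  have hsub : ((Submodule.span ℝ (Set.range fun a => (hX2 a).toLp)) : Set (Lp ℝ 2 P)) ⊆
      {f | IsCenteredGaussian f} := by
    intro g hg
    obtain ⟨c, rfl⟩ := Finsupp.mem_span_range_iff_exists_finsupp.mp hg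
    have hae : ((c.sum fun a r => r • (hX2 a).toLp : Lp ℝ 2 P) : Ω → ℝ) =ᵐ[P]
        fun ω => c.sum fun a r => r * X a ω := by
      simp only [Finsupp.sum]
      have h1 := Lp.coeFn_finsetSum (p := 2) (μ := P) c.support (fun a => c a • (hX2 a).toLp)
      have h2 : ∀ᵐ ω ∂P, ∀ a ∈ c.support, (c a • (hX2 a).toLp : Lp ℝ 2 P) ω = c a * X a ω := by
        rw [Filter.eventually_all_finset]
        intro a _
        filter_upwards [Lp.coeFn_smul (c a) (hX2 a).toLp, (hX2 a).coeFn_toLp] with ω h3 h4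
        rw [h3, Pi.smul_apply, h4, smul_eq_mul]
      filter_upwards [h1, h2] with ω h3 h4
      rw [h3]
      rw [Finset.sum_apply]
      exact Finset.sum_congr rfl h4
    refine isCenteredGaussian_of_hasGaussianLaw ((hG c).congr hae.symm) ?_
    rw [integral_congr_ae hae]
    simp only [Finsupp.sum]
    rw [integral_finsetSum _ fun a _ => ((hX2 a).integrable (by norm_num)).const_mul _]
    refine Finset.sum_eq_zero fun a _ => ?_
    rw [integral_const_mul, h0, mul_zero]
  exact closure_minimal hsub isClosed_isCenteredGaussian hf

/-- A process whose components lie in a Gaussian subspace of `L²` and have the right inner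
products there. -/
lemma isPeriodicGaussian_of_mem [IsProbabilityMeasure P] {lam T : ℝ} {Z : ℝ → Ω → E d}
    {V : Submodule ℝ (Lp ℝ 2 P)} (hV : ∀ f ∈ V, IsCenteredGaussian f)
    (z : ℝ → Fin d → Lp ℝ 2 P) (hz : ∀ t ∈ Set.Icc 0 T, ∀ i, z t i ∈ V)
    (hzZ : ∀ t ∈ Set.Icc 0 T, ∀ i, z t i =ᵐ[P] fun ω => Z t ω i)
    (hin : ∀ s ∈ Set.Icc 0 T, ∀ t ∈ Set.Icc 0 T, ∀ i j,
      ⟪z s i, z t j⟫_ℝ = periodicCov lam T |s - t| * if i = j then 1 else 0) :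
    IsPeriodicGaussian lam T Z P where
  aemeasurable t ht := by
    have h1 : AEMeasurable (fun ω i => Z t ω i) P := aemeasurable_pi_lambda _ fun i =>
      (Lp.aestronglyMeasurable (z t i)).aemeasurable.congr (hzZ t ht i)
    exact (by fun_prop : Measurable (WithLp.toLp 2 : (Fin d → ℝ) → E d)).comp_aemeasurable h1
  charFun_fin n t ht c := by
    set f : Lp ℝ 2 P := ∑ k, ∑ i, (c k i) • z (t k) i with hf
    have hfV : f ∈ V := Submodule.sum_mem _ fun k _ => Submodule.sum_mem _ fun i _ =>
      Submodule.smul_mem _ _ (hz _ (ht k) i)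
    have hae : (f : Ω → ℝ) =ᵐ[P] fun ω => ∑ k, ⟪c k, Z (t k) ω⟫_ℝ := by
      have h1 := Lp.coeFn_finsetSum (p := 2) (μ := P) Finset.univ
        (fun k => ∑ i, (c k i) • z (t k) i)
      have h2 : ∀ᵐ ω ∂P, ∀ k, (∑ i, (c k i) • z (t k) i : Lp ℝ 2 P) ω
          = ∑ i, ((c k i) • z (t k) i : Lp ℝ 2 P) ω := by
        rw [ae_all_iff]
        intro k
        filter_upwards [Lp.coeFn_finsetSum (p := 2) (μ := P) Finset.univ
          (fun i => (c k i) • z (t k) i)] with ω h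
        rw [h, Finset.sum_apply]
      have h3 : ∀ᵐ ω ∂P, ∀ k i, ((c k i) • z (t k) i : Lp ℝ 2 P) ω = c k i * Z (t k) ω i := by
        rw [ae_all_iff]; intro k
        rw [ae_all_iff]; intro i
        filter_upwards [Lp.coeFn_smul (c k i) (z (t k) i), hzZ _ (ht k) i] with ω h4 h5
        rw [h4, Pi.smul_apply, h5, smul_eq_mul]
      filter_upwards [h1, h2, h3] with ω h4 h5 h6
      rw [hf, h4, Finset.sum_apply]
      refine Finset.sum_congr rfl fun k _ => ?_
      rw [h5, PiLp.inner_apply]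
      refine Finset.sum_congr rfl fun i _ => ?_
      rw [h6]
      simp [mul_comm]
    have hnorm : ‖f‖ ^ 2 = ∑ k, ∑ l, periodicCov lam T |t k - t l| * ⟪c k, c l⟫_ℝ := by
      rw [← real_inner_self_eq_norm_sq, hf, sum_inner]
      refine Finset.sum_congr rfl fun k _ => ?_
      rw [inner_sum]
      refine Finset.sum_congr rfl fun l _ => ?_
      rw [sum_inner, PiLp.inner_apply, Finset.mul_sum]
      refine Finset.sum_congr rfl fun i _ => ?_
      rw [inner_sum]
      simp only [inner_smul_left, inner_smul_right, conj_trivial, hin _ (ht k) _ (ht l)]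
      simp
      ring
    have h := hV f hfV 1
    rw [hnorm] at h
    rw [one_pow, one_mul] at h
    rw [← h]
    refine integral_congr_ae ?_
    filter_upwards [hae] with ω hω
    rw [hω, one_mul]

end

/-! ### The integrands of the Ornstein-Uhlenbeck process in `L²(ℝ)` -/

/-- The integrand `τ ↦ exp (-λ (t - τ))` on `(0, t]`. -/
def ouKernel (lam t τ : ℝ) : ℝ :=
  (Set.Ioc 0 t).indicator (fun τ => Real.exp (-(lam * (t - τ)))) τ

lemma memLp_ouKernel (lam t : ℝ) : MemLp (ouKernel lam t) 2 volume := by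
  have hc : Continuous fun τ : ℝ => Real.exp (-(lam * (t - τ))) := by fun_prop
  obtain ⟨C, hC⟩ := isCompact_Icc.exists_bound_of_continuousOn (s := Set.Icc (0 : ℝ) t)
    hc.continuousOn
  have h1 : MemLp (fun τ : ℝ => Real.exp (-(lam * (t - τ)))) 2 (volume.restrict (Set.Ioc 0 t)) := by
    refine MemLp.of_bound hc.aestronglyMeasurable C ?_
    filter_upwards [ae_restrict_mem measurableSet_Ioc] with τ hτ
    exact hC τ ⟨hτ.1.le, hτ.2⟩
  exact (memLp_indicator_iff_restrict measurableSet_Ioc).mpr h1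

/-- The element of `L²(ℝ)` given by `ouKernel`. -/
def ouKernelLp (lam t : ℝ) : Lp ℝ 2 (volume : Measure ℝ) := (memLp_ouKernel lam t).toLp

lemma inner_ouKernelLp {lam s t : ℝ} (hlam : lam ≠ 0) (hs : 0 ≤ s) (hst : s ≤ t) :
    ⟪ouKernelLp lam s, ouKernelLp lam t⟫_ℝ
      = (Real.exp (-(lam * t)) / Real.exp (-(lam * s))
        - Real.exp (-(lam * s)) * Real.exp (-(lam * t))) / (2 * lam) := by
  rw [L2.inner_def]
  have h1 : ∫ τ, ⟪(ouKernelLp lam s) τ, (ouKernelLp lam t) τ⟫_ℝ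
      = ∫ τ in Set.Ioc 0 s, Real.exp (-(lam * (s - τ))) * Real.exp (-(lam * (t - τ))) := by
    rw [← integral_indicator measurableSet_Ioc]
    refine integral_congr_ae ?_
    filter_upwards [(memLp_ouKernel lam s).coeFn_toLp, (memLp_ouKernel lam t).coeFn_toLp]
      with τ h2 h3
    simp only [ouKernelLp, h2, h3, RCLike.inner_apply, conj_trivial, ouKernel, Set.indicator]
    by_cases h : τ ∈ Set.Ioc 0 s
    · have h' : τ ∈ Set.Ioc 0 t := ⟨h.1, h.2.trans hst⟩
      simp only [h, h', if_true]; ring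
    · simp [h]
  have hd : ∀ τ ∈ Set.uIcc 0 s, HasDerivAt (fun τ => Real.exp (-(lam * (s - τ))) *
      Real.exp (-(lam * (t - τ))) / (2 * lam))
      (Real.exp (-(lam * (s - τ))) * Real.exp (-(lam * (t - τ)))) τ := by
    intro τ _
    have e : ∀ u : ℝ, HasDerivAt (fun τ => Real.exp (-(lam * (u - τ))))
        (Real.exp (-(lam * (u - τ))) * lam) τ := by
      intro u
      have h := ((((hasDerivAt_id τ).const_sub u).const_mul lam).neg).exp
      convert! h using 1
      simp
    convert! ((e s).mul (e t)).div_const (2 * lam) using 1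
    field_simp
    ring
  rw [h1, ← intervalIntegral.integral_of_le hs,
    intervalIntegral.integral_eq_sub_of_hasDerivAt hd (Continuous.intervalIntegrable (by fun_prop) _ _),
    ← sub_div]
  congr 1
  rw [sub_self, mul_zero, neg_zero, Real.exp_zero, one_mul, sub_zero, sub_zero, ← Real.exp_sub]
  congr 2
  ring

/-- The integrand representing the periodic Ornstein-Uhlenbeck process at time `t`. -/
def periodicKernel (lam T t : ℝ) : Lp ℝ 2 (volume : Measure ℝ) :=
  (Real.exp (-(lam * t)) / (1 - Real.exp (-(lam * T)))) • ouKernelLp lam T + ouKernelLp lam t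

lemma inner_periodicKernel_of_le {lam T s t : ℝ} (hlam : 0 < lam) (hT : 0 < T)
    (hs : s ∈ Set.Icc 0 T) (ht : t ∈ Set.Icc 0 T) (hst : s ≤ t) :
    ⟪periodicKernel lam T s, periodicKernel lam T t⟫_ℝ = periodicCov lam T (t - s) := by
  have hl := hlam.ne'
  have hq : Real.exp (-(lam * T)) < 1 := Real.exp_lt_one_iff.mpr (by have := mul_pos hlam hT; linarith)
  simp only [periodicKernel, inner_add_left, inner_add_right, inner_smul_left, inner_smul_right,
    conj_trivial]
  rw [real_inner_comm (ouKernelLp lam t) (ouKernelLp lam T),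
    inner_ouKernelLp hl hs.1 hst, inner_ouKernelLp hl hs.1 hs.2, inner_ouKernelLp hl ht.1 ht.2,
    inner_ouKernelLp hl hT.le le_rfl, periodicCov, Real.cosh_eq, Real.sinh_eq]
  have hp : Real.exp (-(lam * T)) = Real.exp (-(lam * T / 2)) ^ 2 := by
    rw [← Real.exp_nat_mul]; congr 1; push_cast; ring
  have e1 : Real.exp (lam * (t - s - T / 2)) = Real.exp (-(lam * T / 2)) *
      (Real.exp (-(lam * s)) / Real.exp (-(lam * t))) := by
    rw [← Real.exp_sub, ← Real.exp_add]; congr 1; ring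
  have e2 : Real.exp (-(lam * (t - s - T / 2))) = (Real.exp (-(lam * T / 2)))⁻¹ *
      (Real.exp (-(lam * t)) / Real.exp (-(lam * s))) := by
    rw [← Real.exp_sub, ← Real.exp_neg, ← Real.exp_add]; congr 1; ring
  have e3 : Real.exp (lam * T / 2) = (Real.exp (-(lam * T / 2)))⁻¹ := by
    rw [← Real.exp_neg, neg_neg]
  rw [e1, e2, e3, hp]
  rw [hp] at hq
  have hp0 := Real.exp_pos (-(lam * T / 2))
  have hx0 := Real.exp_pos (-(lam * s))
  have hy0 := Real.exp_pos (-(lam * t))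
  generalize Real.exp (-(lam * T / 2)) = p at *
  generalize Real.exp (-(lam * s)) = x at *
  generalize Real.exp (-(lam * t)) = y at *
  have h1 : (1 - p ^ 2) ≠ 0 := by linarith
  have h2 : p⁻¹ - p ≠ 0 := by
    have : p⁻¹ - p = (1 - p ^ 2) / p := by field_simp
    rw [this]; positivity
  have h3 : p⁻¹ - p = (1 - p ^ 2) / p := by field_simp
  rw [h3]
  field_simp
  ring

/-- The Gram matrix of the integrands is the periodic covariance. -/
lemma inner_periodicKernel {lam T s t : ℝ} (hlam : 0 < lam) (hT : 0 < T)
    (hs : s ∈ Set.Icc 0 T) (ht : t ∈ Set.Icc 0 T) :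
    ⟪periodicKernel lam T s, periodicKernel lam T t⟫_ℝ = periodicCov lam T |s - t| := by
  rcases le_total s t with h | h
  · rw [inner_periodicKernel_of_le hlam hT hs ht h, abs_sub_comm, abs_of_nonneg (sub_nonneg.mpr h)]
  · rw [real_inner_comm, inner_periodicKernel_of_le hlam hT ht hs h,
      abs_of_nonneg (sub_nonneg.mpr h)]

/-! ### Existence of the Gaussian process -/

/-- The isonormal Gaussian process: every real Hilbert space embeds isometrically into `L²` of some
probability space as a space of centered Gaussian variables. -/
lemma exists_isonormal (H : Type) [NormedAddCommGroup H] [InnerProductSpace ℝ H]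
    [CompleteSpace H] : ∃ (Ω : Type) (_ : MeasurableSpace Ω) (P : Measure Ω)
      (_ : IsProbabilityMeasure P) (J : H →ₗᵢ[ℝ] Lp ℝ 2 P), ∀ h, IsCenteredGaussian (J h) := by
  obtain ⟨ι, b, -⟩ := exists_hilbertBasis ℝ H
  let P : Measure (ι → ℝ) := Measure.infinitePi fun _ => gaussianReal 0 1
  let X : ι → (ι → ℝ) → ℝ := fun a ω => ω a
  have hlaw : ∀ a, P.map (X a) = gaussianReal 0 1 := fun a =>
    Measure.infinitePi_map_eval (fun _ : ι => gaussianReal 0 1) a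
  have hX : ∀ a, HasGaussianLaw (X a) P := fun a => ⟨by rw [hlaw a]; infer_instance⟩
  have hind : iIndepFun X P :=
    iIndepFun_infinitePi (P := fun _ : ι => gaussianReal 0 1) (X := fun _ x => x)
      fun _ => measurable_id
  have hX2 : ∀ a, MemLp (X a) 2 P := fun a => (hX a).memLp_two
  have h0 : ∀ a, ∫ ω, X a ω ∂P = 0 := fun a => by
    have h := integral_map (μ := P) (f := id) (hX a).aemeasurable (by fun_prop)
    rw [hlaw a] at h
    simpa using h.symm
  have hvar : ∀ a, ∫ ω, X a ω * X a ω ∂P = 1 := fun a => by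
    have h := integral_map (μ := P) (f := fun r => r ^ 2) (hX a).aemeasurable (by fun_prop)
    have h3 := variance_eq_integral (μ := gaussianReal 0 1) (X := id) (by fun_prop)
    rw [variance_id_gaussianReal] at h3
    rw [hlaw a] at h
    simp only [← pow_two]
    rw [← h]
    simpa using h3.symm
  let x : ι → Lp ℝ 2 P := fun a => (hX2 a).toLp
  have hon : Orthonormal ℝ x := by
    classical
    rw [orthonormal_iff_ite]
    intro a c
    have e : ⟪x a, x c⟫_ℝ = ∫ ω, X a ω * X c ω ∂P := by
      rw [L2.inner_def]
      refine integral_congr_ae ?_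
      filter_upwards [(hX2 a).coeFn_toLp, (hX2 c).coeFn_toLp] with ω h1 h2
      simp only [x, h1, h2, RCLike.inner_apply, conj_trivial, mul_comm]
    rw [e]
    split_ifs with h
    · rw [h, hvar]
    · rw [(hind.indepFun h).integral_fun_mul_eq_mul_integral (hX2 a).1 (hX2 c).1, h0, zero_mul]
  have hG : ∀ c : ι →₀ ℝ, HasGaussianLaw (fun ω => c.sum fun a r => r * X a ω) P := by
    intro c
    have h1 : iIndepFun (fun (a : c.support) ω => c a * X a ω) P :=
      (hind.precomp (g := fun a : c.support => (a : ι)) Subtype.val_injective).comp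
        (fun a r => c a * r) fun a => by fun_prop
    have h2 := iIndepFun.hasGaussianLaw_fun_sum (fun a : c.support => (hX a).fun_smul (c a)) h1
    convert! h2 using 1
    ext ω
    rw [Finsupp.sum, ← Finset.sum_coe_sort]
    rfl
  let V := hon.orthogonalFamily
  let J : H →ₗᵢ[ℝ] Lp ℝ 2 P := V.linearIsometry.comp b.repr.toLinearIsometry
  refine ⟨ι → ℝ, inferInstance, P, inferInstance, J, fun h => ?_⟩
  refine isCenteredGaussian_of_mem_closure_span hX2 h0 hG ?_
  refine mem_closure_of_tendsto (V.hasSum_linearIsometry (b.repr h)) (Eventually.of_forall fun s => ?_)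
  refine Submodule.sum_mem _ fun a _ => ?_
  rw [LinearIsometry.toSpanSingleton_apply]
  exact Submodule.smul_mem _ _ (Submodule.subset_span ⟨a, rfl⟩)

/-- The components of the process are the images, in an isonormal process over `d` copies of
`L²(ℝ)`, of the integrands `periodicKernel`. -/
lemma exists_isPeriodicGaussian (d : ℕ) {lam T : ℝ} (hlam : 0 < lam) (hT : 0 < T) :
    ∃ (Ω : Type) (_ : MeasurableSpace Ω) (P : Measure Ω) (Z : ℝ → Ω → E d),
      IsProbabilityMeasure P ∧ (∀ t, Measurable (Z t)) ∧ IsPeriodicGaussian lam T Z P := by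
  obtain ⟨Ω, _, P, _, J, hJ⟩ := exists_isonormal
    (PiLp 2 fun _ : Fin d => Lp ℝ 2 (volume : Measure ℝ))
  let z : ℝ → Fin d → Lp ℝ 2 P := fun t i =>
    J (WithLp.toLp 2 (Pi.single i (periodicKernel lam T t)))
  refine ⟨Ω, inferInstance, P, fun t ω => WithLp.toLp 2 fun i => z t i ω, inferInstance,
    fun t => ?_, ?_⟩
  · exact (by fun_prop : Measurable (WithLp.toLp 2 : (Fin d → ℝ) → E d)).comp
      (measurable_pi_lambda _ fun i => (Lp.stronglyMeasurable (z t i)).measurable)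
  · refine isPeriodicGaussian_of_mem (V := LinearMap.range J.toLinearMap) ?_ z
      (fun t _ i => ⟨_, rfl⟩) (fun t _ i => by rfl) fun s hs t ht i j => ?_
    · rintro _ ⟨h, rfl⟩
      exact hJ h
    · rw [LinearIsometry.inner_map_map, PiLp.inner_apply, ← inner_periodicKernel hlam hT hs ht]
      rw [Finset.sum_eq_single i (fun k _ hk => by simp [Pi.single_eq_of_ne hk]) (by simp)]
      by_cases h : i = j
      · subst h; simp
      · simp [h]

/-! ### Wiener integrals as isometric images -/

section Gram

variable {A H H' : Type*} [NormedAddCommGroup H] [InnerProductSpace ℝ H] [NormedAddCommGroup H']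
  [InnerProductSpace ℝ H'] {u : A → H} {u' : A → H'}

lemma inner_linearCombination_eq (h : ∀ a b, ⟪u a, u b⟫_ℝ = ⟪u' a, u' b⟫_ℝ) (p q : A →₀ ℝ) :
    ⟪Finsupp.linearCombination ℝ u p, Finsupp.linearCombination ℝ u q⟫_ℝ
      = ⟪Finsupp.linearCombination ℝ u' p, Finsupp.linearCombination ℝ u' q⟫_ℝ := by
  simp only [Finsupp.linearCombination_apply, Finsupp.sum, sum_inner, inner_sum, inner_smul_left,
    inner_smul_right, h]

lemma norm_linearCombination_eq (h : ∀ a b, ⟪u a, u b⟫_ℝ = ⟪u' a, u' b⟫_ℝ) (p : A →₀ ℝ) :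
    ‖Finsupp.linearCombination ℝ u p‖ = ‖Finsupp.linearCombination ℝ u' p‖ := by
  rw [norm_eq_sqrt_real_inner, norm_eq_sqrt_real_inner, inner_linearCombination_eq h]

/-- Convergence of linear combinations is transferred between families with the same Gram
matrix. -/
lemma exists_tendsto_linearCombination [CompleteSpace H']
    (h : ∀ a b, ⟪u a, u b⟫_ℝ = ⟪u' a, u' b⟫_ℝ) {ρ : ℕ → A →₀ ℝ} {x : H}
    (hx : Tendsto (fun N => Finsupp.linearCombination ℝ u (ρ N)) atTop (𝓝 x)) :
    ∃ y, Tendsto (fun N => Finsupp.linearCombination ℝ u' (ρ N)) atTop (𝓝 y) := by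
  have hc := hx.cauchySeq
  rw [Metric.cauchySeq_iff] at hc
  refine cauchySeq_tendsto_of_complete (Metric.cauchySeq_iff.mpr ?_)
  intro ε hε
  obtain ⟨n, hn⟩ := hc ε hε
  refine ⟨n, fun k hk l hl => ?_⟩
  have := hn k hk l hl
  rw [dist_eq_norm, ← map_sub] at this ⊢
  rwa [← norm_linearCombination_eq h]

lemma inner_eq_of_tendsto_linearCombination (h : ∀ a b, ⟪u a, u b⟫_ℝ = ⟪u' a, u' b⟫_ℝ)
    {ρ σ : ℕ → A →₀ ℝ} {x y : H} {x' y' : H'}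
    (hx : Tendsto (fun N => Finsupp.linearCombination ℝ u (ρ N)) atTop (𝓝 x))
    (hy : Tendsto (fun N => Finsupp.linearCombination ℝ u (σ N)) atTop (𝓝 y))
    (hx' : Tendsto (fun N => Finsupp.linearCombination ℝ u' (ρ N)) atTop (𝓝 x'))
    (hy' : Tendsto (fun N => Finsupp.linearCombination ℝ u' (σ N)) atTop (𝓝 y')) :
    ⟪x, y⟫_ℝ = ⟪x', y'⟫_ℝ := by
  refine tendsto_nhds_unique (hx.inner hy) ?_
  simp_rw [inner_linearCombination_eq h]
  exact hx'.inner hy'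

end Gram

/-- The coefficients of the left-endpoint sum for the integrand `τ ↦ exp (-λ (t - τ))` on
`[0, t]`. -/
def itoCoeff (lam t : ℝ) (N : ℕ) : ℝ≥0 →₀ ℝ :=
  ∑ k ∈ Finset.range N, Real.exp (-(lam * (t - t * k / N))) •
    (Finsupp.single (t * (k + 1) / N).toNNReal 1 - Finsupp.single (t * k / N).toNNReal 1)

lemma linearCombination_itoCoeff {H : Type*} [AddCommGroup H] [Module ℝ H] (u : ℝ≥0 → H)
    (lam t : ℝ) (N : ℕ) : Finsupp.linearCombination ℝ u (itoCoeff lam t N) =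
      ∑ k ∈ Finset.range N, Real.exp (-(lam * (t - t * k / N))) •
        (u (t * (k + 1) / N).toNNReal - u (t * k / N).toNNReal) := by
  simp [itoCoeff, map_sum]

/-- The indicator of `(0, t]` as an element of `L²(ℝ)`. -/
def indLp (t : ℝ≥0) : Lp ℝ 2 (volume : Measure ℝ) :=
  indicatorConstLp 2 (measurableSet_Ioc (a := (0 : ℝ)) (b := t)) (by simp) 1

lemma coeFn_indLp (t : ℝ≥0) : indLp t =ᵐ[volume] (Set.Ioc (0 : ℝ) t).indicator fun _ => 1 :=
  indicatorConstLp_coeFn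

lemma inner_indLp (s t : ℝ≥0) : ⟪indLp s, indLp t⟫_ℝ = min (s : ℝ) t := by
  rw [indLp, indLp, L2.real_inner_indicatorConstLp_one_indicatorConstLp_one (hμs := by simp)
    (hμt := by simp), Set.Ioc_inter_Ioc, sup_idem, Real.volume_real_Ioc_of_le (by positivity),
    sub_zero]

lemma abs_exp_sub_exp_le {a b : ℝ} (ha : a ≤ 0) (hb : b ≤ 0) :
    |Real.exp a - Real.exp b| ≤ |a - b| := by
  wlog h : b ≤ a generalizing a b
  · rw [abs_sub_comm, abs_sub_comm a]
    exact this hb ha (le_of_not_ge h)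
  rw [abs_of_nonneg (sub_nonneg.mpr (Real.exp_le_exp.mpr h)), abs_of_nonneg (sub_nonneg.mpr h)]
  have h1 := Real.add_one_le_exp (b - a)
  have h2 : Real.exp b = Real.exp a * Real.exp (b - a) := by rw [← Real.exp_add]; congr 1; ring
  have h3 := Real.exp_le_one_iff.mpr ha
  have h4 := Real.exp_pos a
  nlinarith

/-- Pointwise error of the step function approximation of `ouKernel`. -/
lemma abs_ouKernel_sub_step_le {lam t : ℝ} (hlam : 0 < lam) (ht : 0 ≤ t) {N : ℕ} (hN : 0 < N)
    (τ : ℝ) :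
    |(∑ k ∈ Finset.range N, Real.exp (-(lam * (t - t * k / N))) *
      ((Set.Ioc (0 : ℝ) (t * (k + 1) / N)).indicator (fun _ => (1 : ℝ)) τ
        - (Set.Ioc (0 : ℝ) (t * k / N)).indicator (fun _ => (1 : ℝ)) τ)) - ouKernel lam t τ|
      ≤ lam * t / N * (Set.Ioc (0 : ℝ) t).indicator (fun _ => (1 : ℝ)) τ := by
  have hN' : (0 : ℝ) < N := by exact_mod_cast hN
  set a : ℕ → ℝ := fun k => (Set.Ioc (0 : ℝ) (t * k / N)).indicator (fun _ => (1 : ℝ)) τ with ha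
  have ha1 : ∀ k : ℕ, (Set.Ioc (0 : ℝ) (t * (k + 1) / N)).indicator (fun _ => (1 : ℝ)) τ
      = a (k + 1) := fun k => by simp only [ha]; push_cast; rfl
  -- On the `k`-th interval the exponents differ by at most `λ t / N`.
  have htel : ∑ k ∈ Finset.range N, (a (k + 1) - a k)
      = (Set.Ioc (0 : ℝ) t).indicator (fun _ => (1 : ℝ)) τ := by
    rw [Finset.sum_range_sub]
    simp [ha, hN'.ne']
  have hker : ouKernel lam t τ = ∑ k ∈ Finset.range N, Real.exp (-(lam * (t - τ))) *
      (a (k + 1) - a k) := by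
    rw [← Finset.mul_sum, htel, ouKernel]
    simp [Set.indicator]
  simp_rw [ha1]
  rw [hker, ← Finset.sum_sub_distrib, ← htel, Finset.mul_sum]
  refine (Finset.abs_sum_le_sum_abs _ _).trans (Finset.sum_le_sum fun k hk => ?_)
  have hk' : (k : ℝ) + 1 ≤ N := by exact_mod_cast Finset.mem_range.mp hk
  have hle : t * k / N ≤ t * (k + 1) / N := by gcongr; linarith
  have hle2 : t * (k + 1) / N ≤ t := by
    rw [div_le_iff₀ hN']; exact mul_le_mul_of_nonneg_left hk' ht
  change |Real.exp (-(lam * (t - t * k / N))) * (a (k + 1) - a k)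
    - Real.exp (-(lam * (t - τ))) * (a (k + 1) - a k)| ≤ _
  rw [← sub_mul, ← ha1]
  simp only [ha, Set.indicator]
  by_cases h1 : τ ∈ Set.Ioc (0 : ℝ) (t * k / N)
  · have h2 : τ ∈ Set.Ioc (0 : ℝ) (t * (k + 1) / N) := ⟨h1.1, h1.2.trans hle⟩
    simp [h1, h2]
  · by_cases h2 : τ ∈ Set.Ioc (0 : ℝ) (t * (k + 1) / N)
    · simp only [h1, h2, if_true, if_false, sub_zero, mul_one]
      have h3 : t * k / N < τ := by
        by_contra hcon
        exact h1 ⟨h2.1, not_lt.mp hcon⟩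
      have h4 : τ ≤ t := h2.2.trans hle2
      refine (abs_exp_sub_exp_le (by nlinarith) (by nlinarith)).trans ?_
      have e : -(lam * (t - t * k / N)) - -(lam * (t - τ)) = lam * (t * k / N - τ) := by ring
      rw [e, abs_mul, abs_of_pos hlam, abs_of_neg (by linarith), mul_div_assoc lam]
      refine mul_le_mul_of_nonneg_left ?_ hlam.le
      have e2 : t * (k + 1) / N = t * k / N + t / N := by ring
      have := h2.2
      linarith
    · simp [h1, h2]

/-- The step functions approximate the integrand in `L²(ℝ)`. -/
lemma tendsto_linearCombination_indLp {lam t : ℝ} (hlam : 0 < lam) (ht : 0 ≤ t) :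
    Tendsto (fun N => Finsupp.linearCombination ℝ indLp (itoCoeff lam t N)) atTop
      (𝓝 (ouKernelLp lam t)) := by
  rw [tendsto_iff_norm_sub_tendsto_zero]
  have hb : ∀ᶠ N : ℕ in atTop, ‖Finsupp.linearCombination ℝ indLp (itoCoeff lam t N)
      - ouKernelLp lam t‖ ≤ lam * t / N * ‖indLp t.toNNReal‖ := by
    filter_upwards [eventually_gt_atTop 0] with N hN
    refine Lp.norm_le_mul_norm_of_ae_le_mul ?_
    rw [linearCombination_itoCoeff]
    set g : ℕ → Lp ℝ 2 (volume : Measure ℝ) := fun k => Real.exp (-(lam * (t - t * k / N))) •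
        (indLp (t * (k + 1) / N).toNNReal - indLp (t * k / N).toNNReal) with hg
    have h1 := Lp.coeFn_finsetSum (p := 2) (μ := volume) (Finset.range N) g
    have h2 : ∀ᵐ τ ∂(volume : Measure ℝ), ∀ k ∈ Finset.range N, g k τ
        = Real.exp (-(lam * (t - t * k / N))) *
      ((Set.Ioc (0 : ℝ) (t * (k + 1) / N)).indicator (fun _ => (1 : ℝ)) τ
        - (Set.Ioc (0 : ℝ) (t * k / N)).indicator (fun _ => (1 : ℝ)) τ) := by
      rw [Filter.eventually_all_finset]
      intro k _
      filter_upwards [Lp.coeFn_smul (Real.exp (-(lam * (t - t * k / N))))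
        (indLp (t * (k + 1) / N).toNNReal - indLp (t * k / N).toNNReal),
        Lp.coeFn_sub (indLp (t * (k + 1) / N).toNNReal) (indLp (t * k / N).toNNReal),
        coeFn_indLp (t * (k + 1) / N).toNNReal, coeFn_indLp (t * k / N).toNNReal]
        with τ h3 h4 h5 h6
      rw [hg]
      simp only
      rw [h3, Pi.smul_apply, h4, Pi.sub_apply, h5, h6, Real.coe_toNNReal _ (by positivity),
        Real.coe_toNNReal _ (by positivity), smul_eq_mul]
    filter_upwards [Lp.coeFn_sub (∑ k ∈ Finset.range N, g k) (ouKernelLp lam t), h1, h2,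
      (memLp_ouKernel lam t).coeFn_toLp, coeFn_indLp t.toNNReal] with τ h3 h4 h5 h6 h7
    rw [h3, Pi.sub_apply, h4, Finset.sum_apply, Finset.sum_congr rfl h5, h7, ouKernelLp, h6,
      Real.coe_toNNReal _ ht]
    have h8 := abs_ouKernel_sub_step_le hlam ht hN τ
    rw [Real.norm_eq_abs, Real.norm_eq_abs]
    exact h8.trans (mul_le_mul_of_nonneg_left (le_abs_self _) (by positivity))
  have hlim : Tendsto (fun N : ℕ => lam * t / N * ‖indLp t.toNNReal‖) atTop (𝓝 0) := by
    have := (tendsto_const_div_atTop_nhds_zero_nat (lam * t)).mul_const ‖indLp t.toNNReal‖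
    rwa [zero_mul] at this
  exact squeeze_zero' (Eventually.of_forall fun N => norm_nonneg _) hb hlim

/-! ### The periodic Ornstein-Uhlenbeck process -/

section

variable {d : ℕ} {Ω : Type*} [MeasurableSpace Ω] {P : Measure Ω}

namespace IsWiener

variable {W : ℝ≥0 → Ω → E d}

lemma memLp (hW : IsWiener W P) (i : Fin d) (t : ℝ≥0) : MemLp (fun ω => W t ω i) 2 P :=
  ((IsPreBrownianReal.isGaussianProcess (hW.brownian i).toIsPreBrownianReal).hasGaussianLaw_eval
    t).memLp_two

/-- The components of the Wiener process as elements of `L²`. -/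
def toLp (hW : IsWiener W P) (i : Fin d) (t : ℝ≥0) : Lp ℝ 2 P := (hW.memLp i t).toLp

lemma integral_eq_zero (hW : IsWiener W P) (i : Fin d) (t : ℝ≥0) : ∫ ω, W t ω i ∂P = 0 :=
  (hW.brownian i).integral_eval t

lemma inner_toLp_eq_integral (hW : IsWiener W P) (i j : Fin d) (s t : ℝ≥0) :
    ⟪hW.toLp i s, hW.toLp j t⟫_ℝ = ∫ ω, W s ω i * W t ω j ∂P := by
  rw [L2.inner_def]
  refine integral_congr_ae ?_
  filter_upwards [(hW.memLp i s).coeFn_toLp, (hW.memLp j t).coeFn_toLp] with ω h1 h2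
  simp only [toLp, h1, h2, RCLike.inner_apply, conj_trivial, mul_comm]

lemma inner_toLp_self [IsProbabilityMeasure P] (hW : IsWiener W P) (i : Fin d) (s t : ℝ≥0) :
    ⟪hW.toLp i s, hW.toLp i t⟫_ℝ = min (s : ℝ) t := by
  rw [inner_toLp_eq_integral, ← NNReal.coe_min, ← (hW.brownian i).covariance_fun_eval s t,
    covariance_eq_sub (hW.memLp i s) (hW.memLp i t), hW.integral_eq_zero, zero_mul, sub_zero]
  rfl

lemma inner_toLp_of_ne (hW : IsWiener W P) {i j : Fin d} (hij : i ≠ j) (s t : ℝ≥0) :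
    ⟪hW.toLp i s, hW.toLp j t⟫_ℝ = 0 := by
  have h : IndepFun (fun ω => W s ω i) (fun ω => W t ω j) P :=
    (hW.indep.indepFun hij).comp (measurable_pi_apply s) (measurable_pi_apply t)
  rw [inner_toLp_eq_integral, h.integral_fun_mul_eq_mul_integral (hW.memLp i s).1 (hW.memLp j t).1,
    hW.integral_eq_zero, zero_mul]

/-- The components at all times are jointly Gaussian. -/
lemma hasGaussianLaw_sum [IsProbabilityMeasure P] (hW : IsWiener W P)
    (c : Fin d × ℝ≥0 →₀ ℝ) :
    HasGaussianLaw (fun ω => c.sum fun a r => r * W a.2 ω a.1) P := by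
  classical
  set B := c.support.image Prod.snd
  have e : ∀ ω, (c.sum fun a r => r * W a.2 ω a.1)
      = ∑ i, ∑ t ∈ B, c (i, t) • W t ω i := by
    intro ω
    rw [Finsupp.sum_of_support_subset c (s := Finset.univ ×ˢ B) (fun a ha => Finset.mem_product.mpr
      ⟨Finset.mem_univ _, Finset.mem_image_of_mem _ ha⟩) _ (fun a _ => by simp),
      Finset.sum_product]
    rfl
  simp_rw [e]
  refine iIndepFun.hasGaussianLaw_fun_sum (X := fun i ω => ∑ t ∈ B, c (i, t) • W t ω i)
    (fun i => ?_) ?_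
  · exact ((IsPreBrownianReal.isGaussianProcess (hW.brownian i).toIsPreBrownianReal).smul
      fun t => c (i, t)).hasGaussianLaw_fun_sum
  · exact hW.indep.comp (fun i path => ∑ t ∈ B, c (i, t) • path t) fun i => by fun_prop

/-- The Gaussian space of a Wiener process. -/
def gaussianSpace (hW : IsWiener W P) : Submodule ℝ (Lp ℝ 2 P) :=
  (Submodule.span ℝ (Set.range fun a : Fin d × ℝ≥0 => hW.toLp a.1 a.2)).topologicalClosure

lemma isCenteredGaussian [IsProbabilityMeasure P] (hW : IsWiener W P) {f : Lp ℝ 2 P}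
    (hf : f ∈ hW.gaussianSpace) : IsCenteredGaussian f :=
  isCenteredGaussian_of_mem_closure_span (X := fun (a : Fin d × ℝ≥0) ω => W a.2 ω a.1)
    (fun a => hW.memLp a.1 a.2) (fun a => hW.integral_eq_zero a.1 a.2) hW.hasGaussianLaw_sum hf

lemma linearCombination_mem (hW : IsWiener W P) (i : Fin d) (ρ : ℝ≥0 →₀ ℝ) :
    Finsupp.linearCombination ℝ (hW.toLp i) ρ ∈
      Submodule.span ℝ (Set.range fun a : Fin d × ℝ≥0 => hW.toLp a.1 a.2) := by
  rw [Finsupp.linearCombination_apply]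
  exact Submodule.sum_mem _ fun t _ => Submodule.smul_mem _ _
    (Submodule.subset_span ⟨(i, t), rfl⟩)

lemma coeFn_linearCombination (hW : IsWiener W P) (i : Fin d) (lam t : ℝ) (N : ℕ) :
    (Finsupp.linearCombination ℝ (hW.toLp i) (itoCoeff lam t N) : Ω → ℝ) =ᵐ[P]
      fun ω => (∑ k ∈ Finset.range N, Real.exp (-(lam * (t - t * k / N))) •
        (W (t * (k + 1) / N).toNNReal ω - W (t * k / N).toNNReal ω)) i := by
  rw [linearCombination_itoCoeff]
  set g : ℕ → Lp ℝ 2 P := fun k => Real.exp (-(lam * (t - t * k / N))) •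
    (hW.toLp i (t * (k + 1) / N).toNNReal - hW.toLp i (t * k / N).toNNReal) with hg
  have h2 : ∀ᵐ ω ∂P, ∀ k ∈ Finset.range N, g k ω = Real.exp (-(lam * (t - t * k / N))) *
      (W (t * (k + 1) / N).toNNReal ω i - W (t * k / N).toNNReal ω i) := by
    rw [Filter.eventually_all_finset]
    intro k _
    filter_upwards [Lp.coeFn_smul (Real.exp (-(lam * (t - t * k / N))))
      (hW.toLp i (t * (k + 1) / N).toNNReal - hW.toLp i (t * k / N).toNNReal),
      Lp.coeFn_sub (hW.toLp i (t * (k + 1) / N).toNNReal) (hW.toLp i (t * k / N).toNNReal),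
      (hW.memLp i (t * (k + 1) / N).toNNReal).coeFn_toLp,
      (hW.memLp i (t * k / N).toNNReal).coeFn_toLp] with ω h3 h4 h5 h6
    rw [hg]
    simp only
    rw [h3, Pi.smul_apply, h4, Pi.sub_apply, toLp, toLp, h5, h6, smul_eq_mul]
  filter_upwards [Lp.coeFn_finsetSum (p := 2) (μ := P) (Finset.range N) g, h2] with ω h3 h4
  rw [h3, Finset.sum_apply, Finset.sum_congr rfl h4]
  simp [WithLp.ofLp_sum]

end IsWiener

lemma norm_le_sum_abs (x : E d) : ‖x‖ ≤ ∑ i, |x i| := by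
  rw [EuclideanSpace.norm_eq]
  refine Real.sqrt_le_iff.mpr ⟨Finset.sum_nonneg fun i _ => abs_nonneg _, ?_⟩
  simp only [Real.norm_eq_abs]
  exact Finset.sum_sq_le_sq_sum_of_nonneg fun i _ => abs_nonneg _

lemma memLp_of_components {X : Ω → E d} {p : ℝ≥0∞} (h : ∀ i, MemLp (fun ω => X ω i) p P) :
    MemLp X p P := by
  have hm : AEStronglyMeasurable X P := by
    have h1 : AEMeasurable (fun ω i => X ω i) P := aemeasurable_pi_lambda _ fun i =>
      (h i).1.aemeasurable
    exact ((by fun_prop : Measurable (WithLp.toLp 2 : (Fin d → ℝ) → E d)).comp_aemeasurable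
      h1).aestronglyMeasurable
  refine (memLp_finsetSum Finset.univ fun i _ => (h i).norm).mono hm
    (Eventually.of_forall fun ω => ?_)
  simp only [Real.norm_eq_abs]
  exact (norm_le_sum_abs (X ω)).trans (le_abs_self _)

lemma eLpNorm_le_sum_components {X : Ω → E d} (h : ∀ i, AEStronglyMeasurable (fun ω => X ω i) P) :
    eLpNorm X 2 P ≤ ∑ i, eLpNorm (fun ω => X ω i) 2 P := by
  have h1 : eLpNorm X 2 P ≤ eLpNorm (∑ i, fun ω => ‖X ω i‖) 2 P := by
    refine eLpNorm_mono_real fun ω => ?_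
    rw [Finset.sum_apply]
    exact norm_le_sum_abs (X ω)
  refine h1.trans ((eLpNorm_sum_le (fun i _ => (h i).norm) (by norm_num)).trans (le_of_eq ?_))
  exact Finset.sum_congr rfl fun i _ => eLpNorm_norm _

lemma eLpNorm_component_le (X : Ω → E d) (i : Fin d) :
    eLpNorm (fun ω => X ω i) 2 P ≤ eLpNorm X 2 P :=
  eLpNorm_mono fun ω => PiLp.norm_apply_le (X ω) i

/-- A vector-valued Itô integral is described by the `L²` limits of its components. -/
lemma isItoIntegral_iff {W : ℝ≥0 → Ω → E d} (hW : IsWiener W P) (lam t : ℝ) (I : Ω → E d) :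
    IsItoIntegral W P (fun τ => Real.exp (-(lam * (t - τ)))) t I ↔
      ∃ y : Fin d → Lp ℝ 2 P, (∀ i, y i =ᵐ[P] fun ω => I ω i) ∧
        ∀ i, Tendsto (fun N => Finsupp.linearCombination ℝ (hW.toLp i) (itoCoeff lam t N)) atTop
          (𝓝 (y i)) := by
  have hcomp : ∀ (y : Lp ℝ 2 P) (i : Fin d), y =ᵐ[P] (fun ω => I ω i) → ∀ N : ℕ,
      eLpNorm (⇑(Finsupp.linearCombination ℝ (hW.toLp i) (itoCoeff lam t N)) - ⇑y) 2 P =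
      eLpNorm (fun ω => (I ω - ∑ k ∈ Finset.range N, Real.exp (-(lam * (t - t * k / N))) •
        (W (t * (k + 1) / N).toNNReal ω - W (t * k / N).toNNReal ω)) i) 2 P := by
    intro y i hy N
    rw [eLpNorm_sub_comm]
    refine eLpNorm_congr_ae ?_
    filter_upwards [hy, hW.coeFn_linearCombination i lam t N] with ω h1 h2
    rw [Pi.sub_apply, h1, h2]
    rfl
  constructor
  · rintro ⟨hI, hlim⟩
    have hIi : ∀ i, MemLp (fun ω => I ω i) 2 P := fun i =>
      hI.mono ((EuclideanSpace.proj (𝕜 := ℝ) i).continuous.comp_aestronglyMeasurable hI.1)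
        (Eventually.of_forall fun ω => PiLp.norm_apply_le (I ω) i)
    refine ⟨fun i => (hIi i).toLp, fun i => (hIi i).coeFn_toLp, fun i => ?_⟩
    rw [Lp.tendsto_Lp_iff_tendsto_eLpNorm']
    simp_rw [hcomp _ i (hIi i).coeFn_toLp]
    exact tendsto_of_tendsto_of_tendsto_of_le_of_le tendsto_const_nhds hlim (fun N => zero_le)
      fun N => eLpNorm_component_le _ i
  · rintro ⟨y, hy, hlim⟩
    have hIi : ∀ i, MemLp (fun ω => I ω i) 2 P := fun i => (memLp_congr_ae (hy i)).mp (Lp.memLp _)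
    refine ⟨memLp_of_components hIi, ?_⟩
    have h0 : Tendsto (fun N => ∑ i, eLpNorm (⇑(Finsupp.linearCombination ℝ (hW.toLp i)
        (itoCoeff lam t N)) - ⇑(y i)) 2 P) atTop (𝓝 0) := by
      have := tendsto_finsetSum Finset.univ fun i _ =>
        (Lp.tendsto_Lp_iff_tendsto_eLpNorm' _ _).mp (hlim i)
      simpa using this
    refine tendsto_of_tendsto_of_tendsto_of_le_of_le tendsto_const_nhds h0 (fun N => zero_le)
      fun N => ?_
    have hm : ∀ i, AEStronglyMeasurable (fun ω => (I ω - ∑ k ∈ Finset.range N,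
        Real.exp (-(lam * (t - t * k / N))) •
        (W (t * (k + 1) / N).toNNReal ω - W (t * k / N).toNNReal ω)) i) P := by
      intro i
      refine ((Lp.aestronglyMeasurable (y i)).sub (Lp.aestronglyMeasurable
        (Finsupp.linearCombination ℝ (hW.toLp i) (itoCoeff lam t N)))).congr ?_
      filter_upwards [hy i, hW.coeFn_linearCombination i lam t N] with ω h1 h2
      rw [Pi.sub_apply, h1, h2]
      rfl
    refine (eLpNorm_le_sum_components hm).trans (le_of_eq (Finset.sum_congr rfl fun i _ => ?_))
    exact (hcomp _ i (hy i) N).symm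

lemma inner_indLp_eq [IsProbabilityMeasure P] {W : ℝ≥0 → Ω → E d} (hW : IsWiener W P) (i : Fin d)
    (s t : ℝ≥0) : ⟪indLp s, indLp t⟫_ℝ = ⟪hW.toLp i s, hW.toLp i t⟫_ℝ := by
  rw [inner_indLp, hW.inner_toLp_self]

/-- The Itô integral exists: the sums are images of step functions that converge in `L²(ℝ)`. -/
lemma exists_isItoIntegral [IsProbabilityMeasure P] {W : ℝ≥0 → Ω → E d} (hW : IsWiener W P)
    {lam t : ℝ} (hlam : 0 < lam) (ht : 0 ≤ t) :
    ∃ I : Ω → E d, IsItoIntegral W P (fun τ => Real.exp (-(lam * (t - τ)))) t I := by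
  choose y hy using fun i => exists_tendsto_linearCombination (inner_indLp_eq hW i)
    (tendsto_linearCombination_indLp hlam ht)
  exact ⟨fun ω => WithLp.toLp 2 fun i => y i ω, (isItoIntegral_iff hW lam t _).mpr
    ⟨y, fun i => by rfl, hy⟩⟩

lemma exists_isPeriodicOU [IsProbabilityMeasure P] {W : ℝ≥0 → Ω → E d} (hW : IsWiener W P)
    {lam T : ℝ} (hlam : 0 < lam) (hT : 0 < T) : ∃ X : ℝ → Ω → E d, IsPeriodicOU lam T W P X := by
  obtain ⟨J, hJ⟩ := exists_isItoIntegral hW hlam hT.le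
  choose I hI using fun t : Set.Icc (0 : ℝ) T => exists_isItoIntegral hW hlam t.2.1
  classical
  refine ⟨fun t ω => if h : t ∈ Set.Icc 0 T then
    (Real.exp (-(lam * t)) / (1 - Real.exp (-(lam * T)))) • J ω + I ⟨t, h⟩ ω else 0,
    fun t ht => ⟨J, I ⟨t, ht⟩, hJ, hI ⟨t, ht⟩, ?_⟩⟩
  simp only [ht, dif_pos]
  rfl

/-- The components of the periodic Ornstein-Uhlenbeck process lie in the Gaussian space of the
Wiener process, and the inner products of the integrands give their covariances. -/
lemma isPeriodicGaussian_of_isPeriodicOU [IsProbabilityMeasure P] {W : ℝ≥0 → Ω → E d}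
    (hW : IsWiener W P) {lam T : ℝ} (hlam : 0 < lam) (hT : 0 < T) {X : ℝ → Ω → E d}
    (hX : IsPeriodicOU lam T W P X) : IsPeriodicGaussian lam T X P := by
  have hex : ∀ t : ℝ, ∃ z : Fin d → Lp ℝ 2 P, t ∈ Set.Icc 0 T →
      (∀ i, z i =ᵐ[P] fun ω => X t ω i) ∧
      ∀ i, Tendsto (fun N => Finsupp.linearCombination ℝ (hW.toLp i)
        ((Real.exp (-(lam * t)) / (1 - Real.exp (-(lam * T)))) • itoCoeff lam T N
          + itoCoeff lam t N)) atTop (𝓝 (z i)) := by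
    intro t
    by_cases ht : t ∈ Set.Icc 0 T
    · obtain ⟨J, I, hJ, hI, hXt⟩ := hX t ht
      obtain ⟨yJ, hyJ, hlJ⟩ := (isItoIntegral_iff hW lam T J).mp hJ
      obtain ⟨yI, hyI, hlI⟩ := (isItoIntegral_iff hW lam t I).mp hI
      refine ⟨fun i => (Real.exp (-(lam * t)) / (1 - Real.exp (-(lam * T)))) • yJ i + yI i,
        fun _ => ⟨fun i => ?_, fun i => ?_⟩⟩
      · filter_upwards [hXt, hyJ i, hyI i,
          Lp.coeFn_add ((Real.exp (-(lam * t)) / (1 - Real.exp (-(lam * T)))) • yJ i) (yI i),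
          Lp.coeFn_smul (Real.exp (-(lam * t)) / (1 - Real.exp (-(lam * T)))) (yJ i)]
          with ω h1 h2 h3 h4 h5
        rw [h4, Pi.add_apply, h5, Pi.smul_apply, h2, h3, h1]
        rfl
      · simp_rw [map_add, map_smul]
        exact ((hlJ i).const_smul _).add (hlI i)
    · exact ⟨0, fun h => absurd h ht⟩
  choose z hz using hex
  have hker : ∀ t ∈ Set.Icc 0 T, Tendsto (fun N => Finsupp.linearCombination ℝ indLp
        ((Real.exp (-(lam * t)) / (1 - Real.exp (-(lam * T)))) • itoCoeff lam T N
          + itoCoeff lam t N)) atTop (𝓝 (periodicKernel lam T t)) := by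
    intro t ht
    simp_rw [map_add, map_smul]
    exact ((tendsto_linearCombination_indLp hlam hT.le).const_smul _).add
      (tendsto_linearCombination_indLp hlam ht.1)
  refine isPeriodicGaussian_of_mem (V := hW.gaussianSpace) (fun f => hW.isCenteredGaussian) z
    (fun t ht i => ?_) (fun t ht => (hz t ht).1) fun s hs t ht i j => ?_
  · exact mem_closure_of_tendsto ((hz t ht).2 i)
      (Eventually.of_forall fun N => hW.linearCombination_mem i _)
  · by_cases hij : i = j
    · subst hij
      rw [if_pos rfl, mul_one, ← inner_periodicKernel hlam hT hs ht]
      exact (inner_eq_of_tendsto_linearCombination (inner_indLp_eq hW i) (hker s hs) (hker t ht)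
        ((hz s hs).2 i) ((hz t ht).2 i)).symm
    · rw [if_neg hij, mul_zero]
      refine tendsto_nhds_unique (((hz s hs).2 i).inner ((hz t ht).2 j)) ?_
      refine tendsto_const_nhds.congr fun N => ?_
      simp only [Finsupp.linearCombination_apply, Finsupp.sum, sum_inner, inner_sum,
        inner_smul_left, inner_smul_right, hW.inner_toLp_of_ne hij, mul_zero,
        Finset.sum_const_zero]

end

/-! ### Integration along chains of positions -/

section

lemma lintegral_pi_fin_succ {n : ℕ} {α : Type*} [MeasurableSpace α]
    (μ : Fin (n + 1) → Measure α) [∀ i, SigmaFinite (μ i)] {f : (Fin (n + 1) → α) → ℝ≥0∞}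
    (hf : Measurable f) :
    ∫⁻ x, f x ∂Measure.pi μ
      = ∫⁻ z, ∫⁻ x', f (Fin.cons z x') ∂Measure.pi (fun k => μ (Fin.succ k)) ∂(μ 0) := by
  have h := (measurePreserving_piFinSuccAbove μ 0).symm
  rw [← h.lintegral_comp hf, lintegral_prod]
  · simp only [MeasurableEquiv.piFinSuccAbove_symm_apply, Fin.insertNthEquiv,
      Fin.insertNth_zero, Equiv.coe_fn_mk]
    rfl
  · exact (hf.comp h.measurable).aemeasurable

lemma lintegral_pi_prod {n : ℕ} {α : Type*} [MeasurableSpace α] (μ : Fin n → Measure α)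
    [∀ i, SigmaFinite (μ i)] {f : Fin n → α → ℝ≥0∞} (hf : ∀ k, Measurable (f k)) :
    ∫⁻ x, ∏ k, f k (x k) ∂Measure.pi μ = ∏ k, ∫⁻ z, f k z ∂(μ k) := by
  induction n with
  | zero => simp
  | succ n ih =>
    have hm : Measurable fun x : Fin (n + 1) → α => ∏ k, f k (x k) :=
      Finset.measurable_fun_prod _ fun k _ => (hf k).comp (measurable_pi_apply k)
    rw [lintegral_pi_fin_succ μ hm, Fin.prod_univ_succ,
      ← lintegral_mul_const _ (hf 0)]
    refine lintegral_congr fun z => ?_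
    simp only [Fin.prod_univ_succ, Fin.cons_zero, Fin.cons_succ]
    rw [lintegral_const_mul, ih (fun k => μ k.succ) (fun k => hf k.succ)]
    exact Finset.measurable_fun_prod _ fun k _ => (hf k.succ).comp (measurable_pi_apply k)

lemma pi_withDensity {n : ℕ} {α : Type*} [MeasurableSpace α] (μ : Measure α) [SigmaFinite μ]
    {f : Fin n → α → ℝ≥0∞} (hf : ∀ k, Measurable (f k))
    [∀ k, SigmaFinite (μ.withDensity (f k))] :
    Measure.pi (fun k => μ.withDensity (f k))
      = (Measure.pi fun _ : Fin n => μ).withDensity fun x => ∏ k, f k (x k) := by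
  refine Measure.pi_eq fun s hs => ?_
  rw [withDensity_apply _ (MeasurableSet.univ_pi hs), Measure.restrict_pi_pi,
    lintegral_pi_prod _ hf]
  exact Finset.prod_congr rfl fun k _ => (withDensity_apply _ (hs k)).symm

variable {d : ℕ}

/-- The weight of the path which is at `x₀` at time `a`, at the points `x` at the times `t` and at
`y` at time `b`: the product of the values of Mehler's kernel over consecutive points. -/
def pathWeight (lam a b : ℝ) {n : ℕ} (t : Fin n → ℝ) (x₀ y : E d) (x : Fin n → E d) : ℝ :=
  (∏ k : Fin n, mehler lam (x k) (t k - (Fin.cons a t : Fin (n + 1) → ℝ) k.castSucc)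
      ((Fin.cons x₀ x : Fin (n + 1) → E d) k.castSucc)) *
    mehler lam y (b - (Fin.cons a t : Fin (n + 1) → ℝ) (Fin.last n))
      ((Fin.cons x₀ x : Fin (n + 1) → E d) (Fin.last n))

lemma pathWeight_eq_prod (lam a b : ℝ) {n : ℕ} (t : Fin n → ℝ) (x₀ y : E d) (x : Fin n → E d) :
    pathWeight lam a b t x₀ y x = ∏ k : Fin (n + 1), mehler lam
      ((Fin.snoc x y : Fin (n + 1) → E d) k)
      ((Fin.snoc t b : Fin (n + 1) → ℝ) k - (Fin.cons a t : Fin (n + 1) → ℝ) k)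
      ((Fin.cons x₀ x : Fin (n + 1) → E d) k) := by
  rw [Fin.prod_univ_castSucc, pathWeight]
  simp only [Fin.snoc_castSucc, Fin.snoc_last]

lemma pathWeight_succ (lam a b : ℝ) {n : ℕ} (t : Fin (n + 1) → ℝ) (x₀ y z : E d)
    (x : Fin n → E d) :
    pathWeight lam a b t x₀ y (Fin.cons z x)
      = mehler lam z (t 0 - a) x₀ * pathWeight lam (t 0) b (Fin.tail t) z y x := by
  have ht : t = Fin.cons (t 0) (Fin.tail t) := (Fin.cons_self_tail t).symm
  rw [pathWeight, pathWeight, Fin.prod_univ_succ, ← mul_assoc]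
  rw [← Fin.succ_last, Fin.cons_succ, Fin.cons_succ]
  have h1 : t (Fin.last n) = (Fin.cons (t 0) (Fin.tail t) : Fin (n + 1) → ℝ) (Fin.last n) :=
    congrFun ht _
  rw [← h1]
  congr 2
  refine Finset.prod_congr rfl fun k _ => ?_
  rw [← Fin.succ_castSucc, Fin.cons_succ, Fin.cons_succ, Fin.cons_succ]
  have h2 : t k.castSucc = (Fin.cons (t 0) (Fin.tail t) : Fin (n + 1) → ℝ) k.castSucc :=
    congrFun ht _
  rw [← h2]
  rfl

lemma continuous_pathWeight (lam a b : ℝ) {n : ℕ} (t : Fin n → ℝ) :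
    Continuous fun p : (E d × E d) × (Fin n → E d) => pathWeight lam a b t p.1.1 p.1.2 p.2 := by
  have hc : ∀ k : Fin (n + 1), Continuous fun p : (E d × E d) × (Fin n → E d) =>
      (Fin.cons p.1.1 p.2 : Fin (n + 1) → E d) k := by
    intro k
    refine Fin.cases ?_ (fun j => ?_) k
    · simp only [Fin.cons_zero]; fun_prop
    · simp only [Fin.cons_succ]; fun_prop
  unfold pathWeight
  refine (continuous_finsetProd _ fun k _ => ?_).mul ?_
  · exact Continuous.mehler (by fun_prop) (hc _) lam _
  · exact Continuous.mehler (by fun_prop) (hc _) lam _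

/-- The iterated Chapman-Kolmogorov equation. -/
lemma lintegral_pathWeight {lam : ℝ} (hlam : 0 < lam) {n : ℕ} {a b : ℝ} (hab : a < b)
    {t : Fin n → ℝ} (ht : StrictMono t) (hta : ∀ k, t k ∈ Set.Ioo a b) (x₀ y : E d) :
    ∫⁻ x : Fin n → E d, ENNReal.ofReal (pathWeight lam a b t x₀ y x)
      = ENNReal.ofReal (mehler lam y (b - a) x₀) := by
  induction n generalizing a x₀ with
  | zero =>
    rw [volume_pi, Measure.pi_of_empty _ (fun k => k.elim0), lintegral_dirac]
    simp [pathWeight]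
  | succ n ih =>
    have hm : Measurable fun x : Fin (n + 1) → E d =>
        ENNReal.ofReal (pathWeight lam a b t x₀ y x) :=
      ((continuous_pathWeight lam a b t).comp (by fun_prop :
        Continuous fun x : Fin (n + 1) → E d => ((x₀, y), x))).measurable.ennreal_ofReal
    rw [volume_pi, lintegral_pi_fin_succ _ hm]
    have h0 : a < t 0 := (hta 0).1
    have h1 : t 0 < b := (hta 0).2
    have e : ∀ z : E d, ∫⁻ x' : Fin n → E d, ENNReal.ofReal
        (pathWeight lam a b t x₀ y (Fin.cons z x')) ∂Measure.pi (fun _ => volume)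
        = ENNReal.ofReal (mehler lam y (b - t 0) z * mehler lam z (t 0 - a) x₀) := by
      intro z
      have hz := (mehler_pos hlam (sub_pos.mpr h0) z x₀).le
      simp_rw [pathWeight_succ, ENNReal.ofReal_mul hz]
      rw [lintegral_const_mul' _ _ ENNReal.ofReal_ne_top, ← volume_pi,
        ih h1 (t := Fin.tail t) (fun i j hij => ht (Fin.succ_lt_succ_iff.mpr hij))
          (fun k => ⟨ht (Fin.succ_pos k), (hta k.succ).2⟩) z,
        ← ENNReal.ofReal_mul hz, mul_comm]
    simp_rw [e]
    rw [lintegral_mehler_mul_mehler hlam (sub_pos.mpr h1) (sub_pos.mpr h0)]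
    congr 2
    ring

/-! ### The cyclic change of variables -/

/-- `x ↦ (x_{k+1} - a_k x_k)_k` with cyclic indices, the last factor being followed by the first. -/
def cyclicMap {n : ℕ} (a : Fin (n + 1) → ℝ) : (Fin (n + 1) → E d) →ₗ[ℝ] (Fin (n + 1) → E d) where
  toFun x k := (Fin.snoc (Fin.tail x) (x 0) : Fin (n + 1) → E d) k - a k • x k
  map_add' x y := by
    ext1 k
    refine Fin.lastCases ?_ (fun j => ?_) k
    · simp only [Fin.snoc_last, Pi.add_apply]; module
    · simp only [Fin.snoc_castSucc, Fin.tail, Pi.add_apply]; module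
  map_smul' c x := by
    ext1 k
    refine Fin.lastCases ?_ (fun j => ?_) k
    · simp only [Fin.snoc_last, Pi.smul_apply, RingHom.id_apply]; module
    · simp only [Fin.snoc_castSucc, Fin.tail, Pi.smul_apply, RingHom.id_apply]; module

lemma sum_snoc_tail {n : ℕ} {α M : Type*} [AddCommMonoid M] (x : Fin (n + 1) → α) (f : α → M) :
    ∑ k, f ((Fin.snoc (Fin.tail x) (x 0) : Fin (n + 1) → α) k) = ∑ k, f (x k) := by
  rw [Fin.sum_univ_castSucc, Fin.sum_univ_succ, add_comm]
  simp only [Fin.snoc_castSucc, Fin.snoc_last]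
  rfl

lemma cyclicMap_injective {n : ℕ} {a : Fin (n + 1) → ℝ} (ha0 : ∀ k, 0 ≤ a k)
    (ha : ∀ k, a k < 1) : Function.Injective (cyclicMap (d := d) a) := by
  rw [← LinearMap.ker_eq_bot, LinearMap.ker_eq_bot']
  intro x hx
  have h1 : ∀ k, (Fin.snoc (Fin.tail x) (x 0) : Fin (n + 1) → E d) k = a k • x k := fun k =>
    sub_eq_zero.mp (congrFun hx k)
  have h2 : ∑ k, (1 - a k) * ‖x k‖ = 0 := by
    have h3 := sum_snoc_tail x (fun z => ‖z‖)
    simp_rw [h1, norm_smul, Real.norm_of_nonneg (ha0 _)] at h3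
    simp_rw [sub_mul, one_mul]
    rw [Finset.sum_sub_distrib, h3, sub_self]
  ext1 k
  have h3 := (Finset.sum_eq_zero_iff_of_nonneg fun k _ =>
    mul_nonneg (sub_nonneg.mpr (ha k).le) (norm_nonneg (x k))).mp h2 k (Finset.mem_univ k)
  exact norm_eq_zero.mp ((mul_eq_zero.mp h3).resolve_left (sub_pos.mpr (ha k)).ne')

/-- If an injective linear image of a random vector has a density, then so has the vector, up to a
normalizing constant. -/
lemma exists_map_eq_smul_withDensity {V Ω : Type*} [NormedAddCommGroup V] [NormedSpace ℝ V]
    [FiniteDimensional ℝ V] [MeasurableSpace V] [BorelSpace V] (μ : Measure V)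
    [μ.IsAddHaarMeasure] [MeasurableSpace Ω] {P : Measure Ω} {X : Ω → V} (hX : Measurable X)
    {M : V →ₗ[ℝ] V} (hM : Function.Injective M) {D : V → ℝ≥0∞} (hD : Measurable D)
    (h : P.map (fun ω => M (X ω)) = μ.withDensity D) :
    ∃ c : ℝ≥0∞, P.map X = c • μ.withDensity fun x => D (M x) := by
  let e : V ≃L[ℝ] V := (LinearEquiv.ofInjectiveEndo M hM).toContinuousLinearEquiv
  have he : ∀ x, e x = M x := fun x => rfl
  have hem : Measurable e := e.continuous.measurable
  have hes : Measurable e.symm := e.symm.continuous.measurable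
  have hμ := Measure.isAddLeftInvariant_eq_smul (μ.map e.symm) μ
  refine ⟨(Measure.addHaarScalarFactor (μ.map e.symm) μ : ℝ≥0∞), ?_⟩
  have hX' : P.map X = (P.map fun ω => M (X ω)).map e.symm := by
    have h1 : (fun ω => M (X ω)) = e ∘ X := rfl
    rw [h1, Measure.map_map hes (hem.comp hX)]
    congr 1
    ext1 ω
    exact (e.symm_apply_apply (X ω)).symm
  rw [hX', h]
  ext B hB
  rw [Measure.map_apply hes hB, withDensity_apply _ (hes hB), Measure.smul_apply,
    withDensity_apply _ hB, ← lintegral_smul_measure, ← Measure.restrict_smul]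
  have hμ' : (Measure.addHaarScalarFactor (μ.map e.symm) μ : ℝ≥0∞) • μ = μ.map e.symm := by
    conv_rhs => rw [hμ]
    rfl
  rw [hμ', setLIntegral_map hB (by exact hD.comp hem) hes]
  refine lintegral_congr fun x => ?_
  rw [← he, e.apply_symm_apply]

end

/-! ### Increments around the loop and the joint density -/

section

variable {d : ℕ} {Ω : Type*} [MeasurableSpace Ω] {P : Measure Ω}

/-- The failure of `K` to be an exponential function: the deviation of `K(p - r)` from
`e^{-λ(p - q)} K(q - r)` depends on `r` through the factor `e^{-λ r}` only, which is why consecutive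
increments are uncorrelated. -/
lemma periodicCov_sub (lam T r q p : ℝ) :
    periodicCov lam T (p - r) - Real.exp (-(lam * (p - q))) * periodicCov lam T (q - r)
      = Real.exp (lam * (q - r - T / 2)) * Real.sinh (lam * (p - q)) /
        (2 * lam * Real.sinh (lam * T / 2)) := by
  rw [periodicCov, periodicCov, ← mul_div_assoc, ← sub_div,
    show lam * (p - r - T / 2) = lam * (q - r - T / 2) + lam * (p - q) by ring, Real.cosh_add,
    ← Real.cosh_sub_sinh (lam * (p - q)), ← Real.cosh_add_sinh (lam * (q - r - T / 2))]
  congr 1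
  ring

namespace IsPeriodicGaussian

variable {lam T : ℝ} {Z : ℝ → Ω → E d}

lemma covariance_inner_sub_smul [IsProbabilityMeasure P] (hZ : IsPeriodicGaussian lam T Z P)
    {p q p' q' : ℝ} (hp : p ∈ Set.Icc 0 T) (hq : q ∈ Set.Icc 0 T) (hp' : p' ∈ Set.Icc 0 T)
    (hq' : q' ∈ Set.Icc 0 T) (a b : ℝ) (x y : E d) :
    cov[fun ω => ⟪x, Z p ω - a • Z q ω⟫_ℝ, fun ω => ⟪y, Z p' ω - b • Z q' ω⟫_ℝ; P]
      = (periodicCov lam T |p' - p| - b * periodicCov lam T |q' - p|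
        - a * periodicCov lam T |p' - q| + a * b * periodicCov lam T |q' - q|) * ⟪x, y⟫_ℝ := by
  simp only [inner_sub_right, inner_smul_right]
  rw [covariance_fun_sub_fun_sub (hZ.memLp_inner hp x) ((hZ.memLp_inner hq x).const_mul a)
    (hZ.memLp_inner hp' y) ((hZ.memLp_inner hq' y).const_mul b)]
  simp only [covariance_const_mul_left, covariance_const_mul_right]
  rw [hZ.covariance_inner hp hp', hZ.covariance_inner hp hq', hZ.covariance_inner hq hp',
    hZ.covariance_inner hq hq']
  ring

/-- The Ornstein-Uhlenbeck increments over disjoint intervals are uncorrelated. -/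
lemma covariance_increments_eq_zero [IsProbabilityMeasure P] (hZ : IsPeriodicGaussian lam T Z P)
    {p q p' q' : ℝ} (hp : p ∈ Set.Icc 0 T) (hq : q ∈ Set.Icc 0 T) (hp' : p' ∈ Set.Icc 0 T)
    (hq' : q' ∈ Set.Icc 0 T) (h1 : q ≤ p) (h2 : p ≤ q') (h3 : q' ≤ p') (x y : E d) :
    cov[fun ω => ⟪x, Z p ω - Real.exp (-(lam * (p - q))) • Z q ω⟫_ℝ,
      fun ω => ⟪y, Z p' ω - Real.exp (-(lam * (p' - q'))) • Z q' ω⟫_ℝ; P] = 0 := by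
  rw [hZ.covariance_inner_sub_smul hp hq hp' hq', abs_of_nonneg (by linarith),
    abs_of_nonneg (by linarith), abs_of_nonneg (by linarith), abs_of_nonneg (by linarith)]
  have e1 := periodicCov_sub lam T p q' p'
  have e2 := periodicCov_sub lam T q q' p'
  have e3 : Real.exp (lam * (q' - p - T / 2))
      = Real.exp (-(lam * (p - q))) * Real.exp (lam * (q' - q - T / 2)) := by
    rw [← Real.exp_add]; congr 1; ring
  rw [e3] at e1
  have : periodicCov lam T (p' - p) - Real.exp (-(lam * (p' - q'))) * periodicCov lam T (q' - p)
      - Real.exp (-(lam * (p - q))) * periodicCov lam T (p' - q)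
      + Real.exp (-(lam * (p - q))) * Real.exp (-(lam * (p' - q'))) * periodicCov lam T (q' - q)
      = 0 := by
    linear_combination e1 - Real.exp (-(lam * (p - q))) * e2
  rw [this, zero_mul]

lemma variance_increment [IsProbabilityMeasure P] (hZ : IsPeriodicGaussian lam T Z P)
    (hlam : 0 < lam) (hT : 0 < T)
    {p q : ℝ} (hp : p ∈ Set.Icc 0 T) (hq : q ∈ Set.Icc 0 T) (h : q ≤ p) (x : E d) :
    Var[fun ω => ⟪x, Z p ω - Real.exp (-(lam * (p - q))) • Z q ω⟫_ℝ; P]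
      = (1 - Real.exp (-(lam * (p - q))) ^ 2) / (2 * lam) * ‖x‖ ^ 2 := by
  have hm : AEMeasurable (fun ω => ⟪x, Z p ω - Real.exp (-(lam * (p - q))) • Z q ω⟫_ℝ) P := by
    simp only [inner_sub_right, inner_smul_right]
    exact (hZ.memLp_inner hp x).aemeasurable.sub ((hZ.memLp_inner hq x).aemeasurable.const_mul _)
  have hS : 0 < Real.sinh (lam * T / 2) := Real.sinh_pos_iff.mpr (by positivity)
  rw [← covariance_self hm, hZ.covariance_inner_sub_smul hp hq hp hq, sub_self, sub_self, abs_zero,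
    abs_of_nonneg (sub_nonneg.mpr h), abs_sub_comm, abs_of_nonneg (sub_nonneg.mpr h),
    real_inner_self_eq_norm_sq]
  congr 1
  have e := periodicCov_sub lam T q q p
  rw [sub_self] at e
  set a := Real.exp (-(lam * (p - q))) with ha
  have e0 : periodicCov lam T 0 = Real.cosh (lam * T / 2) /
      (2 * lam * Real.sinh (lam * T / 2)) := by
    rw [periodicCov, ← Real.cosh_neg]; congr 2; ring
  have e1 : Real.exp (lam * (0 - T / 2)) = Real.cosh (lam * T / 2) - Real.sinh (lam * T / 2) := by
    rw [Real.cosh_sub_sinh]; congr 1; ring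
  have e2 : a * Real.sinh (lam * (p - q)) = (1 - a ^ 2) / 2 := by
    have h1 : a * Real.exp (lam * (p - q)) = 1 := by rw [ha, ← Real.exp_add]; simp
    rw [Real.sinh_eq, ← ha]
    linear_combination h1 / 2
  rw [e1] at e
  have e3 : periodicCov lam T (p - q) = a * periodicCov lam T 0 +
      (Real.cosh (lam * T / 2) - Real.sinh (lam * T / 2)) * Real.sinh (lam * (p - q)) /
        (2 * lam * Real.sinh (lam * T / 2)) := by linear_combination e
  rw [e3, e0]
  field_simp
  linear_combination (-2 * (Real.cosh (lam * T / 2) - Real.sinh (lam * T / 2))) * e2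

end IsPeriodicGaussian

section Times

variable {n : ℕ} {T : ℝ} {t : Fin n → ℝ}

lemma cons_mem_Icc (hT : 0 < T) (ht : ∀ k, t k ∈ Set.Ioo 0 T) (k : Fin (n + 1)) :
    (Fin.cons 0 t : Fin (n + 1) → ℝ) k ∈ Set.Icc 0 T := by
  refine Fin.cases ⟨le_rfl, hT.le⟩ (fun j => ?_) k
  rw [Fin.cons_succ]
  exact Set.Ioo_subset_Icc_self (ht j)

lemma snoc_mem_Ioc (hT : 0 < T) (ht : ∀ k, t k ∈ Set.Ioo 0 T) (k : Fin (n + 1)) :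
    (Fin.snoc t T : Fin (n + 1) → ℝ) k ∈ Set.Ioc 0 T := by
  refine Fin.lastCases ?_ (fun j => ?_) k
  · rw [Fin.snoc_last]; exact ⟨hT, le_rfl⟩
  · rw [Fin.snoc_castSucc]; exact ⟨(ht j).1, (ht j).2.le⟩

/-- The `k`-th interval `[sₖ, vₖ]`, with `s = (0, t₁, …, tₙ)` and `v = (t₁, …, tₙ, T)`, ends before
any later one starts. -/
lemma snoc_le_cons_of_lt (hm : StrictMono t) {k l : Fin (n + 1)} (hkl : k < l) :
    (Fin.snoc t T : Fin (n + 1) → ℝ) k ≤ (Fin.cons 0 t : Fin (n + 1) → ℝ) l := by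
  obtain ⟨j, rfl⟩ := Fin.exists_succ_eq.mpr (Fin.pos_iff_ne_zero.mp ((Fin.zero_le k).trans_lt hkl))
  obtain ⟨i, rfl⟩ := Fin.exists_castSucc_eq.mpr (Fin.ne_last_of_lt hkl)
  rw [Fin.snoc_castSucc, Fin.cons_succ]
  exact hm.monotone (Fin.castSucc_lt_succ_iff.mp hkl)

lemma cons_lt_snoc (hm : StrictMono t) (hT : 0 < T) (ht : ∀ k, t k ∈ Set.Ioo 0 T)
    (k : Fin (n + 1)) :
    (Fin.cons 0 t : Fin (n + 1) → ℝ) k < (Fin.snoc t T : Fin (n + 1) → ℝ) k := by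
  rcases Fin.eq_zero_or_eq_succ k with rfl | ⟨j, rfl⟩
  · exact (snoc_mem_Ioc hT ht 0).1
  · rw [Fin.cons_succ]
    rcases Fin.eq_castSucc_or_eq_last j.succ with ⟨i, hi⟩ | hi
    · rw [hi, Fin.snoc_castSucc]
      refine hm ?_
      have := congrArg Fin.val hi
      simp only [Fin.val_succ, Fin.val_castSucc] at this
      exact Fin.lt_def.mpr (by omega)
    · rw [hi, Fin.snoc_last]
      exact (ht j).2

end Times

namespace IsPeriodicGaussian

variable {lam T : ℝ} {Z : ℝ → Ω → E d}

/-- The Ornstein-Uhlenbeck increments over consecutive intervals covering `[0, T]` are independent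
Gaussian vectors. -/
lemma map_increments [IsProbabilityMeasure P] (hZ : IsPeriodicGaussian lam T Z P)
    (hlam : 0 < lam) (hT : 0 < T) {n : ℕ} {t : Fin n → ℝ} (hm : StrictMono t)
    (ht : ∀ k, t k ∈ Set.Ioo 0 T) (a s v : Fin (n + 1) → ℝ) (hs : s = Fin.cons 0 t)
    (hv : v = Fin.snoc t T) (ha : ∀ k, a k = Real.exp (-(lam * (v k - s k)))) :
    P.map (fun ω k => Z (v k) ω - a k • Z (s k) ω)
      = (volume : Measure (Fin (n + 1) → E d)).withDensity fun y =>
        ∏ k, ENNReal.ofReal (gaussDensity ((1 - a k ^ 2) / (2 * lam)) (y k)) := by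
  have hsI : ∀ k, s k ∈ Set.Icc 0 T := fun k => hs ▸ cons_mem_Icc hT ht k
  have hvI : ∀ k, v k ∈ Set.Icc 0 T := fun k => hv ▸ Set.Ioc_subset_Icc_self (snoc_mem_Ioc hT ht k)
  have hsv : ∀ k, s k < v k := fun k => by rw [hs, hv]; exact cons_lt_snoc hm hT ht k
  have hvs : ∀ k l, k < l → v k ≤ s l := fun k l h => by
    rw [hs, hv]; exact snoc_le_cons_of_lt hm h
  have hpos : ∀ k, 0 < (1 - a k ^ 2) / (2 * lam) := by
    intro k
    have h1 : a k < 1 := by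
      rw [ha, Real.exp_lt_one_iff]
      have := mul_pos hlam (sub_pos.mpr (hsv k))
      linarith
    have h0 : 0 < a k := by rw [ha]; exact Real.exp_pos _
    have : 0 < 1 - a k ^ 2 := by nlinarith
    positivity
  have hG : HasGaussianLaw (fun ω k => Z (v k) ω - a k • Z (s k) ω) P := by
    have h := hZ.hasGaussianLaw_pi (Sum.elim v s) (by rintro (k | k); exacts [hvI k, hsI k])
    exact h.map_fun (ContinuousLinearMap.pi fun k =>
      ContinuousLinearMap.proj (R := ℝ) (φ := fun _ : Fin (n + 1) ⊕ Fin (n + 1) => E d) (Sum.inl k)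
        - a k • ContinuousLinearMap.proj (R := ℝ)
          (φ := fun _ : Fin (n + 1) ⊕ Fin (n + 1) => E d) (Sum.inr k))
  have hGk : ∀ k, HasGaussianLaw (fun ω => Z (v k) ω - a k • Z (s k) ω) P := fun k => hG.eval k
  have hind : iIndepFun (fun k ω => Z (v k) ω - a k • Z (s k) ω) P := by
    refine hG.iIndepFun_of_covariance_inner fun k l hkl x y => ?_
    rcases lt_or_gt_of_ne hkl with h | h
    · rw [ha, ha]
      exact hZ.covariance_increments_eq_zero (hvI k) (hsI k) (hvI l) (hsI l) (hsv k).le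
        (hvs k l h) (hsv l).le x y
    · rw [covariance_comm, ha, ha]
      exact hZ.covariance_increments_eq_zero (hvI l) (hsI l) (hvI k) (hsI k) (hsv l).le
        (hvs l k h) (hsv k).le y x
  have hmap : ∀ k, P.map (fun ω => Z (v k) ω - a k • Z (s k) ω)
      = gaussMeasure d ((1 - a k ^ 2) / (2 * lam)) := by
    intro k
    refine map_eq_gaussMeasure (hGk k) (hpos k) (fun x => ?_) (fun x => ?_)
    · simp only [inner_sub_right, inner_smul_right]
      rw [integral_sub ((hZ.memLp_inner (hvI k) x).integrable (by norm_num))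
        (((hZ.memLp_inner (hsI k) x).integrable (by norm_num)).const_mul _),
        integral_const_mul, hZ.integral_inner (hvI k), hZ.integral_inner (hsI k), mul_zero, sub_zero]
    · rw [ha]
      exact hZ.variance_increment hlam hT (hvI k) (hsI k) (hsv k).le x
  rw [hind.map_fun_eq_pi_map (fun k => (hGk k).aemeasurable)]
  simp_rw [hmap, gaussMeasure]
  have : ∀ k, SigmaFinite ((volume : Measure (E d)).withDensity fun x =>
      ENNReal.ofReal (gaussDensity ((1 - a k ^ 2) / (2 * lam)) x)) := fun k => by
    have := isProbabilityMeasure_gaussMeasure (d := d) (hpos k)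
    rw [gaussMeasure] at this
    infer_instance
  rw [pi_withDensity volume fun k => (continuous_gaussDensity _).measurable.ennreal_ofReal]
  rfl

/-- The joint law of the process at the times `0, t₁, …, tₙ`, up to normalization: the
Ornstein-Uhlenbeck densities are turned into Mehler's kernels by the ground state factors, which
cancel around the loop. -/
lemma exists_map_eq_smul [IsProbabilityMeasure P] (hZ : IsPeriodicGaussian lam T Z P)
    (hmeas : ∀ t ∈ Set.Icc 0 T, Measurable (Z t)) (hlam : 0 < lam) (hT : 0 < T) {n : ℕ}
    {t : Fin n → ℝ} (hm : StrictMono t) (ht : ∀ k, t k ∈ Set.Ioo 0 T) :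
    ∃ c : ℝ≥0∞, P.map (fun ω k => Z ((Fin.cons 0 t : Fin (n + 1) → ℝ) k) ω) =
      c • (volume : Measure (Fin (n + 1) → E d)).withDensity fun x =>
        ENNReal.ofReal (pathWeight lam 0 T t (x 0) (x 0) (Fin.tail x)) := by
  set s : Fin (n + 1) → ℝ := Fin.cons 0 t with hs
  set v : Fin (n + 1) → ℝ := Fin.snoc t T with hv
  set a : Fin (n + 1) → ℝ := fun k => Real.exp (-(lam * (v k - s k))) with ha
  have hsv : ∀ k, s k < v k := cons_lt_snoc hm hT ht
  have ha1 : ∀ k, a k < 1 := fun k => by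
    rw [ha, Real.exp_lt_one_iff]
    have := mul_pos hlam (sub_pos.mpr (hsv k))
    linarith
  have hmap := hZ.map_increments hlam hT hm ht a s v rfl rfl fun k => rfl
  have hXm : Measurable fun ω k => Z (s k) ω := measurable_pi_lambda _ fun k =>
    hmeas _ (cons_mem_Icc hT ht k)
  -- Since `Z T = Z 0` almost surely, the increments are a cyclic linear image of the values.
  have hae : (fun ω => cyclicMap a fun k => Z (s k) ω) =ᵐ[P]
      fun ω k => Z (v k) ω - a k • Z (s k) ω := by
    filter_upwards [hZ.ae_eq_endpoints hT] with ω hω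
    ext1 k
    have : (Fin.snoc (Fin.tail fun k => Z (s k) ω) (Z (s 0) ω) : Fin (n + 1) → E d) k
        = Z (v k) ω := by
      refine Fin.lastCases ?_ (fun j => ?_) k
      · rw [Fin.snoc_last, hv, Fin.snoc_last, hω]; rfl
      · rw [Fin.snoc_castSucc, hv, Fin.snoc_castSucc]; rfl
    exact congrArg (· - a k • Z (s k) ω) this
  rw [← Measure.map_congr hae] at hmap
  have hDm : Measurable fun y : Fin (n + 1) → E d =>
      ∏ k, ENNReal.ofReal (gaussDensity ((1 - a k ^ 2) / (2 * lam)) (y k)) :=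
    Finset.measurable_fun_prod _ fun k _ =>
      ((continuous_gaussDensity _).measurable.comp (measurable_pi_apply k)).ennreal_ofReal
  obtain ⟨c, hc⟩ := exists_map_eq_smul_withDensity (volume : Measure (Fin (n + 1) → E d)) hXm
    (cyclicMap_injective (fun k => (Real.exp_pos _).le) ha1) hDm hmap
  set C : ℝ := ∏ k, Real.exp (d * lam / 2 * (v k - s k)) with hC
  have hCp : 0 ≤ C := Finset.prod_nonneg fun k _ => (Real.exp_pos _).le
  have hdens : ∀ x : Fin (n + 1) → E d,
      ∏ k, ENNReal.ofReal (gaussDensity ((1 - a k ^ 2) / (2 * lam)) (cyclicMap a x k))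
        = ENNReal.ofReal C *
          ENNReal.ofReal (pathWeight lam 0 T t (x 0) (x 0) (Fin.tail x)) := by
    intro x
    set y : Fin (n + 1) → E d := Fin.snoc (Fin.tail x) (x 0) with hy
    have h1 : ∀ k, gaussDensity ((1 - a k ^ 2) / (2 * lam)) (cyclicMap a x k)
        = Real.exp (d * lam / 2 * (v k - s k)) * Real.exp (lam / 2 * (‖x k‖ ^ 2 - ‖y k‖ ^ 2)) *
          mehler lam (y k) (v k - s k) (x k) := fun k =>
      gaussDensity_eq_mehler hlam (sub_pos.mpr (hsv k)) (x k) (y k)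
    -- The ground state factors telescope around the loop.
    have h2 : ∏ k, Real.exp (lam / 2 * (‖x k‖ ^ 2 - ‖y k‖ ^ 2)) = 1 := by
      rw [← Real.exp_sum, ← Finset.mul_sum, Finset.sum_sub_distrib, hy,
        sum_snoc_tail x (fun z => ‖z‖ ^ 2), sub_self, mul_zero, Real.exp_zero]
    rw [← ENNReal.ofReal_prod_of_nonneg fun k _ => by
      rw [h1]
      exact mul_nonneg (mul_nonneg (Real.exp_pos _).le (Real.exp_pos _).le)
        (mehler_pos hlam (sub_pos.mpr (hsv k)) _ _).le, ← ENNReal.ofReal_mul hCp]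
    simp_rw [h1]
    rw [Finset.prod_mul_distrib, Finset.prod_mul_distrib, h2, mul_one, pathWeight_eq_prod,
      Fin.cons_self_tail]
  refine ⟨c * ENNReal.ofReal C, ?_⟩
  rw [hc]
  rw [funext hdens, mul_smul]
  congr 1
  have hpm : Measurable fun x : Fin (n + 1) → E d =>
      ENNReal.ofReal (pathWeight lam 0 T t (x 0) (x 0) (Fin.tail x)) :=
    ((continuous_pathWeight lam 0 T t).comp (by unfold Fin.tail; fun_prop :
      Continuous fun x : Fin (n + 1) → E d => ((x 0, x 0), Fin.tail x))).measurable.ennreal_ofReal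
  exact withDensity_smul _ hpm

end IsPeriodicGaussian

end

/-! ### Gaussian processes with the periodic covariance are generated by Mehler's kernel -/

section

variable {d : ℕ} {Ω : Type*} [MeasurableSpace Ω] {P : Measure Ω}

lemma cylinderMass_mixedMeasure {lam T : ℝ} (hlam : 0 < lam) (hT : 0 < T) {n : ℕ}
    (t : Fin n → ℝ) {F₀ FT : Set (E d)} {F : Fin n → Set (E d)} (h₀ : MeasurableSet F₀)
    (h₁ : MeasurableSet FT) :
    cylinderMass (mehler lam) T (mixedMeasure d lam T) t F₀ FT F
      = ENNReal.ofReal (partitionFn d lam T)⁻¹ *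
        ∫⁻ z in F₀ ∩ FT, ∫⁻ x in Set.univ.pi F, ENNReal.ofReal (pathWeight lam 0 T t z z x) := by
  have hm : ∀ x : E d, 0 < mehler lam x T x := fun x => mehler_pos hlam hT x x
  have hmm : Measurable fun p : E d × E d => mehler lam p.1 T p.2 :=
    (continuous_mehler lam T).measurable
  have hG : Measurable fun p : E d × E d => ∫⁻ x in Set.univ.pi F,
      ENNReal.ofReal (pathWeight lam 0 T t p.1 p.2 x / mehler lam p.1 T p.2) := by
    refine Measurable.lintegral_prod_right' (f := fun q : (E d × E d) × (Fin n → E d) =>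
      ENNReal.ofReal (pathWeight lam 0 T t q.1.1 q.1.2 q.2 / mehler lam q.1.1 T q.1.2)) ?_
    exact ((continuous_pathWeight lam 0 T t).measurable.div
      (hmm.comp measurable_fst)).ennreal_ofReal
  have hdiag : Measurable fun x : E d => (x, x) := measurable_id.prodMk measurable_id
  have hd : Measurable fun x : E d =>
      ENNReal.ofReal ((partitionFn d lam T)⁻¹ * mehler lam x T x) :=
    ((hmm.comp hdiag).const_mul _).ennreal_ofReal
  change ∫⁻ p in F₀ ×ˢ FT, (∫⁻ x in Set.univ.pi F,
      ENNReal.ofReal (pathWeight lam 0 T t p.1 p.2 x / mehler lam p.1 T p.2))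
        ∂(mixedMeasure d lam T) = _
  rw [mixedMeasure, setLIntegral_map (h₀.prod h₁) hG hdiag]
  refine (setLIntegral_withDensity_eq_setLIntegral_mul _ hd (hG.comp hdiag)
    (hdiag (h₀.prod h₁))).trans ?_
  rw [← lintegral_const_mul' _ _ ENNReal.ofReal_ne_top]
  refine lintegral_congr fun z => ?_
  have h1 : ∀ x, ENNReal.ofReal (pathWeight lam 0 T t z z x / mehler lam z T z)
      = ENNReal.ofReal (mehler lam z T z)⁻¹ * ENNReal.ofReal (pathWeight lam 0 T t z z x) :=
    fun x => by rw [← ENNReal.ofReal_mul (inv_nonneg.mpr (hm z).le), div_eq_inv_mul]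
  simp only [Pi.mul_apply, Function.comp_apply, h1]
  rw [lintegral_const_mul' _ _ ENNReal.ofReal_ne_top, ← mul_assoc, ← ENNReal.ofReal_mul
    (mul_nonneg (inv_nonneg.mpr (partitionFn_pos hlam hT).le) (hm z).le),
    mul_assoc (partitionFn d lam T)⁻¹, mul_inv_cancel₀ (hm z).ne', mul_one]

/-- Integrating the weight of the loops over a product of sets, the starting point first. -/
lemma setLIntegral_loop (lam T : ℝ) {n : ℕ} (t : Fin n → ℝ) (A : Set (E d))
    (F : Fin n → Set (E d)) :
    ∫⁻ x in Set.univ.pi (Fin.cons A F : Fin (n + 1) → Set (E d)),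
        ENNReal.ofReal (pathWeight lam 0 T t (x 0) (x 0) (Fin.tail x))
      = ∫⁻ z in A, ∫⁻ x in Set.univ.pi F, ENNReal.ofReal (pathWeight lam 0 T t z z x) := by
  have hpm : Measurable fun x : Fin (n + 1) → E d =>
      ENNReal.ofReal (pathWeight lam 0 T t (x 0) (x 0) (Fin.tail x)) :=
    ((continuous_pathWeight lam 0 T t).comp (by unfold Fin.tail; fun_prop :
      Continuous fun x : Fin (n + 1) → E d => ((x 0, x 0), Fin.tail x))).measurable.ennreal_ofReal
  rw [volume_pi, Measure.restrict_pi_pi, lintegral_pi_fin_succ _ hpm]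
  simp only [Fin.cons_zero, Fin.cons_succ, Fin.tail_cons]
  rw [volume_pi, Measure.restrict_pi_pi]

/-- The normalizing constant of the loop density is the partition function, the trace of the
heat semigroup. -/
lemma inv_partitionFn_mul_lintegral_loop {lam T : ℝ} (hlam : 0 < lam) (hT : 0 < T) {n : ℕ}
    {t : Fin n → ℝ} (hm : StrictMono t) (ht : ∀ k, t k ∈ Set.Ioo 0 T) :
    ENNReal.ofReal (partitionFn d lam T)⁻¹ * ∫⁻ x : Fin (n + 1) → E d,
      ENNReal.ofReal (pathWeight lam 0 T t (x 0) (x 0) (Fin.tail x)) = 1 := by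
  have h := setLIntegral_loop (d := d) lam T t Set.univ fun _ => Set.univ
  have hu : Set.univ.pi (Fin.cons Set.univ fun _ => Set.univ : Fin (n + 1) → Set (E d))
      = Set.univ := by
    rw [Set.eq_univ_iff_forall]
    intro x k _
    refine Fin.cases ?_ (fun j => ?_) k <;> simp
  rw [hu, Measure.restrict_univ, Measure.restrict_univ] at h
  rw [h, ← lintegral_const_mul' _ _ ENNReal.ofReal_ne_top]
  have h1 : ∀ z : E d, ENNReal.ofReal (partitionFn d lam T)⁻¹ *
      ∫⁻ x in Set.univ.pi fun _ : Fin n => Set.univ, ENNReal.ofReal (pathWeight lam 0 T t z z x)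
        = ENNReal.ofReal (gaussDensity (oscVariance lam T) z) := fun z => by
    rw [Set.pi_univ, Measure.restrict_univ, lintegral_pathWeight hlam hT hm ht, sub_zero,
      ← ENNReal.ofReal_mul (inv_nonneg.mpr (partitionFn_pos hlam hT).le),
      inv_partitionFn_mul_mehler hlam hT, gaussianDensity_eq]
  simp_rw [h1]
  exact lintegral_gaussDensity (oscVariance_pos hlam hT)

/-- A periodic Gaussian process is generated by Mehler's kernel and the endpoint measure. -/
theorem IsPeriodicGaussian.isGeneratedBy [IsProbabilityMeasure P] {lam T : ℝ} {Z : ℝ → Ω → E d}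
    (hZ : IsPeriodicGaussian lam T Z P) (hlam : 0 < lam) (hT : 0 < T)
    (hmeas : ∀ t ∈ Set.Icc 0 T, Measurable (Z t)) :
    IsGeneratedBy (mehler lam) T (mixedMeasure d lam T) Z P where
  measurable := hmeas
  law n t hm ht F₀ FT F h₀ h₁ hF := by
    obtain ⟨c, hc⟩ := hZ.exists_map_eq_smul hmeas hlam hT hm ht
    have hXm : Measurable fun ω k => Z ((Fin.cons 0 t : Fin (n + 1) → ℝ) k) ω :=
      measurable_pi_lambda _ fun k => hmeas _ (cons_mem_Icc hT ht k)
    have hone : c * ∫⁻ x : Fin (n + 1) → E d,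
        ENNReal.ofReal (pathWeight lam 0 T t (x 0) (x 0) (Fin.tail x)) = 1 := by
      have := Measure.isProbabilityMeasure_map (μ := P) hXm.aemeasurable
      have h1 := measure_univ (μ := P.map fun ω k => Z ((Fin.cons 0 t : Fin (n + 1) → ℝ) k) ω)
      rwa [hc, Measure.smul_apply, withDensity_apply _ MeasurableSet.univ,
        Measure.restrict_univ, smul_eq_mul] at h1
    -- Both constants normalize the loop weight to total mass one.
    have hcZ : c = ENNReal.ofReal (partitionFn d lam T)⁻¹ := by
      rw [ENNReal.eq_inv_of_mul_eq_one_left hone, ENNReal.eq_inv_of_mul_eq_one_left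
        (inv_partitionFn_mul_lintegral_loop hlam hT hm ht)]
    have hS : MeasurableSet
        (Set.univ.pi (Fin.cons (F₀ ∩ FT) F : Fin (n + 1) → Set (E d))) :=
      MeasurableSet.univ_pi fun k => by
        refine Fin.cases ?_ (fun j => ?_) k
        · simpa using h₀.inter h₁
        · simpa using hF j
    rw [cylinderMass_mixedMeasure hlam hT t h₀ h₁, ← setLIntegral_loop, ← hcZ,
      ← withDensity_apply _ hS, ← smul_eq_mul, ← Measure.smul_apply, ← hc,
      Measure.map_apply hXm hS]
    refine measure_congr (Filter.eventuallyEq_set.mpr ?_)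
    filter_upwards [hZ.ae_eq_endpoints hT] with ω hω
    simp only [Set.mem_preimage, Set.mem_univ_pi, Fin.forall_fin_succ,
      Fin.cons_zero, Fin.cons_succ, Set.mem_inter_iff, hω]
    tauto

end

/-! ### The generated process is determined in law -/

section

variable {d : ℕ} {Ω : Type*} [MeasurableSpace Ω] {P : Measure Ω}

/-- The generating formula determines the finite-dimensional distributions, also at repeated or
unordered times and at the endpoints. -/
theorem IsGeneratedBy.sameLaw {g : E d → ℝ → E d → ℝ} {T : ℝ}
    {μ : Measure (E d × E d)} {Z : ℝ → Ω → E d} [IsProbabilityMeasure P]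
    (hZ : IsGeneratedBy g T μ Z P) {Ω' : Type*} [MeasurableSpace Ω'] {P' : Measure Ω'}
    [IsProbabilityMeasure P'] {X : ℝ → Ω' → E d} (hX : IsGeneratedBy g T μ X P') (hT : 0 < T) :
    SameLaw T Z P X P' := by
  classical
  intro n t ht
  -- the times in the open interval, listed increasingly, together with the two endpoints
  let S : Finset ℝ := (Finset.univ.image t).filter fun u => u ∈ Set.Ioo 0 T
  let τ : Fin S.card → ℝ := S.orderEmbOfFin rfl
  have hτ : StrictMono τ := (S.orderEmbOfFin rfl).strictMono
  have hτI : ∀ k, τ k ∈ Set.Ioo 0 T := fun k =>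
    (Finset.mem_filter.mp (S.orderEmbOfFin_mem rfl k)).2
  let σ : Fin S.card ⊕ Bool → ℝ := Sum.elim τ fun b => bif b then T else 0
  have hσ : ∀ i, σ i ∈ Set.Icc 0 T := by
    rintro (k | b)
    · exact Set.Ioo_subset_Icc_self (hτI k)
    · cases b
      · exact ⟨le_rfl, hT.le⟩
      · exact ⟨hT.le, le_rfl⟩
  have hj : ∀ k, ∃ i, σ i = t k := by
    intro k
    rcases eq_or_lt_of_le (ht k).1 with h | h
    · exact ⟨Sum.inr false, h⟩
    rcases eq_or_lt_of_le (ht k).2 with h' | h'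
    · exact ⟨Sum.inr true, h'.symm⟩
    have hk : t k ∈ S := Finset.mem_filter.mpr
      ⟨Finset.mem_image_of_mem _ (Finset.mem_univ k), h, h'⟩
    have : t k ∈ Set.range (S.orderEmbOfFin rfl) := by
      rw [Finset.range_orderEmbOfFin]; exact hk
    obtain ⟨i, hi⟩ := this
    exact ⟨Sum.inl i, hi⟩
  choose j hj using hj
  have hZm : Measurable fun ω i => Z (σ i) ω :=
    measurable_pi_lambda _ fun i => hZ.measurable _ (hσ i)
  have hXm : Measurable fun ω i => X (σ i) ω :=
    measurable_pi_lambda _ fun i => hX.measurable _ (hσ i)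
  have key : IdentDistrib (fun ω i => Z (σ i) ω) (fun ω i => X (σ i) ω) P P' := by
    refine ⟨hZm.aemeasurable, hXm.aemeasurable, ?_⟩
    have := Measure.isProbabilityMeasure_map (μ := P) hZm.aemeasurable
    have := Measure.isProbabilityMeasure_map (μ := P') hXm.aemeasurable
    refine ext_of_generate_finite _ generateFrom_pi.symm isPiSystem_pi ?_ (by simp)
    rintro _ ⟨s, hs, rfl⟩
    have hs' : ∀ i, MeasurableSet (s i) := fun i => hs i (Set.mem_univ i)
    rw [Measure.map_apply hZm (MeasurableSet.univ_pi hs'),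
      Measure.map_apply hXm (MeasurableSet.univ_pi hs')]
    have e1 := hZ.law _ τ hτ hτI _ _ _ (hs' (Sum.inr false)) (hs' (Sum.inr true))
      fun k => hs' (Sum.inl k)
    have e2 := hX.law _ τ hτ hτI _ _ _ (hs' (Sum.inr false)) (hs' (Sum.inr true))
      fun k => hs' (Sum.inl k)
    convert! e1.trans e2.symm using 2
    · ext ω
      simp [σ]
      tauto
    · ext ω
      simp [σ]
      tauto
  have h := key.comp (u := fun v k => v (j k))
    (measurable_pi_lambda _ fun k => measurable_pi_apply (j k))
  simpa only [Function.comp_def, hj] using h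

/-- Every process generated by Mehler's kernel and the endpoint measure has the law of the periodic
Gaussian model. -/
theorem IsGeneratedBy.isPeriodicGaussian {lam T : ℝ} (hlam : 0 < lam)
    (hT : 0 < T) {Z : ℝ → Ω → E d} [IsProbabilityMeasure P]
    (hZ : IsGeneratedBy (mehler lam) T (mixedMeasure d lam T) Z P) :
    IsPeriodicGaussian lam T Z P := by
  obtain ⟨Ω', _, P', X, hP', hXm, hX⟩ := exists_isPeriodicGaussian d hlam hT
  have hXg := hX.isGeneratedBy hlam hT fun t _ => hXm t
  exact hX.of_sameLaw (hXg.sameLaw hZ hT)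

/-- Completing the probability space does not affect a generated process. -/
lemma IsGeneratedBy.completion {g : E d → ℝ → E d → ℝ} {T : ℝ} {μ : Measure (E d × E d)}
    {Z : ℝ → Ω → E d} (hZ : IsGeneratedBy g T μ Z P) :
    IsGeneratedBy (Ω := NullMeasurableSpace Ω P) g T μ Z P.completion where
  measurable t ht := (hZ.measurable t ht).nullMeasurable
  law n t hm ht F₀ FT F h₀ h₁ hF := by
    exact (Measure.completion_apply P _).trans (hZ.law n t hm ht F₀ FT F h₀ h₁ hF)

theorem exists_isGeneratedBy_isComplete (d : ℕ) {lam T : ℝ} (hlam : 0 < lam) (hT : 0 < T) :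
    ∃ (Ω : Type) (_ : MeasurableSpace Ω) (P : Measure Ω) (Z : ℝ → Ω → E d),
      IsProbabilityMeasure P ∧ P.IsComplete ∧
        IsGeneratedBy (mehler lam) T (mixedMeasure d lam T) Z P := by
  obtain ⟨Ω, _, P, Z, hP, hZm, hZ⟩ := exists_isPeriodicGaussian d hlam hT
  refine ⟨NullMeasurableSpace Ω P, inferInstance, P.completion, Z, ⟨?_⟩, inferInstance,
    (hZ.isGeneratedBy hlam hT fun t _ => hZm t).completion⟩
  exact (Measure.completion_apply P _).trans measure_univ

end

/-! ### Conditional expectations of independent perturbations -/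

section

variable {d : ℕ} {Ω : Type*}

/-- Given a `σ`-algebra `m`, an `m`-measurable vector `Y` and a vector `η` independent of `m`, the
conditional law of `Y + η` is the law of `η` translated by `Y`. -/
theorem condExp_add_of_indep {F : Type*} [NormedAddCommGroup F] [NormedSpace ℝ F] [CompleteSpace F]
    {m mΩ : MeasurableSpace Ω} (hm : m ≤ mΩ) {P : Measure Ω} [IsProbabilityMeasure P]
    {Y η : Ω → E d} (hY : Measurable[m] Y) (hη : Measurable η)
    (hind : Indep (MeasurableSpace.comap η inferInstance) m P) {b : E d → F}
    (hb : StronglyMeasurable b) {C : ℝ} (hC : ∀ x, ‖b x‖ ≤ C) :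
    P[fun ω => b (Y ω + η ω) | m] =ᵐ[P] fun ω => ∫ y, b (Y ω + y) ∂(P.map η) := by
  have hYm : Measurable Y := hY.mono hm le_rfl
  have hPη := Measure.isProbabilityMeasure_map (μ := P) hη.aemeasurable
  have hadd : StronglyMeasurable fun p : E d × E d => b (p.1 + p.2) :=
    hb.comp_measurable (measurable_fst.add measurable_snd)
  have hG : StronglyMeasurable fun x : E d => ∫ y, b (x + y) ∂(P.map η) :=
    hadd.integral_prod_right
  have hGC : ∀ x, ‖∫ y, b (x + y) ∂(P.map η)‖ ≤ C := fun x => by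
    refine (norm_integral_le_of_norm_le_const (Eventually.of_forall fun y => hC (x + y))).trans ?_
    simp
  have hf : Integrable (fun ω => b (Y ω + η ω)) P :=
    Integrable.of_bound (hb.comp_measurable (hYm.add hη)).aestronglyMeasurable C
      (Eventually.of_forall fun ω => hC _)
  have hg : Integrable (fun ω => ∫ y, b (Y ω + y) ∂(P.map η)) P :=
    Integrable.of_bound (hG.comp_measurable hYm).aestronglyMeasurable C
      (Eventually.of_forall fun ω => hGC _)
  refine (ae_eq_condExp_of_forall_setIntegral_eq hm hf (fun s _ _ => hg.integrableOn)
    (fun A hA _ => ?_) (hG.comp_measurable hY).aestronglyMeasurable).symm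
  -- the indicator of `A` and `Y` are jointly independent of `η`
  let U : Ω → ℝ × E d := fun ω => (A.indicator (fun _ => 1) ω, Y ω)
  have hU : Measurable[m] U := (measurable_const.indicator hA).prodMk hY
  have hUm : Measurable U := hU.mono hm le_rfl
  have hi : IndepFun U η P := by
    have h1 : Indep (MeasurableSpace.comap U inferInstance)
        (MeasurableSpace.comap η inferInstance) P :=
      indep_of_indep_of_le_left hind.symm hU.comap_le
    exact h1
  have hmap := hi.map_prod_eq_prod_map_map hUm.aemeasurable hη.aemeasurable
  have hPU := Measure.isProbabilityMeasure_map (μ := P) hUm.aemeasurable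
  have hΦ : StronglyMeasurable fun q : (ℝ × E d) × E d => q.1.1 • b (q.1.2 + q.2) :=
    (measurable_fst.fst.stronglyMeasurable).smul
      (hb.comp_measurable (measurable_fst.snd.add measurable_snd))
  have hAind : ∀ h : Ω → F, ∫ ω in A, h ω ∂P = ∫ ω, (U ω).1 • h ω ∂P := fun h => by
    rw [← integral_indicator (hm A hA)]
    refine integral_congr_ae (Eventually.of_forall fun ω => ?_)
    by_cases hω : ω ∈ A <;> simp [U, hω]
  have hUC : ∀ ω, ‖(U ω).1‖ ≤ 1 := fun ω => by
    by_cases hω : ω ∈ A <;> simp [U, hω]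
  have hint : Integrable (fun q : (ℝ × E d) × E d => q.1.1 • b (q.1.2 + q.2))
      ((P.map U).prod (P.map η)) := by
    rw [← hmap, integrable_map_measure hΦ.aestronglyMeasurable (hUm.prodMk hη).aemeasurable]
    refine Integrable.of_bound
      (hΦ.comp_measurable (hUm.prodMk hη)).aestronglyMeasurable C (Eventually.of_forall fun ω => ?_)
    simp only [Function.comp_apply, norm_smul]
    calc ‖(U ω).1‖ * ‖b ((U ω).2 + η ω)‖ ≤ 1 * C :=
          mul_le_mul (hUC ω) (hC _) (norm_nonneg _) zero_le_one
      _ = C := one_mul C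
  rw [hAind, hAind]
  calc ∫ ω, (U ω).1 • ∫ y, b (Y ω + y) ∂(P.map η) ∂P
      = ∫ u, ∫ y, u.1 • b (u.2 + y) ∂(P.map η) ∂(P.map U) := by
        rw [integral_map hUm.aemeasurable
          (hΦ.integral_prod_right (ν := P.map η)).aestronglyMeasurable]
        refine integral_congr_ae (Eventually.of_forall fun ω => ?_)
        exact (integral_smul _ _).symm
    _ = ∫ q, q.1.1 • b (q.1.2 + q.2) ∂((P.map U).prod (P.map η)) :=
        (integral_prod _ hint).symm
    _ = ∫ ω, (U ω).1 • b (Y ω + η ω) ∂P := by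
        rw [← hmap, integral_map (hUm.prodMk hη).aemeasurable hΦ.aestronglyMeasurable]

/-! ### The bridge between two times -/

/-- The mean at time `r` of the bridge from `y` at time `s` to `x` at time `t`. -/
def bridgeMean (lam s r t : ℝ) (x y : E d) : E d :=
  (Real.sinh (lam * (r - s)) / Real.sinh (lam * (t - s))) • x +
    (Real.sinh (lam * (t - r)) / Real.sinh (lam * (t - s))) • y

/-- The variance at time `r` of the bridge between the times `s` and `t`. -/
def bridgeVar (lam s r t : ℝ) : ℝ :=
  Real.sinh (lam * (t - r)) * Real.sinh (lam * (r - s)) / (lam * Real.sinh (lam * (t - s)))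

lemma bridgeVar_pos {lam s r t : ℝ} (hlam : 0 < lam) (hsr : s < r) (hrt : r < t) :
    0 < bridgeVar lam s r t := by
  have h := bridge_variance_pos hlam (sub_pos.mpr hrt) (sub_pos.mpr hsr)
  rwa [sub_add_sub_cancel] at h

lemma continuous_bridgeMean (lam s r t : ℝ) :
    Continuous fun p : E d × E d => bridgeMean lam s r t p.1 p.2 := by
  unfold bridgeMean; fun_prop

/-- The two-sided transition density of Mehler's kernel is the Gaussian density of the bridge. -/
lemma transitionDensity_mehler {lam s r t : ℝ} (hlam : 0 < lam) (hsr : s < r) (hrt : r < t)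
    (x z y : E d) :
    transitionDensity (mehler lam) x t z r y s
      = gaussDensity (bridgeVar lam s r t) (z - bridgeMean lam s r t x y) := by
  have h := mehler_mul_mehler hlam (sub_pos.mpr hrt) (sub_pos.mpr hsr) x y z
  rw [sub_add_sub_cancel] at h
  rw [transitionDensity, h, mul_div_cancel_left₀ _
    (mehler_pos hlam (sub_pos.mpr (hsr.trans hrt)) x y).ne']
  rfl

/-- Hyperbolic interpolation: the value of a hyperbolic cosine between two points in terms of its
values at these points. -/
lemma sinh_mul_cosh_interpolation (p q a : ℝ) :
    Real.sinh q * Real.cosh (p + q + a) + Real.sinh p * Real.cosh a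
      = Real.sinh (p + q) * Real.cosh (q + a) := by
  have h := Real.cosh_sq q
  rw [add_assoc, Real.cosh_add p (q + a), Real.sinh_add p q, Real.sinh_add q a, Real.cosh_add q a]
  linear_combination (-Real.sinh p * Real.cosh a) * h

/-- Seen from a time outside `(s, t)`, the covariance is, on `[s, t]`, a hyperbolic cosine. -/
lemma exists_periodicCov_eq (lam T : ℝ) {s t u : ℝ} (hu : u ≤ s ∨ t ≤ u) :
    ∃ a, ∀ p ∈ Set.Icc s t, periodicCov lam T |u - p|
      = Real.cosh (lam * (p + a)) / (2 * lam * Real.sinh (lam * T / 2)) := by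
  rcases hu with hu | hu
  · refine ⟨-u - T / 2, fun p hp => ?_⟩
    rw [abs_sub_comm, abs_of_nonneg (by linarith [hp.1]), periodicCov]
    congr 3; ring
  · refine ⟨T / 2 - u, fun p hp => ?_⟩
    rw [abs_of_nonneg (by linarith [hp.2]), periodicCov, ← Real.cosh_neg]
    congr 2; ring

lemma periodicCov_bridge (lam T : ℝ) (hlam : 0 < lam) {s r t u : ℝ} (hsr : s < r) (hrt : r < t)
    (hu : u ≤ s ∨ t ≤ u) :
    periodicCov lam T |u - r| - Real.sinh (lam * (r - s)) / Real.sinh (lam * (t - s)) *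
        periodicCov lam T |u - t| - Real.sinh (lam * (t - r)) / Real.sinh (lam * (t - s)) *
        periodicCov lam T |u - s| = 0 := by
  obtain ⟨a, ha⟩ := exists_periodicCov_eq lam T hu
  rw [ha r ⟨hsr.le, hrt.le⟩, ha t ⟨(hsr.trans hrt).le, le_rfl⟩, ha s ⟨le_rfl, (hsr.trans hrt).le⟩]
  have h := sinh_mul_cosh_interpolation (lam * (t - r)) (lam * (r - s)) (lam * (s + a))
  have e1 : lam * (t - r) + lam * (r - s) + lam * (s + a) = lam * (t + a) := by ring
  have e2 : lam * (t - r) + lam * (r - s) = lam * (t - s) := by ring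
  have e3 : lam * (r - s) + lam * (s + a) = lam * (r + a) := by ring
  rw [e1, e2, e3] at h
  have hS : Real.sinh (lam * (t - s)) ≠ 0 :=
    (Real.sinh_pos_iff.mpr (mul_pos hlam (sub_pos.mpr (hsr.trans hrt)))).ne'
  have h' : Real.cosh (lam * (r + a)) = (Real.sinh (lam * (r - s)) * Real.cosh (lam * (t + a)) +
      Real.sinh (lam * (t - r)) * Real.cosh (lam * (s + a))) / Real.sinh (lam * (t - s)) := by
    rw [h, mul_div_cancel_left₀ _ hS]
  rw [h']
  ring

end

lemma covariance_sub_mul_sub_mul {Ω : Type*} [MeasurableSpace Ω] {P : Measure Ω}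
    [IsFiniteMeasure P] {X Y V W : Ω → ℝ} (hX : MemLp X 2 P) (hY : MemLp Y 2 P) (hV : MemLp V 2 P)
    (hW : MemLp W 2 P) (a b : ℝ) :
    cov[fun ω => X ω - a * Y ω - b * V ω, W; P]
      = cov[X, W; P] - a * cov[Y, W; P] - b * cov[V, W; P] := by
  rw [covariance_fun_sub_left (X := fun ω => X ω - a * Y ω) (hX.sub (hY.const_mul a))
    (hV.const_mul b) hW, covariance_fun_sub_left hX (hY.const_mul a) hW,
    covariance_const_mul_left, covariance_const_mul_left]

namespace IsPeriodicGaussian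

variable {d : ℕ} {Ω : Type*} [MeasurableSpace Ω] {P : Measure Ω}
variable {lam T : ℝ} {Z : ℝ → Ω → E d}

lemma covariance_bridge_right [IsProbabilityMeasure P] (hZ : IsPeriodicGaussian lam T Z P)
    {s r t u : ℝ} (hs : s ∈ Set.Icc 0 T) (hr : r ∈ Set.Icc 0 T) (ht : t ∈ Set.Icc 0 T)
    (hu : u ∈ Set.Icc 0 T) (x y : E d) :
    cov[fun ω => ⟪x, Z r ω - bridgeMean lam s r t (Z t ω) (Z s ω)⟫_ℝ, fun ω => ⟪y, Z u ω⟫_ℝ; P]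
      = (periodicCov lam T |u - r| - Real.sinh (lam * (r - s)) / Real.sinh (lam * (t - s)) *
        periodicCov lam T |u - t| - Real.sinh (lam * (t - r)) / Real.sinh (lam * (t - s)) *
        periodicCov lam T |u - s|) * ⟪x, y⟫_ℝ := by
  simp only [bridgeMean, inner_sub_right, inner_smul_right, ← sub_sub]
  rw [covariance_sub_mul_sub_mul (hZ.memLp_inner hr x) (hZ.memLp_inner ht x)
      (hZ.memLp_inner hs x) (hZ.memLp_inner hu y),
    hZ.covariance_inner hr hu, hZ.covariance_inner ht hu, hZ.covariance_inner hs hu]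
  ring

/-- The deviation from the bridge mean is uncorrelated with the past and the future. -/
lemma covariance_bridge_eq_zero [IsProbabilityMeasure P] (hZ : IsPeriodicGaussian lam T Z P)
    (hlam : 0 < lam) {s r t u : ℝ} (h0 : 0 ≤ s) (hsr : s < r) (hrt : r < t) (h1 : t ≤ T)
    (hu : u ∈ Set.Icc 0 T) (h : u ≤ s ∨ t ≤ u) (x y : E d) :
    cov[fun ω => ⟪x, Z r ω - bridgeMean lam s r t (Z t ω) (Z s ω)⟫_ℝ, fun ω => ⟪y, Z u ω⟫_ℝ; P]
      = 0 := by
  rw [hZ.covariance_bridge_right ⟨h0, by linarith⟩ ⟨by linarith, by linarith⟩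
    ⟨by linarith, h1⟩ hu, periodicCov_bridge lam T hlam hsr hrt h, zero_mul]

/-- The covariance of `Z_r` with its deviation from the bridge mean is the bridge variance. -/
lemma periodicCov_zero_sub_bridge {lam T : ℝ} (hlam : 0 < lam) (hT : 0 < T) {s r t : ℝ}
    (hsr : s < r) (hrt : r < t) :
    periodicCov lam T |r - r| - Real.sinh (lam * (r - s)) / Real.sinh (lam * (t - s)) *
        periodicCov lam T |r - t| - Real.sinh (lam * (t - r)) / Real.sinh (lam * (t - s)) *
        periodicCov lam T |r - s| = bridgeVar lam s r t := by
  have hS : 0 < Real.sinh (lam * T / 2) := Real.sinh_pos_iff.mpr (by positivity)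
  have e : ∀ u, periodicCov lam T u = (Real.cosh (lam * u) * Real.cosh (lam * T / 2)
      - Real.sinh (lam * u) * Real.sinh (lam * T / 2)) / (2 * lam * Real.sinh (lam * T / 2)) := by
    intro u
    rw [← Real.cosh_sub, periodicCov]
    congr 2; ring
  rw [sub_self, abs_zero, abs_of_pos (sub_pos.mpr hsr), abs_sub_comm, abs_of_pos (sub_pos.mpr hrt),
    e, e, e, mul_zero, Real.cosh_zero, Real.sinh_zero, bridgeVar]
  have h2 : lam * (t - s) = lam * (t - r) + lam * (r - s) := by ring
  have h3 : 0 < Real.sinh (lam * (t - s)) :=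
    Real.sinh_pos_iff.mpr (mul_pos hlam (sub_pos.mpr (hsr.trans hrt)))
  rw [h2, Real.sinh_add] at h3 ⊢
  generalize Real.sinh (lam * (t - r)) = p, Real.cosh (lam * (t - r)) = p',
    Real.sinh (lam * (r - s)) = q, Real.cosh (lam * (r - s)) = q',
    Real.sinh (lam * T / 2) = S, Real.cosh (lam * T / 2) = C at h3 hS ⊢
  obtain ⟨D, hD⟩ : ∃ D, D = p * q' + p' * q := ⟨_, rfl⟩
  rw [← hD] at h3 ⊢
  field_simp
  linear_combination C * hD

lemma hasGaussianLaw_bridge [IsProbabilityMeasure P] (hZ : IsPeriodicGaussian lam T Z P)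
    {s r t : ℝ} (hs : s ∈ Set.Icc 0 T) (hr : r ∈ Set.Icc 0 T) (ht : t ∈ Set.Icc 0 T) :
    HasGaussianLaw (fun ω => Z r ω - bridgeMean lam s r t (Z t ω) (Z s ω)) P := by
  have h := hZ.hasGaussianLaw_pi ![s, r, t] (by
    intro k; fin_cases k; exacts [hs, hr, ht])
  exact h.map_fun (ContinuousLinearMap.proj (R := ℝ) (φ := fun _ : Fin 3 => E d) 1
    - ((Real.sinh (lam * (r - s)) / Real.sinh (lam * (t - s))) •
        ContinuousLinearMap.proj (R := ℝ) (φ := fun _ : Fin 3 => E d) 2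
      + (Real.sinh (lam * (t - r)) / Real.sinh (lam * (t - s))) •
        ContinuousLinearMap.proj (R := ℝ) (φ := fun _ : Fin 3 => E d) 0))

lemma map_bridge [IsProbabilityMeasure P] (hZ : IsPeriodicGaussian lam T Z P)
    (hlam : 0 < lam) {s r t : ℝ} (h0 : 0 ≤ s) (hsr : s < r) (hrt : r < t) (h1 : t ≤ T) :
    P.map (fun ω => Z r ω - bridgeMean lam s r t (Z t ω) (Z s ω))
      = gaussMeasure d (bridgeVar lam s r t) := by
  have hs : s ∈ Set.Icc 0 T := ⟨h0, by linarith⟩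
  have hr : r ∈ Set.Icc 0 T := ⟨by linarith, by linarith⟩
  have ht : t ∈ Set.Icc 0 T := ⟨by linarith, h1⟩
  have hT : 0 < T := by linarith
  have hG := hZ.hasGaussianLaw_bridge hs hr ht
  have hL : ∀ x, MemLp (fun ω => ⟪x, Z r ω - bridgeMean lam s r t (Z t ω) (Z s ω)⟫_ℝ) 2 P := by
    intro x
    simp only [bridgeMean, inner_sub_right, inner_add_right, inner_smul_right]
    exact (hZ.memLp_inner hr x).sub
      (((hZ.memLp_inner ht x).const_mul _).add ((hZ.memLp_inner hs x).const_mul _))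
  refine map_eq_gaussMeasure hG (bridgeVar_pos hlam hsr hrt) (fun x => ?_) fun x => ?_
  · simp only [bridgeMean, inner_sub_right, inner_add_right, inner_smul_right]
    have hi : ∀ {u : ℝ}, u ∈ Set.Icc 0 T → Integrable (fun ω => ⟪x, Z u ω⟫_ℝ) P :=
      fun hu => (hZ.memLp_inner hu x).integrable (by norm_num)
    simp only [← sub_sub]
    rw [integral_sub (f := fun ω => ⟪x, Z r ω⟫_ℝ - _ * ⟪x, Z t ω⟫_ℝ)
        ((hi hr).sub ((hi ht).const_mul _)) ((hi hs).const_mul _),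
      integral_sub (hi hr) ((hi ht).const_mul _), integral_const_mul, integral_const_mul,
      hZ.integral_inner hr, hZ.integral_inner hs, hZ.integral_inner ht]
    simp
  · rw [← covariance_self (hL x).aemeasurable]
    have h2 : (fun ω => ⟪x, Z r ω - bridgeMean lam s r t (Z t ω) (Z s ω)⟫_ℝ) = fun ω =>
        ⟪x, Z r ω⟫_ℝ - Real.sinh (lam * (r - s)) / Real.sinh (lam * (t - s)) * ⟪x, Z t ω⟫_ℝ
          - Real.sinh (lam * (t - r)) / Real.sinh (lam * (t - s)) * ⟪x, Z s ω⟫_ℝ := by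
      funext ω
      simp only [bridgeMean, inner_sub_right, inner_smul_right, ← sub_sub]
    have hst : s < t := hsr.trans hrt
    conv_lhs => arg 1; rw [h2]
    rw [covariance_sub_mul_sub_mul (hZ.memLp_inner hr x) (hZ.memLp_inner ht x)
        (hZ.memLp_inner hs x) (hL x), covariance_comm (fun ω => ⟪x, Z r ω⟫_ℝ),
      covariance_comm (fun ω => ⟪x, Z t ω⟫_ℝ), covariance_comm (fun ω => ⟪x, Z s ω⟫_ℝ),
      hZ.covariance_bridge_eq_zero hlam h0 hsr hrt h1 ht (Or.inr le_rfl),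
      hZ.covariance_bridge_eq_zero hlam h0 hsr hrt h1 hs (Or.inl le_rfl),
      hZ.covariance_bridge_right hs hr ht hr, periodicCov_zero_sub_bridge hlam hT hsr hrt,
      real_inner_self_eq_norm_sq, mul_zero, mul_zero, sub_zero, sub_zero]

/-- The deviation from the bridge mean is independent of the past and the future. -/
lemma indep_bridge [IsProbabilityMeasure P] (hZ : IsPeriodicGaussian lam T Z P)
    (hlam : 0 < lam) {s r t : ℝ} (h0 : 0 ≤ s) (hsr : s < r) (hrt : r < t) (h1 : t ≤ T) :
    Indep (MeasurableSpace.comap (fun ω => Z r ω - bridgeMean lam s r t (Z t ω) (Z s ω))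
      inferInstance) (past Z s ⊔ future T Z t) P := by
  classical
  have hs : s ∈ Set.Icc 0 T := ⟨h0, by linarith⟩
  have hr : r ∈ Set.Icc 0 T := ⟨by linarith, by linarith⟩
  have ht : t ∈ Set.Icc 0 T := ⟨by linarith, h1⟩
  let S : Set ℝ := {u | u ∈ Set.Icc 0 T ∧ (u ≤ s ∨ t ≤ u)}
  let η : Ω → E d := fun ω => Z r ω - bridgeMean lam s r t (Z t ω) (Z s ω)
  have hG : IsGaussianProcess (Sum.elim (fun _ : Unit => η) (fun (u : S) => Z u)) P := by
    refine hZ.isGaussianProcess.of_isGaussianProcess ?_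
    rintro (_ | u)
    · let I : Finset (Set.Icc (0 : ℝ) T) := {⟨s, hs⟩, ⟨r, hr⟩, ⟨t, ht⟩}
      let pr : ∀ i ∈ I, (I → E d) →L[ℝ] E d := fun i hi =>
        ContinuousLinearMap.proj (R := ℝ) (φ := fun _ : I => E d) ⟨i, hi⟩
      refine ⟨I, pr ⟨r, hr⟩ (by simp [I]) -
        ((Real.sinh (lam * (r - s)) / Real.sinh (lam * (t - s))) • pr ⟨t, ht⟩ (by simp [I]) +
         (Real.sinh (lam * (t - r)) / Real.sinh (lam * (t - s))) • pr ⟨s, hs⟩ (by simp [I])),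
        fun ω => rfl⟩
    · exact ⟨{⟨u, u.2.1⟩}, ContinuousLinearMap.proj (R := ℝ) ⟨⟨u, u.2.1⟩, by simp⟩, fun ω => rfl⟩
  have hind : IndepFun (fun ω (_ : Unit) => η ω) (fun ω (u : S) => Z u ω) P :=
    hG.indepFun_of_covariance_inner (fun _ => (hZ.hasGaussianLaw_bridge hs hr ht).aemeasurable)
      (fun u => hZ.aemeasurable u u.2.1) fun _ u x y =>
        hZ.covariance_bridge_eq_zero hlam h0 hsr hrt h1 u.2.1 u.2.2 x y
  have hle : past Z s ⊔ future T Z t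
      ≤ MeasurableSpace.comap (fun ω (u : S) => Z u ω) inferInstance := by
    have key : ∀ u : S, MeasurableSpace.comap (Z u) inferInstance
        ≤ MeasurableSpace.comap (fun ω (u : S) => Z u ω) inferInstance := fun u =>
      ((measurable_pi_apply u).comp (comap_measurable fun ω (u : S) => Z u ω)).comap_le
    refine sup_le (iSup₂_le fun u hu => ?_) (iSup₂_le fun u hu => ?_)
    · exact key ⟨u, ⟨hu.1, by linarith [hu.2]⟩, Or.inl hu.2⟩
    · exact key ⟨u, ⟨by linarith [hu.1], hu.2⟩, Or.inr hu.1⟩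
  have h2 : Indep (MeasurableSpace.comap (fun ω (_ : Unit) => η ω) inferInstance)
      (MeasurableSpace.comap (fun ω (u : S) => Z u ω) inferInstance) P := hind
  refine indep_of_indep_of_le_left (indep_of_indep_of_le_right h2 hle) ?_
  exact ((measurable_pi_apply ()).comp
    (comap_measurable fun ω (_ : Unit) => η ω)).comap_le

end IsPeriodicGaussian

/-! ### Bernstein property, transition function, failure of the Markov property -/

namespace IsPeriodicGaussian

variable {d : ℕ} {Ω : Type*} [MeasurableSpace Ω] {P : Measure Ω}
variable {lam T : ℝ} {Z : ℝ → Ω → E d}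

lemma present_le {s : ℝ} (hs : Measurable (Z s)) : present Z s ≤ ‹MeasurableSpace Ω› :=
  hs.comap_le

lemma past_sup_future_le (hmeas : ∀ t ∈ Set.Icc 0 T, Measurable (Z t)) {s t : ℝ} (h0 : 0 ≤ t)
    (hs : s ≤ T) : past Z s ⊔ future T Z t ≤ ‹MeasurableSpace Ω› :=
  sup_le (iSup₂_le fun u hu => (hmeas u ⟨hu.1, hu.2.trans hs⟩).comap_le)
    (iSup₂_le fun u hu => (hmeas u ⟨h0.trans hu.1, hu.2⟩).comap_le)

lemma present_sup_present_le {Ω : Type*} {Z : ℝ → Ω → E d} {s t : ℝ} (h0 : 0 ≤ s) (ht : t ≤ T) :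
    present Z s ⊔ present Z t ≤ past Z s ⊔ future T Z t :=
  sup_le_sup
    (le_iSup₂ (f := fun τ (_ : τ ∈ Set.Icc 0 s) => MeasurableSpace.comap (Z τ) inferInstance) s
      ⟨h0, le_rfl⟩)
    (le_iSup₂ (f := fun τ (_ : τ ∈ Set.Icc t T) => MeasurableSpace.comap (Z τ) inferInstance) t
      ⟨le_rfl, ht⟩)

/-- Any information between the present at the two times `s`, `t` and the past and future leads to
the same conditional law at time `r`, that of the bridge. -/
lemma condExp_bridge {Ω' : Type*} {m mΩ : MeasurableSpace Ω'} {P : Measure Ω'} {Z : ℝ → Ω' → E d}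
    [IsProbabilityMeasure P] (hZ : IsPeriodicGaussian lam T Z P)
    (hmeas : ∀ t ∈ Set.Icc 0 T, Measurable (Z t)) (hlam : 0 < lam) {s r t : ℝ} (h0 : 0 ≤ s)
    (hsr : s < r) (hrt : r < t) (h1 : t ≤ T)
    (hm : present Z s ⊔ present Z t ≤ m) (hm' : m ≤ past Z s ⊔ future T Z t)
    {F : Type*} [NormedAddCommGroup F] [NormedSpace ℝ F] [CompleteSpace F] {b : E d → F}
    (hb : StronglyMeasurable b) {C : ℝ} (hC : ∀ x, ‖b x‖ ≤ C) :
    P[fun ω => b (Z r ω) | m] =ᵐ[P] fun ω => ∫ y, b (bridgeMean lam s r t (Z t ω) (Z s ω) + y)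
      ∂(gaussMeasure d (bridgeVar lam s r t)) := by
  have hs : s ∈ Set.Icc 0 T := ⟨h0, by linarith⟩
  have hr : r ∈ Set.Icc 0 T := ⟨by linarith, by linarith⟩
  have ht : t ∈ Set.Icc 0 T := ⟨by linarith, h1⟩
  have hbm := (continuous_bridgeMean (d := d) lam s r t).measurable
  have hY : Measurable[m] fun ω => bridgeMean lam s r t (Z t ω) (Z s ω) := by
    have hsm : Measurable[m] (Z s) :=
      (comap_measurable (Z s)).mono (le_sup_left.trans hm) le_rfl
    have htm : Measurable[m] (Z t) :=
      (comap_measurable (Z t)).mono (le_sup_right.trans hm) le_rfl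
    exact hbm.comp (htm.prodMk hsm)
  have hη : Measurable fun ω => Z r ω - bridgeMean lam s r t (Z t ω) (Z s ω) :=
    (hmeas r hr).sub (hbm.comp ((hmeas t ht).prodMk (hmeas s hs)))
  have h := condExp_add_of_indep (hm'.trans (past_sup_future_le hmeas ht.1 hs.2)) hY hη
    (indep_of_indep_of_le_right (hZ.indep_bridge hlam h0 hsr hrt h1) hm') hb hC
  simpa only [add_sub_cancel, hZ.map_bridge hlam h0 hsr hrt h1] using h

theorem isBernstein [IsProbabilityMeasure P] (hZ : IsPeriodicGaussian lam T Z P)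
    (hmeas : ∀ t ∈ Set.Icc 0 T, Measurable (Z t)) (hlam : 0 < lam) : IsBernstein T Z P := by
  rintro b hb ⟨C, hC⟩ s r t h0 hsr hrt h1
  have hle := present_sup_present_le (Z := Z) h0 h1
  exact (hZ.condExp_bridge hmeas hlam h0 hsr hrt h1 hle le_rfl hb.stronglyMeasurable hC).trans
    (hZ.condExp_bridge hmeas hlam h0 hsr hrt h1 le_rfl hle hb.stronglyMeasurable hC).symm

theorem hasTransition [IsProbabilityMeasure P] (hZ : IsPeriodicGaussian lam T Z P)
    (hmeas : ∀ t ∈ Set.Icc 0 T, Measurable (Z t)) (hlam : 0 < lam) :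
    HasTransition (mehler lam) T Z P := by
  intro F hF s r t h0 hsr hrt h1
  have hv := bridgeVar_pos hlam hsr hrt
  refine (hZ.condExp_bridge hmeas hlam h0 hsr hrt h1 le_rfl (present_sup_present_le h0 h1)
    (b := F.indicator fun _ => (1 : ℝ)) (stronglyMeasurable_const.indicator hF) (C := 1)
    fun x => (norm_indicator_le_norm_self _ x).trans (by simp)).trans
    (Eventually.of_forall fun ω => ?_)
  have hd : Measurable fun y : E d => ENNReal.ofReal (gaussDensity (bridgeVar lam s r t) y) :=
    (continuous_gaussDensity _).measurable.ennreal_ofReal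
  simp only [transitionDensity_mehler hlam hsr hrt]
  rw [gaussMeasure, integral_withDensity_eq_integral_toReal_smul hd
      (Eventually.of_forall fun _ => ENNReal.ofReal_lt_top), ← integral_indicator hF,
    ← integral_add_left_eq_self (F.indicator fun z => gaussDensity (bridgeVar lam s r t)
      (z - bridgeMean lam s r t (Z t ω) (Z s ω))) (bridgeMean lam s r t (Z t ω) (Z s ω))]
  refine integral_congr_ae (Eventually.of_forall fun y => ?_)
  simp only [ENNReal.toReal_ofReal (gaussDensity_pos hv y).le, smul_eq_mul]
  by_cases hy : bridgeMean lam s r t (Z t ω) (Z s ω) + y ∈ F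
  · rw [Set.indicator_of_mem hy, Set.indicator_of_mem hy, mul_one, add_sub_cancel_left]
  · rw [Set.indicator_of_notMem hy, Set.indicator_of_notMem hy, mul_zero]

/-- The process is a loop, so that its past determines `Z_T`, while given only `Z_{T/2}` the
variable `Z_T` is still a non-degenerate Gaussian vector. -/
theorem not_isMarkov [IsProbabilityMeasure P] (hZ : IsPeriodicGaussian lam T Z P)
    (hmeas : ∀ t ∈ Set.Icc 0 T, Measurable (Z t)) (hlam : 0 < lam) (hT : 0 < T) (hd : 1 ≤ d) :
    ¬ IsMarkov T Z P := by
  intro hM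
  have h0 : (0 : ℝ) ∈ Set.Icc 0 T := ⟨le_rfl, hT.le⟩
  have hs : T / 2 ∈ Set.Icc 0 T := ⟨by linarith, by linarith⟩
  set e : E d := EuclideanSpace.single (⟨0, hd⟩ : Fin d) (1 : ℝ) with he
  have he1 : ‖e‖ = 1 := by simp [he]
  let b : E d → ℂ := fun x => Complex.exp ((⟪x, e⟫_ℝ : ℝ) * Complex.I)
  have hbc : Continuous b := by fun_prop
  have hb1 : ∀ x, ‖b x‖ = 1 := fun x => Complex.norm_exp_ofReal_mul_I _
  have hS : 0 < Real.sinh (lam * T / 2) := Real.sinh_pos_iff.mpr (by positivity)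
  -- the conditional variance is positive
  set c₀ := periodicCov lam T 0 with hc₀
  set c₁ := periodicCov lam T (T / 2) with hc₁
  have hc1 : 0 < c₁ := by
    rw [hc₁, periodicCov]; positivity
  have hc : c₁ < c₀ := by
    rw [hc₁, hc₀, periodicCov, periodicCov]
    refine div_lt_div_of_pos_right ?_ (by positivity)
    rw [sub_self, mul_zero, Real.cosh_zero]
    exact Real.one_lt_cosh.mpr (by
      have : 0 < lam * (T / 2) := by positivity
      intro h; linarith)
  have hc0 : 0 < c₀ := hc1.trans hc
  have hv : 0 < c₀ - c₁ ^ 2 / c₀ := by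
    have : c₁ ^ 2 / c₀ < c₀ := by
      rw [div_lt_iff₀ hc0]; nlinarith
    linarith
  have hcov : ∀ x y, cov[fun ω => ⟪x, Z 0 ω - (c₁ / c₀) • Z (T / 2) ω⟫_ℝ,
      fun ω => ⟪y, Z (T / 2) ω⟫_ℝ; P] = 0 := fun x y => by
    have h := hZ.covariance_inner_sub_smul h0 hs hs h0 (c₁ / c₀) 0 x y
    simp only [zero_smul, sub_zero, zero_mul, mul_zero, add_zero, sub_self, abs_zero,
      abs_of_nonneg hs.1] at h
    rw [h, ← hc₀, ← hc₁, div_mul_cancel₀ _ hc0.ne', sub_self, zero_mul]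
  have hpair : HasGaussianLaw (fun ω => (Z 0 ω - (c₁ / c₀) • Z (T / 2) ω, Z (T / 2) ω)) P := by
    have h := hZ.hasGaussianLaw_pi ![0, T / 2] (by intro k; fin_cases k; exacts [h0, hs])
    exact h.map_fun ((ContinuousLinearMap.proj (R := ℝ) (φ := fun _ : Fin 2 => E d) 0 -
      (c₁ / c₀) • ContinuousLinearMap.proj (R := ℝ) (φ := fun _ : Fin 2 => E d) 1).prod
      (ContinuousLinearMap.proj (R := ℝ) (φ := fun _ : Fin 2 => E d) 1))
  have hind := hpair.indepFun_of_covariance_inner hcov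
  have hmap : P.map (fun ω => Z 0 ω - (c₁ / c₀) • Z (T / 2) ω)
      = gaussMeasure d (c₀ - c₁ ^ 2 / c₀) := by
    have hG : HasGaussianLaw (fun ω => Z 0 ω - (c₁ / c₀) • Z (T / 2) ω) P := hpair.fst
    refine map_eq_gaussMeasure hG hv (fun x => ?_) fun x => ?_
    · simp only [inner_sub_right, inner_smul_right]
      rw [integral_sub ((hZ.memLp_inner h0 x).integrable (by norm_num))
        (((hZ.memLp_inner hs x).integrable (by norm_num)).const_mul _),
        integral_const_mul, hZ.integral_inner h0, hZ.integral_inner hs, mul_zero, sub_zero]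
    · have hm : AEMeasurable (fun ω => ⟪x, Z 0 ω - (c₁ / c₀) • Z (T / 2) ω⟫_ℝ) P :=
        aemeasurable_const.inner hG.aemeasurable
      rw [← covariance_self hm, hZ.covariance_inner_sub_smul h0 hs h0 hs, sub_self, sub_self,
        abs_zero, zero_sub, abs_neg, sub_zero, abs_of_nonneg hs.1, ← hc₀, ← hc₁,
        real_inner_self_eq_norm_sq]
      field_simp
      ring
  have hη : Measurable fun ω => Z 0 ω - (c₁ / c₀) • Z (T / 2) ω :=
    (hmeas 0 h0).sub ((hmeas _ hs).const_smul (c₁ / c₀))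
  have hcond := condExp_add_of_indep (present_le (hmeas _ hs)) (P := P)
    ((comap_measurable (Z (T / 2))).const_smul (c₁ / c₀)) hη hind
    hbc.stronglyMeasurable (fun x => (hb1 x).le)
  -- both sides of the Markov property at time `T / 2` for the time `T`
  have hmk := hM b hbc.measurable ⟨1, fun x => (hb1 x).le⟩ (T / 2) T hs.1 (by linarith) le_rfl
  have hTT : (fun ω => b (Z T ω)) =ᵐ[P] fun ω => b (Z 0 ω) := by
    filter_upwards [hZ.ae_eq_endpoints hT] with ω hω
    rw [hω]
  have hpast : past Z (T / 2) ≤ ‹MeasurableSpace Ω› :=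
    iSup₂_le fun u hu => (hmeas u ⟨hu.1, hu.2.trans hs.2⟩).comap_le
  have hZ0 : Measurable[past Z (T / 2)] (Z 0) :=
    (comap_measurable (Z 0)).mono
      (le_iSup₂ (f := fun τ (_ : τ ∈ Set.Icc 0 (T / 2)) =>
        MeasurableSpace.comap (Z τ) inferInstance) 0 ⟨le_rfl, hs.1⟩) le_rfl
  have hself : P[fun ω => b (Z 0 ω) | past Z (T / 2)] = fun ω => b (Z 0 ω) :=
    condExp_of_stronglyMeasurable hpast (hbc.stronglyMeasurable.comp_measurable hZ0)
      (Integrable.of_bound (hbc.measurable.comp (hmeas 0 h0)).aestronglyMeasurable 1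
        (Eventually.of_forall fun ω => (hb1 _).le))
  have hfinal : ∀ᵐ ω ∂P, (1 : ℝ) = Real.exp (-((c₀ - c₁ ^ 2 / c₀) / 2)) := by
    have e1 := (condExp_congr_ae (m := past Z (T / 2)) hTT).symm.trans hmk
    rw [hself] at e1
    have e2 := condExp_congr_ae (m := present Z (T / 2)) hTT
    simp only [Pi.smul_apply, add_sub_cancel] at hcond
    filter_upwards [e1, e2, hcond] with ω h1 h2 h3
    rw [← hb1 (Z 0 ω), h1, h2, h3, hmap]
    have h4 : ∀ y, b ((c₁ / c₀) • Z (T / 2) ω + y)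
        = b ((c₁ / c₀) • Z (T / 2) ω) * Complex.exp ((⟪y, e⟫_ℝ : ℝ) * Complex.I) := fun y => by
      simp only [b, inner_add_left, Complex.ofReal_add, add_mul, Complex.exp_add]
    simp_rw [h4]
    rw [integral_const_mul, norm_mul, hb1, one_mul, ← charFun_apply, charFun_gaussMeasure hv, he1,
      Complex.norm_exp, Complex.neg_re, Complex.ofReal_re]
    simp
  obtain ⟨ω, hω⟩ := hfinal.exists
  have : Real.exp (-((c₀ - c₁ ^ 2 / c₀) / 2)) < 1 := Real.exp_lt_one_iff.mpr (by linarith)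
  linarith

end IsPeriodicGaussian

/-! ### Expectations of observables -/

namespace IsPeriodicGaussian

variable {d : ℕ} {Ω : Type*} [MeasurableSpace Ω] {P : Measure Ω}
variable {lam T : ℝ} {Z : ℝ → Ω → E d}

lemma measure_preimage [IsProbabilityMeasure P] (hZ : IsPeriodicGaussian lam T Z P)
    (hlam : 0 < lam) (hT : 0 < T) {t : ℝ} (ht : t ∈ Set.Icc 0 T) (hm : Measurable (Z t))
    {F : Set (E d)} (hF : MeasurableSet F) :
    P (Z t ⁻¹' F) = ∫⁻ x in F, ENNReal.ofReal (gaussianDensity lam T x) := by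
  rw [← Measure.map_apply hm hF, hZ.map_eq hlam hT ht, gaussMeasure, withDensity_apply _ hF]
  rfl

lemma integrable_coord_mul_coord [IsProbabilityMeasure P] (hZ : IsPeriodicGaussian lam T Z P)
    {s t : ℝ} (hs : s ∈ Set.Icc 0 T) (ht : t ∈ Set.Icc 0 T) (i j : Fin d) :
    Integrable (fun ω => Z s ω i * Z t ω j) P := by
  have h := (hZ.memLp_inner hs (EuclideanSpace.single i 1)).integrable_mul
    (hZ.memLp_inner ht (EuclideanSpace.single j 1))
  simpa [Pi.mul_def, EuclideanSpace.inner_single_left] using h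

lemma integral_coord_mul_coord [IsProbabilityMeasure P] (hZ : IsPeriodicGaussian lam T Z P)
    {s t : ℝ} (hs : s ∈ Set.Icc 0 T) (ht : t ∈ Set.Icc 0 T) (i j : Fin d) :
    ∫ ω, Z s ω i * Z t ω j ∂P = periodicCov lam T |t - s| * (if i = j then 1 else 0) := by
  have h := hZ.integral_inner_mul_inner hs ht (EuclideanSpace.single i 1)
    (EuclideanSpace.single j 1)
  simpa [EuclideanSpace.inner_single_left, Pi.single_apply] using h

lemma integral_observable [IsProbabilityMeasure P] (hZ : IsPeriodicGaussian lam T Z P)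
    (hlam : 0 < lam) (hT : 0 < T) {t : ℝ} (ht : t ∈ Set.Icc 0 T) (hm : Measurable (Z t))
    {b : E d → ℝ} (hb : MemLp b ∞ volume) :
    Integrable (fun ω => b (Z t ω)) P ∧
      ∫ ω, b (Z t ω) ∂P = ∫ x, b x * gaussianDensity lam T x := by
  have hmap := hZ.map_eq hlam hT ht
  have hac : P.map (Z t) ≪ volume := by
    rw [hmap, gaussMeasure]
    exact withDensity_absolutelyContinuous _ _
  have hbm : AEStronglyMeasurable b (P.map (Z t)) := hb.1.mono_ac hac
  constructor
  · obtain ⟨C, -, hC⟩ := memLp_top_bound hb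
    exact Integrable.of_bound (hbm.comp_aemeasurable hm.aemeasurable) C
      (ae_of_ae_map hm.aemeasurable (hac.ae_le hC))
  · rw [← integral_map hm.aemeasurable hbm, hmap, gaussMeasure,
      integral_withDensity_eq_integral_toReal_smul
        (continuous_gaussDensity _).measurable.ennreal_ofReal
        (Eventually.of_forall fun _ => ENNReal.ofReal_lt_top)]
    refine integral_congr_ae (Eventually.of_forall fun x => ?_)
    simp only
    rw [ENNReal.toReal_ofReal (gaussDensity_pos (oscVariance_pos hlam hT) x).le, smul_eq_mul,
      mul_comm, gaussianDensity_eq]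

end IsPeriodicGaussian

end PeriodicOU

end

/-- The mixed Bernstein process of the isotropic harmonic oscillator with Hermite data and Gibbs
weights. -/
theorem theorem6 (d : ℕ) (hd : 1 ≤ d) (lam T : ℝ) (hlam : 0 < lam) (hT : 0 < T) :
    -- The oscillator: the Hermite functions are eigenfunctions of `-Δ/2 + λ²|x|²/2`, and Mehler's
    -- kernel is the integral kernel of the corresponding semigroup.
    (∀ (m : Fin d → ℕ) (x : E d),
      -(1 / 2) * Laplacian.laplacian (hermiteFn lam m) x
        + lam ^ 2 / 2 * ‖x‖ ^ 2 * hermiteFn lam m x = energy lam m * hermiteFn lam m x) ∧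
    (∀ (x y : E d) (t : ℝ), 0 < t →
      HasSum (fun m : Fin d → ℕ => Real.exp (-(t * energy lam m)) * hermiteFn lam m x *
        hermiteFn lam m y) (mehler lam x t y)) ∧
    -- The Gibbs weights are a probability on the levels, and the endpoint measure is the
    -- corresponding mixture of the signed measures of the levels.
    (∀ m : Fin d → ℕ, 0 < gibbsWeight lam T m) ∧
    HasSum (fun m : Fin d → ℕ => gibbsWeight lam T m) 1 ∧
    IsProbabilityMeasure (mixedMeasure d lam T) ∧
    (∀ m : Fin d → ℕ, Integrable (levelDensity lam T m) volume) ∧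
    (∀ F₀ FT : Set (E d), MeasurableSet F₀ → MeasurableSet FT →
      HasSum (fun m : Fin d → ℕ => gibbsWeight lam T m * ∫ p in F₀ ×ˢ FT, levelDensity lam T m p)
        ((mixedMeasure d lam T).real (F₀ ×ˢ FT))) ∧
    -- The Gibbs density operator.
    (∀ f : L2 d, HasSum (fun m : Fin d → ℕ =>
      ((gibbsWeight lam T m : ℂ) * ⟪hermiteL2 hlam m, f⟫_ℂ) • hermiteL2 hlam m)
      (densityOperator d hlam T f)) ∧
    -- The process exists on some complete probability space.
    (∃ (Ω : Type) (_ : MeasurableSpace Ω) (P : Measure Ω) (Z : ℝ → Ω → E d),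
      IsProbabilityMeasure P ∧ P.IsComplete ∧
        IsGeneratedBy (mehler lam) T (mixedMeasure d lam T) Z P) ∧
    -- Every realization of it has the following properties.
    (∀ (Ω : Type*) [MeasurableSpace Ω] (P : Measure Ω) [IsProbabilityMeasure P]
      (Z : ℝ → Ω → E d), IsGeneratedBy (mehler lam) T (mixedMeasure d lam T) Z P →
      IsBernstein T Z P ∧ HasTransition (mehler lam) T Z P ∧
      IsStationary T Z P ∧ ¬ IsMarkov T Z P ∧
      IsGaussianProcess (fun t : Set.Icc (0 : ℝ) T => Z t) P ∧
      (∀ t ∈ Set.Icc 0 T, Integrable (Z t) P ∧ ∫ ω, Z t ω ∂P = 0) ∧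
      -- The one-time marginals.
      (∀ t ∈ Set.Icc 0 T, ∀ F : Set (E d), MeasurableSet F →
        P (Z t ⁻¹' F) = ∫⁻ x in F, ENNReal.ofReal (gaussianDensity lam T x)) ∧
      -- The covariance.
      (∀ s ∈ Set.Icc 0 T, ∀ t ∈ Set.Icc 0 T, ∀ i j : Fin d,
        Integrable (fun ω => Z s ω i * Z t ω j) P ∧
        ∫ ω, Z s ω i * Z t ω j ∂P =
          Real.cosh (lam * (|t - s| - T / 2)) / (2 * lam * Real.sinh (lam * T / 2)) *
            (if i = j then 1 else 0)) ∧
      -- Traces against the density operator are expectations.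
      (∀ (b : E d → ℝ) (hb : MemLp b ∞ volume), ∀ t ∈ Set.Icc 0 T,
        Integrable (fun ω => b (Z t ω)) P ∧
        HasTrace (densityOperator d hlam T ∘L mulOperator b hb)
          ((∫ ω, b (Z t ω) ∂P : ℝ) : ℂ) ∧
        ∫ ω, b (Z t ω) ∂P = ∫ x, b x * gaussianDensity lam T x) ∧
      -- Identity in law with the periodic Ornstein-Uhlenbeck process.
      (∀ (Ω' : Type*) [MeasurableSpace Ω'] (P' : Measure Ω') [IsProbabilityMeasure P']
        (W : ℝ≥0 → Ω' → E d), IsWiener W P' →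
        (∃ X : ℝ → Ω' → E d, IsPeriodicOU lam T W P' X) ∧
        ∀ X : ℝ → Ω' → E d, IsPeriodicOU lam T W P' X → SameLaw T Z P X P')) := by
  refine ⟨oscillator_hermiteFn hlam, fun x y t ht => hasSum_mehler hlam ht x y,
    gibbsWeight_pos hlam hT, hasSum_gibbsWeight hlam hT,
    isProbabilityMeasure_mixedMeasure hlam hT, integrable_levelDensity hlam hT,
    fun F₀ FT h₀ h₁ => hasSum_mixedMeasure hlam hT h₀ h₁, hasSum_densityOperator hlam hT,
    exists_isGeneratedBy_isComplete d hlam hT, ?_⟩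
  intro Ω _ P _ Z hgen
  have hZ := hgen.isPeriodicGaussian hlam hT
  have hm := hgen.measurable
  refine ⟨hZ.isBernstein hm hlam, hZ.hasTransition hm hlam, hZ.isStationary,
    hZ.not_isMarkov hm hlam hT hd, hZ.isGaussianProcess,
    fun t ht => ⟨(hZ.hasGaussianLaw ht).integrable, hZ.integral_eq_zero ht⟩,
    fun t ht F hF => hZ.measure_preimage hlam hT ht (hm t ht) hF,
    fun s hs t ht i j => ⟨hZ.integrable_coord_mul_coord hs ht i j,
      hZ.integral_coord_mul_coord hs ht i j⟩,
    fun b hb t ht => ?_, fun Ω' _ P' _ W hW => ⟨exists_isPeriodicOU hW hlam hT,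
      fun X hX => hZ.sameLaw (isPeriodicGaussian_of_isPeriodicOU hW hlam hT hX)⟩⟩
  obtain ⟨h1, h2⟩ := hZ.integral_observable hlam hT ht (hm t ht) hb
  refine ⟨h1, ?_, h2⟩
  rw [h2]
  exact hasTrace_densityOperator_comp hlam hT b hb
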